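/- **Setting.** Everything is over $\mathbb C$. Let $\mathfrak g$ be a simple finite-dimensional Lie superalgebra with a non-degenerate even supersymmetric invariant bilinear form $(\cdot|\cdot)$, and write $p$ for parity. Let $x,f\in\mathfrak g$ be even, such that $\operatorname{ad}x$ is diagonalizable with eigenvalues in $\frac12\mathbb Z$, with eigenspace decomposition $\mathfrak g=\bigoplus_{j\in\frac12\mathbb Z}\mathfrak g_j$; $[x,f]=-f$; and $\operatorname{ad}f:\mathfrak g_{1/2}\to\mathfrak g_{-1/2}$ is bijective. Put $\mathfrak g_+=\bigoplus_{j>0}\mathfrak g_j$ and $\mathfrak g_0^f=\{v\in\mathfrak g_0:[f,v]=0\}$. Let $h^\vee$ be half of the eigenvalue of the Casimir operator $\sum_i(-1)^{p(a_i)}(\operatorname{ad} a_i)(\operatorname{ad} a^i)$ on $\mathfrak g$, where $\{a_i\},\{a^i\}$ are bases with $(a_i|a^j)=\delta_{ij}$ and the $a_i$ are homogeneous, and let $k\in\mathbb C$ with $k+h^\vee\ne0$. For a subspace $W$ stable under $T$ and under the parity operator $\Gamma$ (acting as $(-1)^{p}$), $\operatorname{str}_W T=\operatorname{tr}_W(\Gamma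 T)$. *The complex.* Let $\mathcal C=V_k(\mathfrak g)\otimes F^{\rm ch}\otimes F^{\rm ne}$ be the vertex algebra strongly generated by: currents $a\in\mathfrak g$ with $[a_\lambda b]=[a,b]+\lambda k(a|b)$; charged ghosts $\varphi\in\Pi\mathfrak g_+$, $\varphi^*\in\Pi\mathfrak g_+^*$ ($\Pi$ is parity reversal) with $[\varphi_\lambda\varphi^*]=\varphi^*(\varphi)$, $[\varphi^*{}_\lambda\varphi]=-(-1)^{p(\varphi)p(\varphi^*)}\varphi^*(\varphi)$ (parities taken in $\Pi\mathfrak g_+$, $\Pi\mathfrak g_+^*$); neutral ghosts $\Phi_a$, $a\in\mathfrak g_{1/2}$, with $[\Phi_{a\,\lambda}\Phi_b]=\langle a,b\rangle:=(f|[a,b])$; all other $\lambda$-brackets of generators vanish. Its state space is the quotient of the algebra of modes by the left ideal generated by the modes $a_{(n)}$, $n\ge0$, of the generators. Here, for fields $a(z)=\sum_n a_{(n)}z^{-n-1}$, $[a_\lambda b]=\sum_{n\ge0}\frac{\lambda^n}{n!}a_{(n)}b$ with $a(z)_{(n)}b(z)=\operatorname{Res}_y(y-z)^n[a(y),b(z)]$,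 and $:ab:\,=a(z)_+b(z)+(-1)^{p(a)p(b)}b(z)a(z)_-$ with $a(z)_+=\sum_{n<0}a_{(n)}z^{-n-1}$, $a(z)_-=\sum_{n\ge0}a_{(n)}z^{-n-1}$; products of three fields are nested from the right. The charge grading $\mathcal C=\bigoplus_m\mathcal C_m$ gives the $\varphi$ charge $1$, the $\varphi^*$ charge $-1$ and the other generators charge $0$. Choose a basis $\{u_i\}$ of $\mathfrak g$, homogeneous in parity and with $[x,u_i]=m_iu_i$; let $S=\{i:m_i>0\}$ and $S'=\{i:m_i=\frac12\}$, let $\{u^i\}$ be the dual basis, $(u_i|u^j)=\delta_{ij}$, and let $[u_i,u_j]=\sum_\ell c_{ij}^\ell u_\ell$, $[v,u_j]=\sum_i c_{ij}(v)u_i$. Let $\{\varphi_i\}_{i\in S}$, $\{\varphi_i^*\}_{i\in S}$ be the corresponding dual bases of ghosts, $\Phi_i=\Phi_{u_i}$ $(i\in S')$, and $\Phi^i$ the neutral ghosts with $\langle\Phi_i,\Phi^j\rangle=\delta_{ij}$. Put $$d=\sum_{i\in S}(-1)^{p(u_i)}:u_i\varphi_i^*:-\tfrac12\sum_{i,j,\ell\in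 S}(-1)^{p(u_i)p(u_\ell)}c_{ij}^\ell:\varphi_\ell\varphi_i^*\varphi_j^*:+\sum_{i\in S}(f|u_i)\varphi_i^*+\sum_{i\in S'}:\varphi_i^*\Phi_i:,$$ $d_0=\operatorname{Res}_z d(z)$, and let $W_k(\mathfrak g,x,f)$ be the $0$-th homology of $(\mathcal C,d_0)$, i.e. $\{c\in\mathcal C_0:d_0c=0\}$ modulo $d_0\mathcal C_1$; its fields are those induced by the fields of charge $0$ of $\mathcal C$ that supercommute with $d_0$. Put $$L=\tfrac1{2(k+h^\vee)}\sum_i(-1)^{p(u_i)}:u_iu^i:+\partial x-\sum_{i\in S}m_i:\varphi_i^*\partial\varphi_i:+\sum_{i\in S}(1-m_i):(\partial\varphi_i^*)\varphi_i:+\tfrac12\sum_{i\in S'}:(\partial\Phi^i)\Phi_i:,$$ and for $v\in\mathfrak g$ $$v^{\rm ch}=-\sum_{i,j\in S}(-1)^{p(\varphi_i)}c_{ij}(v):\varphi_i\varphi_j^*:,\qquad v^{\rm ne}=-\tfrac12\sum_{i,j\in S'}(-1)^{p(\Phi_i)}c_{ij}(v):\Phi_i\Phi^j:,$$ where $p(\varphi_i)=p(u_i)+1$,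 $p(\Phi_i)=p(u_i)$, and $$J^{(v)}=v+v^{\rm ch},\qquad J^{\{v\}}=v+v^{\rm ch}+v^{\rm ne}.$$ **Theorem.** (a) If $v\in\mathfrak g_0^f$, then $[d_\lambda J^{\{v\}}]=0$; hence the modes of $J^{\{v\}}$ induce operators on $W_k(\mathfrak g,x,f)$, and the image of $J^{\{v\}}$ is a field of the vertex algebra $W_k(\mathfrak g,x,f)$. (b) If $v\in\mathfrak g_j$, then $$[L_\lambda J^{(v)}]=(\partial+(1-j)\lambda)J^{(v)}+\delta_{j0}\lambda^2\Big(\tfrac12\operatorname{str}_{\mathfrak g_+}(\operatorname{ad}v)-(k+h^\vee)(v|x)\Big),$$ and the same formula holds for $J^{\{v\}}$ (with $j=0$) if $v\in\mathfrak g_0$. (c) If $v,v'\in\mathfrak g_0^f$, then $$[J^{\{v\}}{}_\lambda J^{\{v'\}}]=J^{\{[v,v']\}}+\lambda\Big(k(v|v')+\operatorname{str}_{\mathfrak g_+}(\operatorname{ad}v)(\operatorname{ad}v')-\tfrac12\operatorname{str}_{\mathfrak g_{1/2}}(\operatorname{ad}v)(\operatorname{ad}v')\Big).$$ If $v\in\mathfrak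 g_i$, $v'\in\mathfrak g_j$ and $ij\ge0$, then $$[J^{(v)}{}_\lambda J^{(v')}]=J^{([v,v'])}+\delta_{i0}\delta_{j0}\lambda\Big(k(v|v')+\operatorname{str}_{\mathfrak g_+}(\operatorname{ad}v)(\operatorname{ad}v')\Big).$$ -/

import Mathlib

noncomputable section

namespace QRed

open HVertexOperator

/-! ## Signs, Lie superalgebras -/

/-- The sign `(-1)^p` of a parity `p ∈ ℤ/2`. -/
def sg (p : ZMod 2) : ℂ := if p = 0 then 1 else -1

/-- A complex Lie superalgebra.  The `ℤ/2`-grading is given by its parity operator, which acts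
on the part of parity `p` as `(-1)^p`; thus `a` has parity `p` iff `parity a = (-1)^p a`. -/
class LieSuperalgebra (g : Type*) [AddCommGroup g] [Module ℂ g] where
  parity : g →ₗ[ℂ] g
  parity_parity : ∀ a, parity (parity a) = a
  br : g →ₗ[ℂ] g →ₗ[ℂ] g
  parity_br : ∀ a b, parity (br a b) = br (parity a) (parity b)
  skew : ∀ (p q : ZMod 2) (a b : g), parity a = sg p • a → parity b = sg q • b →
    br a b = -(sg (p * q) • br b a)
  jacobi : ∀ (p q : ZMod 2) (a b c : g), parity a = sg p • a → parity b = sg q • b →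
    br a (br b c) = br (br a b) c + sg (p * q) • br b (br a c)

open LieSuperalgebra (parity br)

/-- Simplicity: not abelian, and no graded ideals except `0` and the whole algebra. -/
def IsSimple (g : Type*) [AddCommGroup g] [Module ℂ g] [LieSuperalgebra g] : Prop :=
  (∃ a b : g, br a b ≠ 0) ∧
  ∀ I : Submodule ℂ g, (∀ a ∈ I, parity a ∈ I) → (∀ (a : g), ∀ b ∈ I, br a b ∈ I) →
    I = ⊥ ∨ I = ⊤

open Classical in
/-- The supertrace `str_W T = tr_W (Γ T)` of an operator over a subspace `W` stable under `Γ T`. -/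
def strOn {g : Type*} [AddCommGroup g] [Module ℂ g] [LieSuperalgebra g]
    (W : Submodule ℂ g) (T : g →ₗ[ℂ] g) : ℂ :=
  if h : ∀ w ∈ W, ((parity : g →ₗ[ℂ] g) ∘ₗ T) w ∈ W then
    LinearMap.trace ℂ W (((parity : g →ₗ[ℂ] g) ∘ₗ T).restrict h)
  else 0

/-! ## Fields on a vector superspace

A field is a `VertexOperator ℂ V`; its mode `a_(n)`, the coefficient of `z^(-n-1)`, is
`VertexOperator.ncoeff a n`. -/

section Fields

variable {V : Type*} [AddCommGroup V] [Module ℂ V]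

/-- The field with prescribed modes `a_(n)`. -/
def mkField (a : ℤ → Module.End ℂ V) (h : ∀ v, ∃ N : ℤ, ∀ n ≥ N, a n v = 0) :
    VertexOperator ℂ V :=
  VertexOperator.of_coeff (fun n => a (-n - 1)) fun v => by
    obtain ⟨N, hN⟩ := h v
    refine ⟨-N - 1, fun n hn => ?_⟩
    by_contra hlt
    exact hn (hN (-n - 1) (by omega))

@[simp] theorem ncoeff_mkField (a : ℤ → Module.End ℂ V)
    (h : ∀ v, ∃ N : ℤ, ∀ n ≥ N, a n v = 0) (n : ℤ) :
    VertexOperator.ncoeff (mkField a h) n = a n := by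
  rw [mkField, VertexOperator.ncoeff_of_coeff]
  congr 1
  omega

theorem exists_trunc (a : VertexOperator ℂ V) (v : V) :
    ∃ N : ℤ, ∀ n ≥ N, VertexOperator.ncoeff a n v = 0 := by
  refine ⟨-(HahnSeries.order ((HahnModule.of ℂ).symm (a v))), fun n hn => ?_⟩
  exact VertexOperator.ncoeff_eq_zero_of_lt_order a n v (by omega)

/-- `1` as a field: the only nonzero mode is `1_(-1) = id`. -/
def oneField : VertexOperator ℂ V :=
  mkField (fun n => if n = -1 then 1 else 0) fun _ => ⟨0, fun n hn => by
    rw [if_neg (by omega)]; rfl⟩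

/-- The derivative: `(∂a)_(n) = -n a_(n-1)`. -/
def deriv (a : VertexOperator ℂ V) : VertexOperator ℂ V :=
  mkField (fun n => (-(n : ℂ)) • VertexOperator.ncoeff a (n - 1)) fun v => by
    obtain ⟨N, hN⟩ := exists_trunc a v
    exact ⟨N + 1, fun n hn => by simp [hN (n - 1) (by omega)]⟩

variable (Γ : Module.End ℂ V)

/-- `(-1)^{p(X)p(Y)} Y X`, extended bilinearly to all operators `X`, `Y` on a superspace with
parity operator `Γ` (the parity of an operator is that under `X ↦ Γ X Γ`). -/
def swapMul (X Y : Module.End ℂ V) : Module.End ℂ V :=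
  (1 / 2 : ℂ) • (Y * X + (Γ * Y * Γ) * X + Y * (Γ * X * Γ) - (Γ * Y * Γ) * (Γ * X * Γ))

/-- The supercommutator `[X, Y] = X Y - (-1)^{p(X)p(Y)} Y X`. -/
def scomm (X Y : Module.End ℂ V) : Module.End ℂ V := X * Y - swapMul Γ X Y

theorem swapMul_apply (X Y : Module.End ℂ V) (v : V) :
    swapMul Γ X Y v = (1 / 2 : ℂ) • (Y (X v) + Γ (Y (Γ (X v))) + Y (Γ (X (Γ v)))
      - Γ (Y (Γ (Γ (X (Γ v)))))) := by
  simp [swapMul]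

theorem swapMul_left_trunc (a : VertexOperator ℂ V) (v : V) :
    ∃ N : ℤ, ∀ n ≥ N, ∀ Y : Module.End ℂ V,
      swapMul Γ (VertexOperator.ncoeff a n) Y v = 0 := by
  obtain ⟨N, hN⟩ := exists_trunc a v
  obtain ⟨M, hM⟩ := exists_trunc a (Γ v)
  refine ⟨max N M, fun n hn Y => ?_⟩
  rw [swapMul_apply, hN n (le_trans (le_max_left _ _) hn), hM n (le_trans (le_max_right _ _) hn)]
  simp

theorem swapMul_right_trunc (b : VertexOperator ℂ V) (X : Module.End ℂ V) (v : V) :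
    ∃ N : ℤ, ∀ n ≥ N, swapMul Γ X (VertexOperator.ncoeff b n) v = 0 := by
  obtain ⟨N₁, h₁⟩ := exists_trunc b (X v)
  obtain ⟨N₂, h₂⟩ := exists_trunc b (Γ (X v))
  obtain ⟨N₃, h₃⟩ := exists_trunc b (Γ (X (Γ v)))
  obtain ⟨N₄, h₄⟩ := exists_trunc b (Γ (Γ (X (Γ v))))
  refine ⟨max (max N₁ N₂) (max N₃ N₄), fun n hn => ?_⟩
  have : N₁ ≤ n ∧ N₂ ≤ n ∧ N₃ ≤ n ∧ N₄ ≤ n := by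
    refine ⟨?_, ?_, ?_, ?_⟩ <;> simp only [ge_iff_le, max_le_iff] at hn <;> tauto
  rw [swapMul_apply, h₁ n this.1, h₂ n this.2.1, h₃ n this.2.2.1, h₄ n this.2.2.2]
  simp

/-- The summands of `:ab:_(m)`:
`a_(-j-1) b_(m+j) + (-1)^{p(a)p(b)} b_(m-j-1) a_(j)`, for `j ≥ 0`. -/
def nopTerm (a b : VertexOperator ℂ V) (m : ℤ) (j : ℕ) : Module.End ℂ V :=
  VertexOperator.ncoeff a (-j - 1) * VertexOperator.ncoeff b (m + j)
    + swapMul Γ (VertexOperator.ncoeff a j) (VertexOperator.ncoeff b (m - j - 1))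

theorem nopTerm_finite (a b : VertexOperator ℂ V) (m : ℤ) (v : V) :
    (Function.support fun j : ℕ => nopTerm Γ a b m j v).Finite := by
  obtain ⟨N, hN⟩ := exists_trunc b v
  obtain ⟨M, hM⟩ := swapMul_left_trunc Γ a v
  refine (Set.finite_lt_nat (max (N - m) M).toNat).subset fun j hj => ?_
  by_contra hlt
  simp only [Set.mem_ofPred_eq, not_lt, Int.toNat_le, max_le_iff] at hlt
  apply hj
  simp only [nopTerm, LinearMap.add_apply, Module.End.mul_apply]
  rw [hN (m + j) (by omega), hM j (by omega)]
  simp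

/-- The modes of the normally ordered product
`:a(z)b(z): = a(z)_+ b(z) + (-1)^{p(a)p(b)} b(z) a(z)_-`, where
`a(z)_+ = ∑_{n<0} a_(n) z^(-n-1)` and `a(z)_- = ∑_{n≥0} a_(n) z^(-n-1)`. -/
def nopMode (a b : VertexOperator ℂ V) (m : ℤ) : Module.End ℂ V where
  toFun v := ∑ᶠ j : ℕ, nopTerm Γ a b m j v
  map_add' v w := by
    simp only [map_add]
    exact finsum_add_distrib (nopTerm_finite Γ a b m v) (nopTerm_finite Γ a b m w)
  map_smul' c v := by
    simp only [map_smul, RingHom.id_apply]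
    exact (smul_finsum' c (nopTerm_finite Γ a b m v)).symm

/-- The normally ordered product `:ab:`. -/
def nop (a b : VertexOperator ℂ V) : VertexOperator ℂ V :=
  mkField (nopMode Γ a b) fun v => by
    obtain ⟨N, hN⟩ := exists_trunc b v
    obtain ⟨M, hM⟩ := swapMul_left_trunc Γ a v
    choose K hK using fun j : ℕ => swapMul_right_trunc Γ b (VertexOperator.ncoeff a j) v
    obtain ⟨R, hR⟩ := ((Finset.range M.toNat).image fun j => K j + j + 1).exists_le
    refine ⟨max N R, fun m hm => finsum_eq_zero_of_forall_eq_zero fun j => ?_⟩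
    have hmN : N ≤ m := le_trans (le_max_left _ _) hm
    have hmR : R ≤ m := le_trans (le_max_right _ _) hm
    simp only [nopTerm, LinearMap.add_apply, Module.End.mul_apply]
    rw [hN (m + j) (by omega), map_zero, zero_add]
    by_cases hj : M ≤ j
    · exact hM j hj _
    · have := hR (K j + j + 1) (Finset.mem_image_of_mem _ (Finset.mem_range.2 (by omega)))
      exact hK j _ (by omega)

/-- For `n ≥ 0`, the `n`-th product `Res_x (x - z)^n [a(x), b(z)]`, whose `m`-th mode is
`∑_i (-1)^i (n choose i) [a_(n-i), b_(m+i)]`. -/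
def posProd (n : ℕ) (a b : VertexOperator ℂ V) : VertexOperator ℂ V :=
  mkField (fun m => ∑ i ∈ Finset.range (n + 1), ((-1 : ℂ) ^ i * (n.choose i : ℂ)) •
      scomm Γ (VertexOperator.ncoeff a ((n : ℤ) - i)) (VertexOperator.ncoeff b (m + i)))
    fun v => by
      obtain ⟨N, hN⟩ := exists_trunc b v
      choose K hK using fun i : ℕ =>
        swapMul_right_trunc Γ b (VertexOperator.ncoeff a ((n : ℤ) - i)) v
      obtain ⟨R, hR⟩ := ((Finset.range (n + 1)).image K).exists_le
      refine ⟨max N R, fun m hm => ?_⟩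
      have hmN : N ≤ m := le_trans (le_max_left _ _) hm
      have hmR : R ≤ m := le_trans (le_max_right _ _) hm
      rw [LinearMap.sum_apply]
      refine Finset.sum_eq_zero fun i hi => ?_
      have := hR (K i) (Finset.mem_image_of_mem _ hi)
      simp only [scomm, LinearMap.smul_apply, LinearMap.sub_apply, Module.End.mul_apply]
      rw [hN (m + i) (by omega), hK i (m + i) (by omega)]
      simp

/-- The `n`-th product of fields, `n ∈ ℤ`; `a_(-n-1) b = :∂^n a b: / n!` for `n ≥ 0`. -/
def nProd : ℤ → VertexOperator ℂ V → VertexOperator ℂ V → VertexOperator ℂ V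
  | Int.ofNat n, a, b => posProd Γ n a b
  | Int.negSucc n, a, b => ((n.factorial : ℂ)⁻¹) • nop Γ (deriv^[n] a) b

/-- The `λ`-bracket `[a_λ b] = ∑_{n≥0} (λ^n / n!) a_(n) b`, a formal power series in `λ` whose
coefficients are fields, recorded by the sequence of its coefficients. -/
def lbr (a b : VertexOperator ℂ V) : ℕ → VertexOperator ℂ V :=
  fun n => ((n.factorial : ℂ)⁻¹) • nProd Γ n a b

/-- The power series `λ^n c`. -/
def lam (n : ℕ) (c : VertexOperator ℂ V) : ℕ → VertexOperator ℂ V := Pi.single n c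

end Fields

/-! ## The vertex algebra attached to currents with linear `λ`-brackets -/

/-- A superspace `P` (with parity operator `Γ`) of currents whose `λ`-brackets are to be
`[a_λ b] = [a, b] + α(a, b) + λ β(a, b)`, for an even bracket and even bilinear forms. -/
structure CurrentData (P : Type*) [AddCommGroup P] [Module ℂ P] where
  Γ : P →ₗ[ℂ] P
  br : P →ₗ[ℂ] P →ₗ[ℂ] P
  α : P →ₗ[ℂ] P →ₗ[ℂ] ℂ
  β : P →ₗ[ℂ] P →ₗ[ℂ] ℂ
  Γ_Γ : ∀ a, Γ (Γ a) = a
  Γ_br : ∀ a b, Γ (br a b) = br (Γ a) (Γ b)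
  α_Γ : ∀ a b, α (Γ a) (Γ b) = α a b
  β_Γ : ∀ a b, β (Γ a) (Γ b) = β a b

namespace CurrentData

variable {P : Type*} [AddCommGroup P] [Module ℂ P] (D : CurrentData P)

/-- The symbol `a t^n` in the tensor algebra of `P ⊗ ℂ[t, t⁻¹]`. -/
def tgen (a : P) (n : ℤ) : TensorAlgebra ℂ (ℤ →₀ P) :=
  TensorAlgebra.ι ℂ (Finsupp.single n a)

/-- The relations
`[a t^m, b t^n] = [a, b] t^(m+n) + δ_{m+n,-1} α(a, b) + m δ_{m+n,0} β(a, b)`,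
with the supercommutator on the left. -/
inductive Rel : TensorAlgebra ℂ (ℤ →₀ P) → TensorAlgebra ℂ (ℤ →₀ P) → Prop
  | comm (p q : ZMod 2) (a b : P) (m n : ℤ) (ha : D.Γ a = sg p • a) (hb : D.Γ b = sg q • b) :
      Rel (tgen a m * tgen b n)
        (sg (p * q) • (tgen b n * tgen a m) + tgen (D.br a b) (m + n)
          + algebraMap ℂ _ ((if m + n = -1 then D.α a b else 0)
            + (if m + n = 0 then (m : ℂ) * D.β a b else 0)))

/-- The algebra of modes: the enveloping algebra of the affinization, with its central elements
specialized to numbers. -/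
abbrev U : Type _ := RingQuot (Rel D)

/-- The mode `a t^n` in the algebra of modes. -/
def gen (a : P) (n : ℤ) : D.U := RingQuot.mkAlgHom ℂ (Rel D) (tgen a n)

theorem gen_add (a b : P) (n : ℤ) : D.gen (a + b) n = D.gen a n + D.gen b n := by
  simp [gen, tgen]

theorem gen_smul (c : ℂ) (a : P) (n : ℤ) : D.gen (c • a) n = c • D.gen a n := by
  rw [gen, tgen, ← Finsupp.smul_single, map_smul, map_smul]; rfl

theorem gen_mul_gen (p q : ZMod 2) (a b : P) (m n : ℤ)
    (ha : D.Γ a = sg p • a) (hb : D.Γ b = sg q • b) :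
    D.gen a m * D.gen b n = sg (p * q) • (D.gen b n * D.gen a m) + D.gen (D.br a b) (m + n)
      + algebraMap ℂ _ ((if m + n = -1 then D.α a b else 0)
        + (if m + n = 0 then (m : ℂ) * D.β a b else 0)) := by
  have h := RingQuot.mkAlgHom_rel ℂ (Rel.comm (D := D) p q a b m n ha hb)
  simpa only [gen, map_mul, map_add, map_smul, AlgHom.commutes] using h

/-- The parity automorphism on the tensor algebra, with values in the algebra of modes. -/
def parityT : TensorAlgebra ℂ (ℤ →₀ P) →ₐ[ℂ] D.U :=
  TensorAlgebra.lift ℂ ((RingQuot.mkAlgHom ℂ (Rel D)).toLinearMap ∘ₗ TensorAlgebra.ι ℂ ∘ₗ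
    Finsupp.mapRange.linearMap D.Γ)

theorem parityT_tgen (a : P) (n : ℤ) : D.parityT (tgen a n) = D.gen (D.Γ a) n := by
  simp [parityT, tgen, gen]

/-- The parity automorphism of the algebra of modes, `a t^n ↦ (-1)^{p(a)} a t^n`. -/
def parityU : D.U →ₐ[ℂ] D.U :=
  RingQuot.liftAlgHom ℂ ⟨D.parityT, by
    rintro _ _ ⟨p, q, a, b, m, n, ha, hb⟩
    simp only [map_mul, map_add, map_smul, AlgHom.commutes, parityT_tgen]
    rw [D.gen_mul_gen p q (D.Γ a) (D.Γ b) m n (by rw [ha, map_smul, ha])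
      (by rw [hb, map_smul, hb]), D.Γ_br, D.α_Γ, D.β_Γ]
    simp⟩

theorem parityU_gen (a : P) (n : ℤ) : D.parityU (D.gen a n) = D.gen (D.Γ a) n := by
  rw [parityU, gen, RingQuot.liftAlgHom_mkAlgHom_apply, parityT_tgen]

/-- The left ideal generated by the modes `a t^n`, `n ≥ 0`. -/
def annIdeal : Submodule ℂ D.U :=
  Submodule.span ℂ {y | ∃ (u : D.U) (a : P) (n : ℤ), 0 ≤ n ∧ y = u * D.gen a n}

theorem annIdeal_mul (w : D.U) : D.annIdeal ≤ D.annIdeal.comap (LinearMap.mulLeft ℂ w) := by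
  rw [annIdeal, Submodule.span_le]
  rintro _ ⟨u, a, n, hn, rfl⟩
  exact Submodule.subset_span ⟨w * u, a, n, hn, by simp [mul_assoc]⟩

theorem annIdeal_parity : D.annIdeal ≤ D.annIdeal.comap D.parityU.toLinearMap := by
  rw [annIdeal, Submodule.span_le]
  rintro _ ⟨u, a, n, hn, rfl⟩
  exact Submodule.subset_span ⟨D.parityU u, D.Γ a, n, hn, by simp [parityU_gen]⟩

/-- The state space (vacuum module): the quotient of the algebra of modes by the left ideal
generated by the modes `a t^n` with `n ≥ 0`. -/
abbrev V : Type _ := D.U ⧸ D.annIdeal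

/-- The vacuum vector. -/
def vac : D.V := D.annIdeal.mkQ 1

/-- The parity operator of the state space. -/
def ΓV : Module.End ℂ D.V := D.annIdeal.mapQ D.annIdeal D.parityU.toLinearMap D.annIdeal_parity

/-- Left multiplication by an element of the algebra of modes. -/
def act (w : D.U) : Module.End ℂ D.V :=
  D.annIdeal.mapQ D.annIdeal (LinearMap.mulLeft ℂ w) (D.annIdeal_mul w)

theorem act_mk (w u : D.U) : D.act w (D.annIdeal.mkQ u) = D.annIdeal.mkQ (w * u) := rfl

/-- Vectors killed by `a t^n`, for every current `a` and all large `n`. -/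
def truncSub : Submodule ℂ D.U where
  carrier := {u | ∀ a : P, ∃ N : ℤ, ∀ n ≥ N, D.gen a n * u ∈ D.annIdeal}
  add_mem' {u w} hu hw a := by
    obtain ⟨N, hN⟩ := hu a
    obtain ⟨M, hM⟩ := hw a
    refine ⟨max N M, fun n hn => ?_⟩
    rw [mul_add]
    exact add_mem (hN n (le_trans (le_max_left _ _) hn)) (hM n (le_trans (le_max_right _ _) hn))
  zero_mem' a := ⟨0, fun n _ => by simp⟩
  smul_mem' c u hu a := by
    obtain ⟨N, hN⟩ := hu a
    exact ⟨N, fun n hn => by rw [mul_smul_comm]; exact Submodule.smul_mem _ _ (hN n hn)⟩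

theorem exists_homogeneous (a : P) :
    ∃ a₀ a₁ : P, a = a₀ + a₁ ∧ D.Γ a₀ = sg 0 • a₀ ∧ D.Γ a₁ = sg 1 • a₁ := by
  refine ⟨(1 / 2 : ℂ) • (a + D.Γ a), (1 / 2 : ℂ) • (a - D.Γ a), ?_, ?_, ?_⟩
  · rw [← smul_add, add_add_sub_cancel, ← two_smul ℂ a, smul_smul]; norm_num
  · simp [sg, D.Γ_Γ, add_comm]
  · simp only [sg, map_smul, map_sub, D.Γ_Γ, one_ne_zero, if_false, neg_smul, one_smul, ← smul_neg,
      neg_sub]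

theorem gen_mul_mem_truncSub (b : P) (m : ℤ) {u : D.U} (hu : u ∈ D.truncSub) :
    D.gen b m * u ∈ D.truncSub := by
  have key : ∀ (p q : ZMod 2) (a b : P), D.Γ a = sg p • a → D.Γ b = sg q • b →
      ∃ N : ℤ, ∀ n ≥ N, D.gen a n * (D.gen b m * u) ∈ D.annIdeal := by
    intro p q a b ha hb
    obtain ⟨N, hN⟩ := hu a
    obtain ⟨M, hM⟩ := hu (D.br a b)
    refine ⟨max (max N (M - m)) (1 - m), fun n hn => ?_⟩
    have h : N ≤ n ∧ M - m ≤ n ∧ 1 - m ≤ n := by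
      simp only [ge_iff_le, max_le_iff] at hn; tauto
    rw [← mul_assoc, D.gen_mul_gen p q a b n m ha hb, if_neg (by omega), if_neg (by omega)]
    simp only [add_zero, map_zero, add_mul, smul_mul_assoc, mul_assoc]
    refine add_mem (Submodule.smul_mem _ _ (D.annIdeal_mul _ (hN n h.1))) (hM _ (by omega))
  intro a
  obtain ⟨a₀, a₁, rfl, ha₀, ha₁⟩ := D.exists_homogeneous a
  obtain ⟨b₀, b₁, rfl, hb₀, hb₁⟩ := D.exists_homogeneous b
  obtain ⟨N₁, h₁⟩ := key _ _ _ _ ha₀ hb₀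
  obtain ⟨N₂, h₂⟩ := key _ _ _ _ ha₀ hb₁
  obtain ⟨N₃, h₃⟩ := key _ _ _ _ ha₁ hb₀
  obtain ⟨N₄, h₄⟩ := key _ _ _ _ ha₁ hb₁
  refine ⟨max (max N₁ N₂) (max N₃ N₄), fun n hn => ?_⟩
  simp only [ge_iff_le, max_le_iff] at hn
  simp only [gen_add, add_mul, mul_add]
  exact add_mem (add_mem (h₁ n (by tauto)) (h₃ n (by tauto)))
    (add_mem (h₂ n (by tauto)) (h₄ n (by tauto)))

theorem mem_truncSub (u : D.U) : u ∈ D.truncSub := by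
  have h1 : (1 : D.U) ∈ D.truncSub := fun a =>
    ⟨0, fun n hn => Submodule.subset_span ⟨1, a, n, hn, by simp⟩⟩
  have key : ∀ (t : TensorAlgebra ℂ (ℤ →₀ P)) (w : D.U), w ∈ D.truncSub →
      RingQuot.mkAlgHom ℂ (Rel D) t * w ∈ D.truncSub := by
    intro t
    induction t using TensorAlgebra.induction with
    | algebraMap r =>
      intro w hw
      rw [AlgHom.commutes, ← Algebra.smul_def]
      exact Submodule.smul_mem _ _ hw
    | ι x =>
      intro w hw
      induction x using Finsupp.induction_linear with
      | zero => simp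
      | add x y hx hy => simp only [map_add, add_mul]; exact add_mem hx hy
      | single n a => exact D.gen_mul_mem_truncSub a n hw
    | mul s t hs ht => intro w hw; rw [map_mul, mul_assoc]; exact hs _ (ht _ hw)
    | add s t hs ht => intro w hw; rw [map_add, add_mul]; exact add_mem (hs _ hw) (ht _ hw)
  obtain ⟨t, rfl⟩ := RingQuot.mkAlgHom_surjective ℂ (Rel D) u
  simpa using key t 1 h1

/-- The current field `a(z) = ∑_n (a t^n) z^(-n-1)` attached to `a ∈ P`. -/
def field (a : P) : VertexOperator ℂ D.V :=
  mkField (fun n => D.act (D.gen a n)) fun v => by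
    obtain ⟨u, rfl⟩ := D.annIdeal.mkQ_surjective v
    obtain ⟨N, hN⟩ := D.mem_truncSub u a
    exact ⟨N, fun n hn => by
      rw [act_mk]; exact (Submodule.Quotient.mk_eq_zero _).2 (hN n hn)⟩

end CurrentData

/-! ## Quantum reduction -/

section Reduction

variable {g : Type*} [AddCommGroup g] [Module ℂ g] [LieSuperalgebra g]

/-- The eigenspace `g_j` of `ad x`, for the half-integer `j = n / 2`. -/
def gr (x : g) (n : ℤ) : Submodule ℂ g := Module.End.eigenspace (br x) ((n : ℂ) / 2)

variable (g) in
/-- The data of a quantum reduction: an invariant form on `g`, a pair `(x, f)` and a level `k`. -/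
structure ReductionData where
  form : g →ₗ[ℂ] g →ₗ[ℂ] ℂ
  form_even : ∀ a b, form (parity a) (parity b) = form a b
  form_symm : ∀ (p q : ZMod 2) (a b : g), parity a = sg p • a → parity b = sg q • b →
    form a b = sg (p * q) * form b a
  form_inv : ∀ a b c, form (br a b) c = form a (br b c)
  form_nondeg : ∀ a, (∀ b, form a b = 0) → a = 0
  x : g
  f : g
  x_even : parity x = x
  f_even : parity f = f
  x_diag : ⨆ n : ℤ, gr x n = ⊤
  f_mem : br x f = -f
  f_bij : Set.BijOn (br f) (gr x 1) (gr x (-1))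
  k : ℂ

namespace ReductionData

variable (Q : ReductionData g)

/-- `g_{1/2}`. -/
abbrev gHalf : Submodule ℂ g := gr Q.x 1

/-- `g_+ = ⨁_{j > 0} g_j`. -/
def gPlus : Submodule ℂ g := ⨆ n : {n : ℤ // 0 < n}, gr Q.x n

/-- The elements of degree zero centralizing `f`. -/
def centralizer₀ : Submodule ℂ g := gr Q.x 0 ⊓ LinearMap.ker (br Q.f)

theorem parity_mem_gr (n : ℤ) {a : g} (ha : a ∈ gr Q.x n) : parity a ∈ gr Q.x n := by
  simp only [gr, Module.End.mem_eigenspace_iff] at ha ⊢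
  have h := LieSuperalgebra.parity_br Q.x a
  rw [Q.x_even] at h
  rw [← h, ha, map_smul]

theorem parity_mem_gPlus {a : g} (ha : a ∈ Q.gPlus) : parity a ∈ Q.gPlus := by
  have : Q.gPlus ≤ Q.gPlus.comap parity := by
    refine iSup_le fun n a ha => ?_
    exact Submodule.mem_iSup_of_mem n (Q.parity_mem_gr n ha)
  exact this ha

/-- The parity operator of `g` on `g_+`. -/
def parityPlus : Q.gPlus →ₗ[ℂ] Q.gPlus := parity.restrict fun _ ha => Q.parity_mem_gPlus ha

/-- The parity operator of `g` on `g_{1/2}`. -/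
def parityHalf : Q.gHalf →ₗ[ℂ] Q.gHalf := parity.restrict fun _ ha => Q.parity_mem_gr 1 ha

/-- The bilinear form `⟨a, b⟩ = (f | [a, b])` on `g_{1/2}`. -/
def formHalf (a b : Q.gHalf) : ℂ := Q.form Q.f (br (a : g) (b : g))

/-- The superspace of generating currents and ghosts: `g ⊕ Πg_+ ⊕ Πg_+^* ⊕ g_{1/2}`. -/
abbrev P : Type _ := g × Q.gPlus × Module.Dual ℂ Q.gPlus × Q.gHalf

/-- The `λ`-brackets of the generators of `V_k(g) ⊗ F^ch ⊗ F^ne`: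
`[a_λ b] = [a, b] + λ k (a | b)` on `g`; on `Πg_+ ⊕ Πg_+^*` the skew-supersymmetric pairing with
`⟨φ, ψ⟩ = ψ(φ)` for `φ ∈ Πg_+`, `ψ ∈ Πg_+^*`, so that `⟨ψ, φ⟩ = -(-1)^{p(ψ)p(φ)} ψ(φ)`, which is
`ψ(Γ φ)` for the parity operator `Γ` of `g`; and `⟨a, b⟩ = (f | [a, b])` on `g_{1/2}`.
The three summands are mutually orthogonal. -/
def currents : CurrentData Q.P where
  Γ := (parity : g →ₗ[ℂ] g).prodMap
    ((-Q.parityPlus).prodMap ((-Q.parityPlus.dualMap).prodMap Q.parityHalf))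
  br := LinearMap.mk₂ ℂ (fun s t => (br s.1 t.1, 0, 0, 0))
    (by intros; simp) (by intros; simp) (by intros; simp) (by intros; simp)
  α := LinearMap.mk₂ ℂ
    (fun s t => t.2.2.1 s.2.1 + s.2.2.1 (Q.parityPlus t.2.1) + Q.formHalf s.2.2.2 t.2.2.2)
    (by intros; simp [formHalf]; ring) (by intros; simp [formHalf]; ring)
    (by intros; simp [formHalf]; ring) (by intros; simp [formHalf]; ring)
  β := LinearMap.mk₂ ℂ (fun s t => Q.k * Q.form s.1 t.1)
    (by intros; simp; ring) (by intros; simp; ring)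
    (by intros; simp; ring) (by intros; simp; ring)
  Γ_Γ s := by
    obtain ⟨a, b, c, d⟩ := s
    have hb : ∀ b, Q.parityPlus (Q.parityPlus b) = b := fun b =>
      Subtype.ext (LieSuperalgebra.parity_parity _)
    have hd : Q.parityHalf (Q.parityHalf d) = d := Subtype.ext (LieSuperalgebra.parity_parity _)
    have hc : Q.parityPlus.dualMap (Q.parityPlus.dualMap c) = c := by
      ext b; simp [hb]
    simp [LieSuperalgebra.parity_parity, hb, hc, hd]
  Γ_br s t := by simp [LieSuperalgebra.parity_br]
  α_Γ s t := by
    have hb : ∀ b, Q.parityPlus (Q.parityPlus b) = b := fun b =>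
      Subtype.ext (LieSuperalgebra.parity_parity _)
    have hd : ∀ a b, Q.formHalf (Q.parityHalf a) (Q.parityHalf b) = Q.formHalf a b := by
      intro a b
      have := Q.form_even Q.f (br (a : g) (b : g))
      rw [Q.f_even, LieSuperalgebra.parity_br] at this
      exact this
    simp [hb, hd]
  β_Γ s t := by simp [Q.form_even]

/-- The space underlying the vertex algebra `C(g, x, f, k) = V_k(g) ⊗ F^ch ⊗ F^ne`. -/
abbrev C : Type _ := Q.currents.V

/-- Fields on `C(g, x, f, k)`. -/
abbrev Fld : Type _ := VertexOperator ℂ Q.C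

/-- The normally ordered product of fields on `C(g, x, f, k)`. -/
def no (a b : Q.Fld) : Q.Fld := nop Q.currents.ΓV a b

/-- The `λ`-bracket of fields on `C(g, x, f, k)`. -/
def bracket (a b : Q.Fld) : ℕ → Q.Fld := lbr Q.currents.ΓV a b

/-- The current attached to `a ∈ g`. -/
def cur (a : g) : Q.Fld := Q.currents.field (a, 0, 0, 0)

/-- The charged ghost attached to `a ∈ Πg_+`. -/
def gh (a : Q.gPlus) : Q.Fld := Q.currents.field (0, a, 0, 0)

/-- The charged ghost attached to `ψ ∈ Πg_+^*`. -/
def ghDual (ψ : Module.Dual ℂ Q.gPlus) : Q.Fld := Q.currents.field (0, 0, ψ, 0)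

/-- The neutral ghost attached to `a ∈ g_{1/2}`. -/
def ghNe (a : Q.gHalf) : Q.Fld := Q.currents.field (0, 0, 0, a)

/-- `HasCharge m v`: the vector `v` lies in the component `C_m` of the charge decomposition. -/
inductive HasCharge : ℤ → Q.C → Prop
  | vac : HasCharge 0 Q.currents.vac
  | zero (m : ℤ) : HasCharge m 0
  | add {m : ℤ} {v w : Q.C} : HasCharge m v → HasCharge m w → HasCharge m (v + w)
  | smul {m : ℤ} (c : ℂ) {v : Q.C} : HasCharge m v → HasCharge m (c • v)
  | cur {m : ℤ} {v : Q.C} (a : g) (n : ℤ) : HasCharge m v →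
      HasCharge m (VertexOperator.ncoeff (Q.cur a) n v)
  | gh {m : ℤ} {v : Q.C} (a : Q.gPlus) (n : ℤ) : HasCharge m v →
      HasCharge (m + 1) (VertexOperator.ncoeff (Q.gh a) n v)
  | ghDual {m : ℤ} {v : Q.C} (ψ : Module.Dual ℂ Q.gPlus) (n : ℤ) : HasCharge m v →
      HasCharge (m - 1) (VertexOperator.ncoeff (Q.ghDual ψ) n v)
  | ghNe {m : ℤ} {v : Q.C} (a : Q.gHalf) (n : ℤ) : HasCharge m v →
      HasCharge m (VertexOperator.ncoeff (Q.ghNe a) n v)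

/-- The component `C_m` of the charge decomposition of the state space. -/
def charge (m : ℤ) : Submodule ℂ Q.C where
  carrier := {v | Q.HasCharge m v}
  add_mem' := HasCharge.add
  zero_mem' := HasCharge.zero m
  smul_mem' c _ h := HasCharge.smul c h

/-- `IsVField m a`: the field `a` belongs to the component of charge `m` of the vertex algebra of
fields generated by the currents and ghosts, i.e. of the smallest space of fields that contains
`1` and these generators and is closed under `∂` and all `n`-th products. -/
inductive IsVField : ℤ → Q.Fld → Prop
  | one : IsVField 0 oneField
  | zero (m : ℤ) : IsVField m 0
  | add {m : ℤ} {a b : Q.Fld} : IsVField m a → IsVField m b → IsVField m (a + b)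
  | smul {m : ℤ} (c : ℂ) {a : Q.Fld} : IsVField m a → IsVField m (c • a)
  | deriv {m : ℤ} {a : Q.Fld} : IsVField m a → IsVField m (deriv a)
  | nProd {m m' : ℤ} {a b : Q.Fld} (n : ℤ) : IsVField m a → IsVField m' b →
      IsVField (m + m') (nProd Q.currents.ΓV n a b)
  | cur (a : g) : IsVField 0 (Q.cur a)
  | gh (a : Q.gPlus) : IsVField 1 (Q.gh a)
  | ghDual (ψ : Module.Dual ℂ Q.gPlus) : IsVField (-1) (Q.ghDual ψ)
  | ghNe (a : Q.gHalf) : IsVField 0 (Q.ghNe a)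

theorem mem_gHalf {n : ℤ} (hn : n = 1) {a : g} (ha : a ∈ gr Q.x n) :
    a ∈ Q.gHalf := by
  subst hn; exact ha

/-- A basis `{u_i}` of `g`, homogeneous for the parity and for the gradation by `ad x`, with its
dual basis `{u^i}` for `(. | .)`, and the dual basis for `⟨. , .⟩` of its part in `g_{1/2}`. -/
structure AdaptedBasis (ι : Type*) [Fintype ι] where
  u : Module.Basis ι ℂ g
  par : ι → ZMod 2
  /-- twice the degree, so that `[x, u_i] = (deg i / 2) u_i` -/
  deg : ι → ℤ
  parity_u : ∀ i, parity (u i) = sg (par i) • u i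
  u_mem : ∀ i, u i ∈ gr Q.x (deg i)
  uDual : ι → g
  form_u : ∀ i j, Q.form (u i) (uDual j) = open Classical in if i = j then 1 else 0
  halfDual : {i : ι // deg i = 1} → Q.gHalf
  formHalf_u : ∀ i j : {i : ι // deg i = 1},
    Q.formHalf ⟨u i, mem_gHalf Q i.2 (u_mem i)⟩ (halfDual j) =
      open Classical in if i = j then 1 else 0

namespace AdaptedBasis

variable {Q} {ι : Type*} [Fintype ι] (𝔲 : Q.AdaptedBasis ι)

/-- The index set of the basis of `g_+`. -/
abbrev S : Type _ := {i // 0 < 𝔲.deg i}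

/-- The index set of the basis of `g_{1/2}`. -/
abbrev S' : Type _ := {i // 𝔲.deg i = 1}

/-- `m_i`, where `[x, u_i] = m_i u_i`. -/
def m (i : ι) : ℂ := (𝔲.deg i : ℂ) / 2

/-- The matrix of `ad v`: `[v, u_j] = ∑_i c_ij(v) u_i`. -/
def c (v : g) (i j : ι) : ℂ := 𝔲.u.repr (br v (𝔲.u j)) i

/-- The ghosts `φ_i`. -/
def φ (i : 𝔲.S) : Q.Fld :=
  Q.gh ⟨𝔲.u i, Submodule.mem_iSup_of_mem (⟨𝔲.deg i, i.2⟩ : {n : ℤ // 0 < n}) (𝔲.u_mem i)⟩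

/-- The ghosts `φ_i^*` (the functional is the coordinate `u_i^*`, restricted to `g_+`). -/
def φDual (i : ι) : Q.Fld := Q.ghDual (𝔲.u.coord i ∘ₗ Q.gPlus.subtype)

/-- The ghosts `Φ_i`. -/
def Φ (i : 𝔲.S') : Q.Fld := Q.ghNe ⟨𝔲.u i, Q.mem_gHalf i.2 (𝔲.u_mem i)⟩

/-- The ghosts `Φ^i`. -/
def ΦDual (i : 𝔲.S') : Q.Fld := Q.ghNe (𝔲.halfDual i)

/-- The action `∑_i (-1)^{p(u_i)} (ad u_i)(ad u^i)` of the Casimir operator on `g`. -/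
def casimir : g →ₗ[ℂ] g := ∑ i, sg (𝔲.par i) • (br (𝔲.u i) ∘ₗ br (𝔲.uDual i))

/-- The dual Coxeter number `h^∨`: half of the eigenvalue of the Casimir operator on `g`. -/
def hDual : ℂ := Classical.epsilon fun h => 𝔲.casimir = (2 * h) • LinearMap.id

open Classical in
/-- The field `d(z)`. -/
def d : Q.Fld :=
  ∑ i : 𝔲.S, sg (𝔲.par i) • Q.no (Q.cur (𝔲.u i)) (𝔲.φDual i)
  - (1 / 2 : ℂ) • ∑ i : 𝔲.S, ∑ j : 𝔲.S, ∑ l : 𝔲.S,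
      (sg (𝔲.par i * 𝔲.par l) * 𝔲.c (𝔲.u i) l j) •
        Q.no (𝔲.φ l) (Q.no (𝔲.φDual i) (𝔲.φDual j))
  + ∑ i : 𝔲.S, Q.form Q.f (𝔲.u i) • 𝔲.φDual i
  + ∑ i : 𝔲.S', Q.no (𝔲.φDual i) (𝔲.Φ i)

/-- The Sugawara field of `V_k(g)`. -/
def Lg : Q.Fld := (2 * (Q.k + 𝔲.hDual))⁻¹ •
  ∑ i, sg (𝔲.par i) • Q.no (Q.cur (𝔲.u i)) (Q.cur (𝔲.uDual i))

open Classical in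
/-- The energy-momentum field of the charged ghosts. -/
def Lch : Q.Fld :=
  -∑ i : 𝔲.S, 𝔲.m i • Q.no (𝔲.φDual i) (deriv (𝔲.φ i))
  + ∑ i : 𝔲.S, (1 - 𝔲.m i) • Q.no (deriv (𝔲.φDual i)) (𝔲.φ i)

open Classical in
/-- The energy-momentum field of the neutral ghosts. -/
def Lne : Q.Fld := (1 / 2 : ℂ) • ∑ i : 𝔲.S', Q.no (deriv (𝔲.ΦDual i)) (𝔲.Φ i)

/-- The energy-momentum field `L(z)`. -/
def L : Q.Fld := 𝔲.Lg + deriv (Q.cur Q.x) + 𝔲.Lch + 𝔲.Lne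

open Classical in
/-- `v^ch = -∑_{i,j ∈ S} (-1)^{p(φ_i)} c_ij(v) :φ_i φ_j^*:`, with `p(φ_i) = p(u_i) + 1`. -/
def vch (v : g) : Q.Fld :=
  -∑ i : 𝔲.S, ∑ j : 𝔲.S, (sg (𝔲.par i + 1) * 𝔲.c v i j) • Q.no (𝔲.φ i) (𝔲.φDual j)

open Classical in
/-- `v^ne = -1/2 ∑_{i,j ∈ S'} (-1)^{p(Φ_i)} c_ij(v) :Φ_i Φ^j:`. -/
def vne (v : g) : Q.Fld :=
  -((1 / 2 : ℂ) • ∑ i : 𝔲.S', ∑ j : 𝔲.S',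
    (sg (𝔲.par i) * 𝔲.c v i j) • Q.no (𝔲.Φ i) (𝔲.ΦDual j))

/-- `J^{(v)} = v + v^ch`. -/
def Jround (v : g) : Q.Fld := Q.cur v + 𝔲.vch v

/-- `J^{{v}} = v + v^ch + v^ne`. -/
def Jcurly (v : g) : Q.Fld := Q.cur v + 𝔲.vch v + 𝔲.vne v

/-- The differential `d_0 = Res_z d(z)` of the complex `C(g, x, f, k)`. -/
def d₀ : Module.End ℂ Q.C := VertexOperator.ncoeff 𝔲.d 0

/-- The `0`-cycles of the complex. -/
def Z₀ : Submodule ℂ Q.C := LinearMap.ker 𝔲.d₀ ⊓ Q.charge 0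

/-- The `0`-boundaries of the complex. -/
def B₀ : Submodule ℂ Q.C := (Q.charge 1).map 𝔲.d₀

/-- The space underlying the vertex algebra `W_k(g, x, f)`: the `0`-th homology of the complex
`(C(g, x, f, k), d_0)`. -/
abbrev W : Type _ := 𝔲.Z₀ ⧸ 𝔲.B₀.submoduleOf 𝔲.Z₀

/-- The field `F` on `W_k(g, x, f)` is the image of the field `a`: the modes of `a` preserve the
`0`-cycles and induce the modes of `F` on homology. -/
def IsImage (a : Q.Fld) (F : VertexOperator ℂ 𝔲.W) : Prop :=
  ∀ (n : ℤ) (z : 𝔲.Z₀), ∃ h : VertexOperator.ncoeff a n (z : Q.C) ∈ 𝔲.Z₀,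
    VertexOperator.ncoeff F n ((𝔲.B₀.submoduleOf 𝔲.Z₀).mkQ z) =
      (𝔲.B₀.submoduleOf 𝔲.Z₀).mkQ ⟨VertexOperator.ncoeff a n (z : Q.C), h⟩

/-- The fields of the vertex algebra `W_k(g, x, f)`: images of those fields of charge `0` of the
vertex algebra `C(g, x, f, k)` that supercommute with `d_0`. -/
def IsWField (F : VertexOperator ℂ 𝔲.W) : Prop :=
  ∃ a : Q.Fld, Q.IsVField 0 a ∧
    (∀ n : ℤ, scomm Q.currents.ΓV 𝔲.d₀ (VertexOperator.ncoeff a n) = 0) ∧ 𝔲.IsImage a F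

end AdaptedBasis

end ReductionData

end Reduction

end QRed
end

noncomputable section
namespace QRed
open LieSuperalgebra (parity br)
open scoped VertexOperator
open Filter

/-! ### Operators on a superspace: parity, supercommutators, Leibniz rules. -/

section Operators

variable {V : Type*} [AddCommGroup V] [Module ℂ V] (Γ : Module.End ℂ V)

/-! The theorem is free-field calculus organized by operators. The λ-bracket of `J^{(v)}` or
`J^{{v}}` with a generator of the complex is again a generator: up to signs, v acts by ad v on g, by
the compression of ad v on g_+ and its dual, and by ad v on g_{1/2}, with one extra term kλ(v|·) on
currents (`ActsBy`, `actsBy_Jround`, `actsBy_Jcurly`). On g_{1/2} this needs ad v to be skew for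
⟨·,·⟩, which is where [f,v] = 0 enters (`isSkewHalf_adHalf`).

The quadratic ghost fields are images of canonical elements: ∑_j :φ_{K u_j} φ_j^*: depends only on
the operator K, and v^ch is this field for K = Γ ad v; similarly v^ne, with a factor -1/2. By the
noncommutative Wick formula (`OPE.nop`) the field J acts on such a field by a twisted commutator
with K, and the only central contribution is a double contraction, that is, a trace of a product
with Γ, hence a supertrace (`ActsBy.quadPlus`, `ActsBy.quadHalf`). Part (c) follows once
compressions multiply like the operators themselves; on g_+ this holds for degrees of equal sign
(`adPlus_comp`, `adPlus_br`).

For (a), d is a sum of four fields attached to tensors: the identity of g_+, its bracket, the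
functional (f|·), and the projection onto g_{1/2}. Each tensor is invariant under g_0^f, so each
summand has zero λ-bracket with `J^{{v}}` (`Jcurly_d`); skew-symmetry gives `d_Jcurly`. Then d_0
supercommutes with all modes of `J^{{v}}`, which therefore descend to homology.

For (b), the Casimir eigenvalue 2h^∨ makes every current of weight 1 for the Sugawara field
(`cur_sugawara`). Adding ∂x changes the weight of a ∈ g_j to 1-j and creates the anomaly -k(x|a)λ²
(`L_cur`). The ghosts φ_i, φ_i^*, Φ_i get weights 1-m_i, m_i, 1/2. Wick's formula gives v^ch the λ²
term ½ str(ad v) - str(ad x ad v) over g_+ (`L_ch`). The last supertrace is half of the one over g,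
so it equals h^∨(v|x) (`trace_x_adPlus`) and turns k into k + h^∨.

Signs: (-1)^{p·p(b)} b is always written as the conjugate of b by Γ^p. Then only one argument of
each identity has to be homogeneous, and the rest extends linearly. -/

theorem zmod_two_cases {motive : ZMod 2 → Prop} (p : ZMod 2) (h0 : motive 0) (h1 : motive 1) :
    motive p := by
  fin_cases p
  exacts [h0, h1]

theorem sg_zero : sg 0 = 1 := by simp [sg]

theorem sg_one : sg 1 = -1 := by simp [sg]

theorem sg_mul_self (p : ZMod 2) : sg p * sg p = 1 := by
  induction p using zmod_two_cases <;> simp [sg]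

theorem sg_add (p q : ZMod 2) : sg (p + q) = sg p * sg q := by
  induction p using zmod_two_cases <;> induction q using zmod_two_cases <;>
    simp [sg, show (1 : ZMod 2) + 1 = 0 from rfl]

/-- Conjugation by `Γ ^ p`. -/
def conj (p : ZMod 2) (X : Module.End ℂ V) : Module.End ℂ V :=
  if p = 0 then X else Γ * X * Γ

@[simp] theorem conj_zero_left (X : Module.End ℂ V) : conj Γ 0 X = X := if_pos rfl

@[simp] theorem conj_one_left (X : Module.End ℂ V) : conj Γ 1 X = Γ * X * Γ :=
  if_neg one_ne_zero

/-- The operator `X` is homogeneous of parity `p`. -/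
def IsPar (p : ZMod 2) (X : Module.End ℂ V) : Prop := Γ * X * Γ = sg p • X

theorem swapMul_add_left (X X' Y : Module.End ℂ V) :
    swapMul Γ (X + X') Y = swapMul Γ X Y + swapMul Γ X' Y := by
  simp only [swapMul, mul_add, add_mul]; module

theorem swapMul_add_right (X Y Y' : Module.End ℂ V) :
    swapMul Γ X (Y + Y') = swapMul Γ X Y + swapMul Γ X Y' := by
  simp only [swapMul, mul_add, add_mul]; module

theorem swapMul_smul_left (c : ℂ) (X Y : Module.End ℂ V) :
    swapMul Γ (c • X) Y = c • swapMul Γ X Y := by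
  simp only [swapMul, mul_smul_comm, smul_mul_assoc]; module

theorem swapMul_smul_right (c : ℂ) (X Y : Module.End ℂ V) :
    swapMul Γ X (c • Y) = c • swapMul Γ X Y := by
  simp only [swapMul, mul_smul_comm, smul_mul_assoc]; module

/-- The supercommutator as a bilinear map. -/
def scommB : Module.End ℂ V →ₗ[ℂ] Module.End ℂ V →ₗ[ℂ] Module.End ℂ V :=
  LinearMap.mk₂ ℂ (scomm Γ)
    (fun X X' Y => by simp only [scomm, swapMul_add_left, add_mul]; abel)
    (fun c X Y => by simp only [scomm, swapMul_smul_left, smul_mul_assoc, smul_sub])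
    (fun X Y Y' => by simp only [scomm, swapMul_add_right, mul_add]; abel)
    (fun c X Y => by simp only [scomm, swapMul_smul_right, mul_smul_comm, smul_sub])

@[simp] theorem scommB_apply (X Y : Module.End ℂ V) : scommB Γ X Y = scomm Γ X Y := rfl

variable {Γ}

theorem conj_conj (hΓ : Γ * Γ = 1) (X : Module.End ℂ V) : Γ * (Γ * X * Γ) * Γ = X := by
  rw [show Γ * (Γ * X * Γ) * Γ = (Γ * Γ) * X * (Γ * Γ) by simp only [mul_assoc], hΓ, one_mul,
    mul_one]

theorem conj_mul (hΓ : Γ * Γ = 1) (X Y : Module.End ℂ V) :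
    Γ * (X * Y) * Γ = (Γ * X * Γ) * (Γ * Y * Γ) := by
  rw [show (Γ * X * Γ) * (Γ * Y * Γ) = Γ * X * (Γ * Γ) * Y * Γ by simp only [mul_assoc], hΓ,
    mul_one]
  simp only [mul_assoc]

/-- Passing a homogeneous `X` of parity `p` multiplies each homogeneous part of `Y` by
(-1)^{p·p(Y)}, which is conjugation by Γ^p. Hence the rules below need no homogeneity of `Y`. -/
theorem swapMul_of_isPar {p : ZMod 2} {X : Module.End ℂ V} (hX : IsPar Γ p X)
    (Y : Module.End ℂ V) : swapMul Γ X Y = conj Γ p Y * X := by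
  unfold swapMul
  rw [hX]
  induction p using zmod_two_cases with
  | h0 => simp only [conj_zero_left, sg_zero, one_smul]; module
  | h1 => simp only [conj_one_left, sg_one, neg_smul, one_smul, mul_neg]; module

theorem scomm_of_isPar {p : ZMod 2} {X : Module.End ℂ V} (hX : IsPar Γ p X)
    (Y : Module.End ℂ V) : scomm Γ X Y = X * Y - conj Γ p Y * X := by
  rw [scomm, swapMul_of_isPar hX]

/-- Super skew-symmetry, with the sign absorbed in the conjugate so that `Y` may be inhomogeneous.
-/
theorem scomm_conj_left (hΓ : Γ * Γ = 1) {p : ZMod 2} {X : Module.End ℂ V} (hX : IsPar Γ p X)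
    (Y : Module.End ℂ V) : scomm Γ (conj Γ p Y) X = -scomm Γ X Y := by
  rw [scomm_of_isPar hX, scomm, swapMul, hX]
  induction p using zmod_two_cases with
  | h0 => simp only [conj_zero_left, sg_zero, one_smul]; module
  | h1 =>
    simp only [conj_one_left, sg_one, neg_smul, one_smul, neg_mul, conj_conj hΓ]
    module

theorem scomm_mul (hΓ : Γ * Γ = 1) {p : ZMod 2} {X : Module.End ℂ V} (hX : IsPar Γ p X)
    (Y Z : Module.End ℂ V) :
    scomm Γ X (Y * Z) = scomm Γ X Y * Z + conj Γ p Y * scomm Γ X Z := by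
  simp only [scomm_of_isPar hX]
  induction p using zmod_two_cases with
  | h0 => simp only [conj_zero_left]; noncomm_ring
  | h1 => simp only [conj_one_left, conj_mul hΓ]; noncomm_ring

theorem conj_scomm (hΓ : Γ * Γ = 1) {p : ZMod 2} {X : Module.End ℂ V} (hX : IsPar Γ p X)
    (Y : Module.End ℂ V) : Γ * scomm Γ X Y * Γ = sg p • scomm Γ X (Γ * Y * Γ) := by
  have hX' : Γ * X * Γ = sg p • X := hX
  simp only [scomm_of_isPar hX, mul_sub, sub_mul, conj_mul hΓ X]
  induction p using zmod_two_cases with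
  | h0 => simp only [conj_zero_left, conj_mul hΓ, hX']; simp [sg_zero]
  | h1 => simp only [conj_one_left, conj_mul hΓ (Γ * Y * Γ) X, hX']; simp [sg_one]; abel

/-- The annihilation half of a normally ordered product is a `swapMul`, so Wick's formula needs the
Leibniz rule for this product as well as for composition. -/
theorem scomm_swapMul (hΓ : Γ * Γ = 1) {p : ZMod 2} {X : Module.End ℂ V} (hX : IsPar Γ p X)
    (Y Z : Module.End ℂ V) :
    scomm Γ X (swapMul Γ Y Z) =
      swapMul Γ (scomm Γ X Y) Z + swapMul Γ (conj Γ p Y) (scomm Γ X Z) := by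
  have hadd : ∀ A B, scomm Γ X (A + B) = scomm Γ X A + scomm Γ X B := map_add (scommB Γ X)
  have hsmul : ∀ (c : ℂ) A, scomm Γ X (c • A) = c • scomm Γ X A := map_smul (scommB Γ X)
  have hsub : ∀ A B, scomm Γ X (A - B) = scomm Γ X A - scomm Γ X B := map_sub (scommB Γ X)
  simp only [swapMul, hadd, hsmul, hsub, scomm_mul hΓ hX, conj_scomm hΓ hX]
  induction p using zmod_two_cases with
  | h0 => simp only [conj_zero_left, sg_zero, one_smul]; module
  | h1 =>
    simp only [conj_one_left, sg_one, neg_smul, one_smul, conj_conj hΓ, mul_neg, neg_mul]; module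

end Operators

/-! ### Modes, derivatives, and bilinearity of the normally ordered product. -/

section FieldCalculus

variable {V : Type*} [AddCommGroup V] [Module ℂ V]

theorem field_ext {a b : VertexOperator ℂ V} (h : ∀ n, a[[n]] = b[[n]]) : a = b :=
  HVertexOperator.coeff_inj (funext fun n => by
    rw [VertexOperator.coeff_eq_ncoeff, VertexOperator.coeff_eq_ncoeff, h])

@[simp] theorem ncoeff_deriv (a : VertexOperator ℂ V) (n : ℤ) :
    (deriv a)[[n]] = (-(n : ℂ)) • a[[n - 1]] := by
  rw [deriv, ncoeff_mkField]

theorem ncoeff_oneField (n : ℤ) :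
    (oneField : VertexOperator ℂ V)[[n]] = if n = -1 then 1 else 0 := by
  rw [oneField, ncoeff_mkField]

/-- The derivative as a linear map. -/
def derivL : VertexOperator ℂ V →ₗ[ℂ] VertexOperator ℂ V where
  toFun := deriv
  map_add' a b := field_ext fun n => by simp
  map_smul' c a := field_ext fun n => by simp [smul_comm c]

@[simp] theorem derivL_apply (a : VertexOperator ℂ V) : derivL a = deriv a := rfl

theorem deriv_oneField : deriv (oneField : VertexOperator ℂ V) = 0 := field_ext fun n => by
  rw [ncoeff_deriv, ncoeff_oneField]
  split_ifs with h
  · obtain rfl : n = 0 := by omega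
    simp
  · simp

variable (Γ : Module.End ℂ V)

@[simp] theorem ncoeff_nop (a b : VertexOperator ℂ V) (n : ℤ) :
    (nop Γ a b)[[n]] = nopMode Γ a b n := by
  rw [nop, ncoeff_mkField]

/-- On a fixed vector the infinite sum is finite, so it equals every sufficiently long partial sum.
Phrasing this as an eventual statement lets several products share one cutoff `M`, after which
identities are checked term by term or by telescoping. -/
theorem nopMode_apply_eventually (a b : VertexOperator ℂ V) (m : ℤ) (v : V) :
    ∀ᶠ M : ℕ in atTop, nopMode Γ a b m v = ∑ j ∈ Finset.range M, nopTerm Γ a b m j v := by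
  obtain ⟨M, hM⟩ := (nopTerm_finite Γ a b m v).bddAbove
  filter_upwards [eventually_ge_atTop (M + 1)] with M' hM'
  change (∑ᶠ j : ℕ, nopTerm Γ a b m j v) = _
  refine finsum_eq_sum_of_support_subset _ fun j hj => ?_
  have := hM hj
  simp only [Finset.coe_range, Set.mem_Iio]
  omega

theorem ncoeff_eventually (a : VertexOperator ℂ V) (k : ℤ) (v : V) :
    ∀ᶠ j : ℕ in atTop, (a[[k + j]]) v = 0 := by
  obtain ⟨N, hN⟩ := exists_trunc a v
  filter_upwards [eventually_ge_atTop (N - k).toNat] with j hj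
  exact hN _ (by omega)

theorem swapMul_eventually (a : VertexOperator ℂ V) (k : ℤ) (v : V) :
    ∀ᶠ j : ℕ in atTop, ∀ Y, swapMul Γ (a[[k + j]]) Y v = 0 := by
  obtain ⟨N, hN⟩ := swapMul_left_trunc Γ a v
  filter_upwards [eventually_ge_atTop (N - k).toNat] with j hj
  exact hN _ (by omega)

/-- The normally ordered product as a bilinear map. -/
def nopB : VertexOperator ℂ V →ₗ[ℂ] VertexOperator ℂ V →ₗ[ℂ] VertexOperator ℂ V :=
  LinearMap.mk₂ ℂ (nop Γ)
    (fun a a' b => field_ext fun n => by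
      ext v
      rw [map_add, Pi.add_apply, LinearMap.add_apply]
      simp only [ncoeff_nop]
      obtain ⟨M, h1, h2, h3⟩ := ((nopMode_apply_eventually Γ (a + a') b n v).and
        ((nopMode_apply_eventually Γ a b n v).and (nopMode_apply_eventually Γ a' b n v))).exists
      rw [h1, h2, h3, ← Finset.sum_add_distrib]
      refine Finset.sum_congr rfl fun j _ => ?_
      simp only [nopTerm, map_add, Pi.add_apply, swapMul_add_left, LinearMap.add_apply,
        Module.End.mul_apply]
      abel)
    (fun c a b => field_ext fun n => by
      ext v
      rw [map_smul, Pi.smul_apply, LinearMap.smul_apply]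
      simp only [ncoeff_nop]
      obtain ⟨M, h1, h2⟩ := ((nopMode_apply_eventually Γ (c • a) b n v).and
        (nopMode_apply_eventually Γ a b n v)).exists
      rw [h1, h2, Finset.smul_sum]
      refine Finset.sum_congr rfl fun j _ => ?_
      simp only [nopTerm, map_smul, Pi.smul_apply, swapMul_smul_left, LinearMap.add_apply,
        LinearMap.smul_apply, Module.End.mul_apply, smul_add])
    (fun a b b' => field_ext fun n => by
      ext v
      rw [map_add, Pi.add_apply, LinearMap.add_apply]
      simp only [ncoeff_nop]
      obtain ⟨M, h1, h2, h3⟩ := ((nopMode_apply_eventually Γ a (b + b') n v).and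
        ((nopMode_apply_eventually Γ a b n v).and (nopMode_apply_eventually Γ a b' n v))).exists
      rw [h1, h2, h3, ← Finset.sum_add_distrib]
      refine Finset.sum_congr rfl fun j _ => ?_
      simp only [nopTerm, map_add, Pi.add_apply, swapMul_add_right, LinearMap.add_apply,
        Module.End.mul_apply]
      abel)
    (fun c a b => field_ext fun n => by
      ext v
      rw [map_smul, Pi.smul_apply, LinearMap.smul_apply]
      simp only [ncoeff_nop]
      obtain ⟨M, h1, h2⟩ := ((nopMode_apply_eventually Γ a (c • b) n v).and
        (nopMode_apply_eventually Γ a b n v)).exists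
      rw [h1, h2, Finset.smul_sum]
      refine Finset.sum_congr rfl fun j _ => ?_
      simp only [nopTerm, map_smul, Pi.smul_apply, swapMul_smul_right, LinearMap.add_apply,
        LinearMap.smul_apply, Module.End.mul_apply, smul_add])

@[simp] theorem nopB_apply (a b : VertexOperator ℂ V) : nopB Γ a b = nop Γ a b := rfl

theorem nop_oneField_left (b : VertexOperator ℂ V) : nop Γ oneField b = b :=
  field_ext fun n => by
    ext v
    rw [ncoeff_nop]
    change (∑ᶠ j : ℕ, nopTerm Γ oneField b n j v) = _
    rw [finsum_eq_single _ 0]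
    · simp [nopTerm, ncoeff_oneField, swapMul]
    · intro j hj
      have h1 : ¬ (-(j : ℤ) - 1 = -1) := by omega
      have h2 : ¬ ((j : ℤ) = -1) := by omega
      simp [nopTerm, ncoeff_oneField, swapMul, h1, h2]

variable {Γ}

theorem nop_oneField_right (hΓ : Γ * Γ = 1) (a : VertexOperator ℂ V) : nop Γ a oneField = a :=
  field_ext fun n => by
    ext v
    rw [ncoeff_nop]
    change (∑ᶠ j : ℕ, nopTerm Γ a oneField n j v) = _
    have hs : ∀ X : Module.End ℂ V, swapMul Γ X 1 = X := by
      intro X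
      simp only [swapMul, one_mul, mul_one, hΓ]
      module
    have hs0 : ∀ X : Module.End ℂ V, swapMul Γ X 0 = 0 := by
      intro X
      simp [swapMul]
    by_cases hn : n < 0
    -- Only the mode of 1 with index -1 survives. For n < 0 it meets the creation part, at j = -1-n;
    -- for n ≥ 0 it meets the annihilation part, at j = n.
    · rw [finsum_eq_single _ (-1 - n).toNat]
      · have h1 : n + ((-1 - n).toNat : ℤ) = -1 := by omega
        have h2 : ¬ (n - ((-1 - n).toNat : ℤ) - 1 = -1) := by omega
        have h3 : -((-1 - n).toNat : ℤ) - 1 = n := by omega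
        simp only [nopTerm, ncoeff_oneField, if_pos h1, if_neg h2, h3, hs0]
        simp
      · intro j hj
        have h1 : ¬ (n + (j : ℤ) = -1) := by omega
        have h2 : ¬ (n - (j : ℤ) - 1 = -1) := by omega
        simp only [nopTerm, ncoeff_oneField, if_neg h1, if_neg h2, hs0]
        simp
    · rw [finsum_eq_single _ n.toNat]
      · have h1 : ¬ (n + (n.toNat : ℤ) = -1) := by omega
        have h2 : (n - (n.toNat : ℤ) - 1 = -1) := by omega
        have h3 : (n.toNat : ℤ) = n := by omega
        simp only [nopTerm, ncoeff_oneField, if_neg h1, if_pos h2, hs]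
        simp [h3]
      · intro j hj
        have h1 : ¬ (n + (j : ℤ) = -1) := by omega
        have h2 : ¬ (n - (j : ℤ) - 1 = -1) := by omega
        simp only [nopTerm, ncoeff_oneField, if_neg h1, if_neg h2, hs0]
        simp

end FieldCalculus

/-! ### Operator product expansions up to order λ², and the noncommutative Wick formula. -/

section OPE

variable {V : Type*} [AddCommGroup V] [Module ℂ V] (Γ : Module.End ℂ V)

/-- The fields `a`, `b` satisfy `[a_λ b] = c₀ + λ c₁ + λ² c₂`, in the strong form of the
commutator formula for all modes. -/
def OPE (a b c₀ c₁ c₂ : VertexOperator ℂ V) : Prop :=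
  ∀ m n : ℤ, scomm Γ (a[[m]]) (b[[n]]) =
    c₀[[m + n]] + (m : ℂ) • c₁[[m + n - 1]] + ((m : ℂ) * (m - 1)) • c₂[[m + n - 2]]

/-- This and the next two sums are n-th finite differences at 0 of the polynomials 1, x, x(x-1),
evaluated at x = n-i. They extract a single coefficient from the commutator formula. -/
theorem sum_alternating_choose_mul {M : Type*} [AddCommGroup M] [Module ℂ M] (n : ℕ) (x : M) :
    ∑ i ∈ Finset.range (n + 1), ((-1 : ℂ) ^ i * (n.choose i : ℂ)) • x =
      if n = 0 then x else 0 := by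
  rw [← Finset.sum_smul]
  have h := Int.alternating_sum_range_choose (n := n)
  have h' : ∑ i ∈ Finset.range (n + 1), ((-1 : ℂ) ^ i * (n.choose i : ℂ)) =
      if n = 0 then 1 else 0 := by
    exact_mod_cast congrArg (Int.cast : ℤ → ℂ) h
  rw [h']
  split_ifs <;> simp

theorem sum_alternating_choose_mul_linear {M : Type*} [AddCommGroup M] [Module ℂ M] (n : ℕ)
    (x : M) :
    ∑ i ∈ Finset.range (n + 1), ((-1 : ℂ) ^ i * (n.choose i : ℂ) * (n - i)) • x =
      if n = 1 then x else 0 := by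
  rcases n with _ | n
  · simp
  rw [Finset.sum_range_succ]
  have h : ∀ i ∈ Finset.range (n + 1),
      ((-1 : ℂ) ^ i * ((n + 1).choose i : ℂ) * ((n + 1 : ℕ) - i)) • x =
        ((-1 : ℂ) ^ i * (n.choose i : ℂ)) • ((n + 1 : ℂ) • x) := by
    intro i hi
    have hi : i ≤ n := Nat.lt_succ_iff.1 (Finset.mem_range.1 hi)
    have := Nat.choose_mul_succ_eq n i
    have h2 : (n.choose i : ℂ) * (n + 1) = ((n + 1).choose i : ℂ) * ((n + 1 : ℕ) - i) := by
      rw [← Nat.cast_sub (by omega)]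
      exact_mod_cast this
    rw [smul_smul, mul_assoc, ← h2, mul_assoc]
  rw [Finset.sum_congr rfl h, sum_alternating_choose_mul]
  by_cases hn : n = 0 <;> simp [hn]

theorem sum_alternating_choose_mul_quadratic {M : Type*} [AddCommGroup M] [Module ℂ M] (n : ℕ)
    (x : M) :
    ∑ i ∈ Finset.range (n + 1), ((-1 : ℂ) ^ i * (n.choose i : ℂ) * ((n - i) * (n - i - 1))) • x =
      if n = 2 then (2 : ℂ) • x else 0 := by
  rcases n with _ | n
  · simp
  rw [Finset.sum_range_succ]
  have h : ∀ i ∈ Finset.range (n + 1),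
      ((-1 : ℂ) ^ i * ((n + 1).choose i : ℂ) *
        (((n + 1 : ℕ) - i) * ((n + 1 : ℕ) - i - 1))) • x =
        ((-1 : ℂ) ^ i * (n.choose i : ℂ) * (n - i)) • ((n + 1 : ℂ) • x) := by
    intro i hi
    have hi : i ≤ n := Nat.lt_succ_iff.1 (Finset.mem_range.1 hi)
    have := Nat.choose_mul_succ_eq n i
    have h2 : (n.choose i : ℂ) * (n + 1) = ((n + 1).choose i : ℂ) * ((n + 1 : ℕ) - i) := by
      rw [← Nat.cast_sub (by omega)]
      exact_mod_cast this
    rw [smul_smul]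
    congr 1
    push_cast at h2 ⊢
    linear_combination (-(-1 : ℂ) ^ i * (n - i)) * h2
  rw [Finset.sum_congr rfl h, sum_alternating_choose_mul_linear]
  by_cases hn : n = 1
  · subst hn; simp; module
  · simp [hn]

variable {Γ}

/-- All commutators in the n-th product have the same total mode index, so only the polynomial
dependence on the first index matters. Its n-th difference isolates the λ^n coefficient; the value 2
for n = 2 cancels the 1/2! in the λ-bracket. -/
theorem OPE.lbr_eq {a b c₀ c₁ c₂ : VertexOperator ℂ V} (h : OPE Γ a b c₀ c₁ c₂) :
    lbr Γ a b = lam 0 c₀ + lam 1 c₁ + lam 2 c₂ := by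
  have hp : ∀ (n : ℕ) (m : ℤ), (posProd Γ n a b)[[m]] =
      (if n = 0 then c₀[[n + m]] else 0) + (if n = 1 then c₁[[n + m - 1]] else 0) +
        (if n = 2 then (2 : ℂ) • c₂[[n + m - 2]] else 0) := by
    intro n m
    rw [posProd, ncoeff_mkField, ← sum_alternating_choose_mul,
      ← sum_alternating_choose_mul_linear, ← sum_alternating_choose_mul_quadratic,
      ← Finset.sum_add_distrib, ← Finset.sum_add_distrib]
    refine Finset.sum_congr rfl fun i _ => ?_
    rw [h, show (n : ℤ) - i + (m + i) = n + m by ring]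
    push_cast
    module
  funext n
  refine field_ext fun m => ?_
  rw [lbr]
  change (((n.factorial : ℂ)⁻¹) • posProd Γ n a b)[[m]] = _
  rw [map_smul, Pi.smul_apply, hp]
  simp only [lam, Pi.add_apply, map_add]
  rcases n with _ | _ | _ | n
  · simp
  · simp
  · simp [show (2 : ℤ) + m - 2 = m by ring]
  · simp

theorem OPE.eq_scomm {a b c₀ c₁ c₂ : VertexOperator ℂ V} (h : OPE Γ a b c₀ c₁ c₂) {m n N : ℤ}
    (hN : m + n = N) : scomm Γ (a[[m]]) (b[[n]]) =
    c₀[[N]] + (m : ℂ) • c₁[[N - 1]] + ((m : ℂ) * (m - 1)) • c₂[[N - 2]] := hN ▸ h m n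

theorem OPE.of_eq {a b c₀ c₁ c₂ d₀ d₁ d₂ : VertexOperator ℂ V} (h : OPE Γ a b c₀ c₁ c₂)
    (h0 : c₀ = d₀) (h1 : c₁ = d₁) (h2 : c₂ = d₂) : OPE Γ a b d₀ d₁ d₂ := by
  subst h0 h1 h2; exact h

theorem OPE.zero_left (b : VertexOperator ℂ V) : OPE Γ 0 b 0 0 0 := by
  intro m n
  simp [scomm, swapMul]

theorem OPE.zero_right (a : VertexOperator ℂ V) : OPE Γ a 0 0 0 0 := by
  intro m n
  simp [scomm, swapMul]

theorem OPE.add_left {a a' b c₀ c₁ c₂ d₀ d₁ d₂ : VertexOperator ℂ V} (h : OPE Γ a b c₀ c₁ c₂)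
    (h' : OPE Γ a' b d₀ d₁ d₂) : OPE Γ (a + a') b (c₀ + d₀) (c₁ + d₁) (c₂ + d₂) := by
  intro m n
  rw [← scommB_apply]
  simp only [map_add, Pi.add_apply, LinearMap.add_apply, scommB_apply, h m n, h' m n]
  module

theorem OPE.add_right {a b b' c₀ c₁ c₂ d₀ d₁ d₂ : VertexOperator ℂ V} (h : OPE Γ a b c₀ c₁ c₂)
    (h' : OPE Γ a b' d₀ d₁ d₂) : OPE Γ a (b + b') (c₀ + d₀) (c₁ + d₁) (c₂ + d₂) := by
  intro m n
  rw [← scommB_apply]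
  simp only [map_add, Pi.add_apply, scommB_apply, h m n, h' m n]
  module

theorem OPE.smul_left {a b c₀ c₁ c₂ : VertexOperator ℂ V} (h : OPE Γ a b c₀ c₁ c₂) (r : ℂ) :
    OPE Γ (r • a) b (r • c₀) (r • c₁) (r • c₂) := by
  intro m n
  rw [← scommB_apply]
  simp only [map_smul, Pi.smul_apply, LinearMap.smul_apply, scommB_apply, h m n]
  module

theorem OPE.smul_right {a b c₀ c₁ c₂ : VertexOperator ℂ V} (h : OPE Γ a b c₀ c₁ c₂) (r : ℂ) :
    OPE Γ a (r • b) (r • c₀) (r • c₁) (r • c₂) := by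
  intro m n
  rw [← scommB_apply]
  simp only [map_smul, Pi.smul_apply, scommB_apply, h m n]
  module

theorem OPE.sum_right {ι : Type*} (s : Finset ι) {a : VertexOperator ℂ V}
    {b c₀ c₁ c₂ : ι → VertexOperator ℂ V} (h : ∀ i ∈ s, OPE Γ a (b i) (c₀ i) (c₁ i) (c₂ i)) :
    OPE Γ a (∑ i ∈ s, b i) (∑ i ∈ s, c₀ i) (∑ i ∈ s, c₁ i) (∑ i ∈ s, c₂ i) := by
  classical
  induction s using Finset.induction_on with
  | empty => simpa using OPE.zero_right a
  | insert i s hi ih =>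
    simp only [Finset.sum_insert hi]
    exact (h i (Finset.mem_insert_self i s)).add_right
      (ih fun j hj => h j (Finset.mem_insert_of_mem hj))

/-- Sesquilinearity, [∂a_λ b] = -λ[a_λ b]. The vanishing λ² term keeps the result within order two.
-/
theorem OPE.deriv_left {a b c₀ c₁ : VertexOperator ℂ V} (h : OPE Γ a b c₀ c₁ 0) :
    OPE Γ (deriv a) b 0 (-c₀) (-c₁) := by
  intro m n
  rw [← scommB_apply]
  simp only [ncoeff_deriv, map_smul, LinearMap.smul_apply, scommB_apply]
  rw [h.eq_scomm (N := m + n - 1) (by ring), show m + n - 1 - 1 = m + n - 2 by ring]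
  simp only [map_zero, Pi.zero_apply, map_neg, Pi.neg_apply]
  push_cast
  module

theorem OPE.deriv_right {a b c₀ c₁ : VertexOperator ℂ V} (h : OPE Γ a b c₀ c₁ 0) :
    OPE Γ a (deriv b) (deriv c₀) (c₀ + deriv c₁) c₁ := by
  intro m n
  rw [← scommB_apply]
  simp only [ncoeff_deriv, map_smul, scommB_apply, map_add, Pi.add_apply]
  rw [h.eq_scomm (N := m + n - 1) (by ring), show m + n - 1 - 1 = m + n - 2 by ring]
  simp only [map_zero, Pi.zero_apply]
  push_cast
  module

variable (Γ) in
/-- The field `b'` is the conjugate of `b` by `Γ ^ p`. -/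
def IsConj (p : ZMod 2) (b b' : VertexOperator ℂ V) : Prop :=
  ∀ n, b'[[n]] = conj Γ p (b[[n]])

variable (Γ) in
/-- The field `a` is homogeneous of parity `p`. -/
def FieldPar (p : ZMod 2) (a : VertexOperator ℂ V) : Prop := ∀ n, IsPar Γ p (a[[n]])

/-- Substitute -λ-∂ for λ in the bracket and change its sign: the coefficients of -(c₀ - (λ+∂)c₁ +
(λ+∂)²c₂) are the ones listed. The parity sign sits in `b'`. -/
theorem OPE.skew (hΓ : Γ * Γ = 1) {p : ZMod 2} {a b b' c₀ c₁ c₂ : VertexOperator ℂ V}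
    (ha : FieldPar Γ p a) (hb : IsConj Γ p b b') (h : OPE Γ a b c₀ c₁ c₂) :
    OPE Γ b' a (-c₀ + deriv c₁ - deriv (deriv c₂)) (c₁ - (2 : ℂ) • deriv c₂) (-c₂) := by
  intro m n
  rw [hb, scomm_conj_left hΓ (ha n), h.eq_scomm (N := m + n) (by ring)]
  simp only [map_add, map_sub, map_neg, map_smul, Pi.add_apply, Pi.sub_apply, Pi.neg_apply,
    Pi.smul_apply, ncoeff_deriv, show m + n - 1 - 1 = m + n - 2 by ring]
  push_cast
  module

/-- The summands of the normally ordered product, with the splitting of the modes of `a` into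
creation and annihilation operators shifted by `s`. -/
def shiftedNopTerm (Γ : Module.End ℂ V) (a b : VertexOperator ℂ V) (s m : ℤ) (j : ℕ) :
    Module.End ℂ V :=
  a[[s - j - 1]] * b[[m - s + j]] + swapMul Γ (a[[s + j]]) (b[[m - s - j - 1]])

theorem shiftedNopTerm_zero (a b : VertexOperator ℂ V) (m : ℤ) (j : ℕ) :
    shiftedNopTerm Γ a b 0 m j = nopTerm Γ a b m j := by
  simp [shiftedNopTerm, nopTerm]

/-- Raising the splitting point by one turns `a[[s]]` from an annihilation mode into a creation
mode, which costs exactly its supercommutator with the matching mode of `b`. The two telescoping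
boundary terms at `M` vanish for large `M`. -/
theorem sum_shiftedNopTerm_succ (a b : VertexOperator ℂ V) (s m : ℤ) (v : V) :
    ∀ᶠ M : ℕ in atTop, ∑ j ∈ Finset.range M, shiftedNopTerm Γ a b (s + 1) m j v =
      ∑ j ∈ Finset.range M, shiftedNopTerm Γ a b s m j v +
        scomm Γ (a[[s]]) (b[[m - s - 1]]) v := by
  filter_upwards [ncoeff_eventually b (m - s - 1) v, swapMul_eventually Γ a s v] with M h1 h2
  have hA := Finset.sum_range_sub
    (fun j : ℕ => (a[[s - j]]) ((b[[m - s - 1 + j]]) v)) M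
  have hB := Finset.sum_range_sub
    (fun j : ℕ => swapMul Γ (a[[s + j]]) (b[[m - s - j - 1]]) v) M
  have key : ∀ j : ℕ, shiftedNopTerm Γ a b (s + 1) m j v = shiftedNopTerm Γ a b s m j v
      - ((a[[s - (j + 1 : ℕ)]]) ((b[[m - s - 1 + (j + 1 : ℕ)]]) v)
          - (a[[s - j]]) ((b[[m - s - 1 + j]]) v))
      + (swapMul Γ (a[[s + (j + 1 : ℕ)]]) (b[[m - s - (j + 1 : ℕ) - 1]]) v
        - swapMul Γ (a[[s + j]]) (b[[m - s - j - 1]]) v) := by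
    intro j
    simp only [shiftedNopTerm, LinearMap.add_apply, Module.End.mul_apply]
    rw [show s + 1 - (j : ℤ) - 1 = s - j by ring, show m - (s + 1) + (j : ℤ) = m - s - 1 + j by ring,
      show s + 1 + (j : ℤ) = s + (j + 1 : ℕ) by push_cast; ring,
      show m - (s + 1) - (j : ℤ) - 1 = m - s - (j + 1 : ℕ) - 1 by push_cast; ring,
      show s - (j : ℤ) - 1 = s - (j + 1 : ℕ) by push_cast; ring,
      show m - s + (j : ℤ) = m - s - 1 + (j + 1 : ℕ) by push_cast; ring]
    abel
  simp only [key, Finset.sum_add_distrib, Finset.sum_sub_distrib] at hA hB ⊢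
  rw [hA, hB, h1, h2, scomm]
  simp only [map_zero, zero_sub, Nat.cast_zero, add_zero, sub_zero, LinearMap.sub_apply,
    Module.End.mul_apply]
  abel

/-- Adding up the commutators picked up while moving the splitting point from 0 to s gives ∑_{t<s}
(c₀ + t c₁). This is the discrete form of the integral ∫_0^λ in Wick's formula, and it holds for
negative s too. -/
theorem sum_shiftedNopTerm {a b c₀ c₁ : VertexOperator ℂ V} (h : OPE Γ a b c₀ c₁ 0) (s m : ℤ)
    (v : V) :
    ∀ᶠ M : ℕ in atTop, ∑ j ∈ Finset.range M, shiftedNopTerm Γ a b s m j v =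
      nopMode Γ a b m v + (s : ℂ) • (c₀[[m - 1]]) v
        + ((s : ℂ) * (s - 1) / 2) • (c₁[[m - 2]]) v := by
  have hs : ∀ s : ℤ, scomm Γ (a[[s]]) (b[[m - s - 1]]) v =
      (c₀[[m - 1]]) v + (s : ℂ) • (c₁[[m - 2]]) v := by
    intro s
    rw [h.eq_scomm (N := m - 1) (by ring), show m - 1 - 1 = m - 2 by ring]
    simp
  induction s using Int.induction_on with
  | zero =>
    filter_upwards [nopMode_apply_eventually Γ a b m v] with M hM
    simp [shiftedNopTerm_zero, hM]
  | succ i ih =>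
    filter_upwards [ih, sum_shiftedNopTerm_succ a b i m v] with M h1 h2
    rw [h2, h1, hs]
    push_cast
    module
  | pred i ih =>
    filter_upwards [ih, sum_shiftedNopTerm_succ a b (-i - 1) m v] with M h1 h2
    rw [show -(i : ℤ) - 1 + 1 = -i by ring, h1, hs] at h2
    rw [← sub_eq_iff_eq_add] at h2
    rw [← h2]
    push_cast
    module

theorem scomm_nopMode {p : ZMod 2} {X : Module.End ℂ V} (hX : IsPar Γ p X)
    (b c : VertexOperator ℂ V) (m : ℤ) (v : V) :
    ∀ᶠ M : ℕ in atTop, scomm Γ X (nopMode Γ b c m) v =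
      ∑ j ∈ Finset.range M, scomm Γ X (nopTerm Γ b c m j) v := by
  simp only [scomm_of_isPar hX]
  induction p using zmod_two_cases with
  | h0 =>
    filter_upwards [nopMode_apply_eventually Γ b c m v,
      nopMode_apply_eventually Γ b c m (X v)] with M h1 h2
    simp only [conj_zero_left, LinearMap.sub_apply, Module.End.mul_apply, h1, h2, map_sum,
      Finset.sum_sub_distrib]
  | h1 =>
    filter_upwards [nopMode_apply_eventually Γ b c m v,
      nopMode_apply_eventually Γ b c m (Γ (X v))] with M h1 h2
    simp only [conj_one_left, LinearMap.sub_apply, Module.End.mul_apply, h1, h2, map_sum,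
      Finset.sum_sub_distrib]

/-- The noncommutative Wick formula. -/
theorem OPE.nop (hΓ : Γ * Γ = 1) {p : ZMod 2}
    {a b b' c b₀ b₁ c₀ c₁ e₀ e₁ e : VertexOperator ℂ V}
    (ha : FieldPar Γ p a) (hb : IsConj Γ p b b') (hab : OPE Γ a b b₀ b₁ 0)
    (hac : OPE Γ a c c₀ c₁ 0) (h0 : OPE Γ b₀ c e₀ e₁ 0) (h1 : OPE Γ b₁ c e 0 0) :
    OPE Γ a (nop Γ b c) (nop Γ b₀ c + nop Γ b' c₀) (nop Γ b₁ c + nop Γ b' c₁ + e₀)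
      ((1 / 2 : ℂ) • e₁ + e) := by
  intro m n
  -- Bracketing with the mode m of `a` sends the modes of `b` to modes of `b₀` with index raised by
  -- m and of `b₁` raised by m-1, so their creation/annihilation splittings are displaced by these
  -- amounts. Moving the splittings back to 0 produces `e₀`, `e₁` and `e`; the half of `e₁` comes
  -- from m(m-1)/2.
  have key : ∀ j : ℕ, scomm Γ (a[[m]]) (nopTerm Γ b c n j) =
      shiftedNopTerm Γ b₀ c m (m + n) j + (m : ℂ) • shiftedNopTerm Γ b₁ c (m - 1) (m + n - 1) j
        + nopTerm Γ b' c₀ (m + n) j + (m : ℂ) • nopTerm Γ b' c₁ (m + n - 1) j := by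
    intro j
    rw [nopTerm, ← scommB_apply, map_add, scommB_apply, scommB_apply, scomm_mul hΓ (ha m),
      scomm_swapMul hΓ (ha m), ← hb, ← hb,
      hab.eq_scomm (N := m - j - 1) (by ring), hac.eq_scomm (N := m + n + j) (by ring),
      hab.eq_scomm (N := m + j) (by ring), hac.eq_scomm (N := m + n - j - 1) (by ring)]
    simp only [shiftedNopTerm, nopTerm, map_zero, Pi.zero_apply, smul_zero, add_zero,
      swapMul_add_left, swapMul_add_right, swapMul_smul_left, swapMul_smul_right, add_mul, mul_add,
      smul_mul_assoc, mul_smul_comm]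
    rw [show m + n - m + (j : ℤ) = n + j by ring, show m - (j : ℤ) - 1 - 1 = m - 1 - j - 1 by ring,
      show m + n - 1 - (m - 1) + (j : ℤ) = n + j by ring,
      show m + n - m - (j : ℤ) - 1 = n - j - 1 by ring,
      show m + (j : ℤ) - 1 = m - 1 + j by ring,
      show m + n - 1 - (m - 1) - (j : ℤ) - 1 = n - j - 1 by ring,
      show m + n + (j : ℤ) - 1 = m + n - 1 + j by ring,
      show m + n - (j : ℤ) - 1 - 1 = m + n - 1 - j - 1 by ring]
    module
  ext v
  obtain ⟨M, g1, g2, g3, g4, g5⟩ := ((scomm_nopMode (ha m) b c n v).and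
    ((sum_shiftedNopTerm h0 m (m + n) v).and
      ((sum_shiftedNopTerm h1 (m - 1) (m + n - 1) v).and
        ((nopMode_apply_eventually Γ b' c₀ (m + n) v).and
          (nopMode_apply_eventually Γ b' c₁ (m + n - 1) v))))).exists
  rw [ncoeff_nop, g1]
  simp only [key, LinearMap.add_apply, LinearMap.smul_apply, Finset.sum_add_distrib,
    ← Finset.smul_sum, g2, g3, ← g4, ← g5, map_add, Pi.add_apply, ncoeff_nop, map_smul,
    Pi.smul_apply, map_zero, Pi.zero_apply, LinearMap.zero_apply, smul_zero, add_zero,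
    show m + n - 1 - 1 = m + n - 2 by ring]
  push_cast
  module

end OPE

/-! ### Parity and λ-brackets of the generating fields on the vacuum module. -/

namespace CurrentData

variable {P : Type*} [AddCommGroup P] [Module ℂ P] (D : CurrentData P)

theorem parityU_parityU (u : D.U) : D.parityU (D.parityU u) = u := by
  have : (D.parityU.comp D.parityU) = AlgHom.id ℂ D.U := by
    refine RingQuot.ringQuot_ext' _ _ _ (TensorAlgebra.hom_ext (Finsupp.lhom_ext fun n a => ?_))
    change D.parityU (D.parityU (D.gen a n)) = D.gen a n
    rw [parityU_gen, parityU_gen, D.Γ_Γ]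
  exact DFunLike.congr_fun this u

theorem ΓV_mk (u : D.U) : D.ΓV (D.annIdeal.mkQ u) = D.annIdeal.mkQ (D.parityU u) := rfl

theorem ΓV_mul_ΓV : D.ΓV * D.ΓV = 1 := by
  refine LinearMap.ext fun v => ?_
  obtain ⟨u, rfl⟩ := D.annIdeal.mkQ_surjective v
  rw [Module.End.mul_apply, ΓV_mk, ΓV_mk, parityU_parityU, Module.End.one_apply]

theorem ΓV_vac : D.ΓV D.vac = D.vac := by
  rw [vac, ΓV_mk, map_one]

theorem conj_act (u : D.U) : D.ΓV * D.act u * D.ΓV = D.act (D.parityU u) := by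
  refine LinearMap.ext fun v => ?_
  obtain ⟨w, rfl⟩ := D.annIdeal.mkQ_surjective v
  simp only [Module.End.mul_apply, ΓV_mk, act_mk, map_mul, parityU_parityU]

@[simp] theorem ncoeff_field (a : P) (n : ℤ) : (D.field a)[[n]] = D.act (D.gen a n) := by
  rw [field, ncoeff_mkField]

theorem act_add (u w : D.U) : D.act (u + w) = D.act u + D.act w := by
  refine LinearMap.ext fun v => ?_
  obtain ⟨y, rfl⟩ := D.annIdeal.mkQ_surjective v
  simp [act_mk, add_mul, -Submodule.mkQ_apply]

theorem act_smul (c : ℂ) (u : D.U) : D.act (c • u) = c • D.act u := by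
  refine LinearMap.ext fun v => ?_
  obtain ⟨y, rfl⟩ := D.annIdeal.mkQ_surjective v
  simp [act_mk, -Submodule.mkQ_apply]

theorem act_mul (u w : D.U) : D.act (u * w) = D.act u * D.act w := by
  refine LinearMap.ext fun v => ?_
  obtain ⟨y, rfl⟩ := D.annIdeal.mkQ_surjective v
  simp only [act_mk, Module.End.mul_apply, mul_assoc]

theorem act_algebraMap (c : ℂ) : D.act (algebraMap ℂ _ c) = c • 1 := by
  rw [Algebra.algebraMap_eq_smul_one, act_smul]
  congr 1
  refine LinearMap.ext fun v => ?_
  obtain ⟨y, rfl⟩ := D.annIdeal.mkQ_surjective v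
  simp only [act_mk, one_mul, Module.End.one_apply]

/-- The assignment of fields to currents, as a linear map. -/
def fieldL : P →ₗ[ℂ] VertexOperator ℂ D.V where
  toFun := D.field
  map_add' a b := field_ext fun n => by simp [gen_add, act_add]
  map_smul' c a := field_ext fun n => by simp [gen_smul, act_smul]

@[simp] theorem fieldL_apply (a : P) : D.fieldL a = D.field a := rfl

theorem conj_field (a : P) (n : ℤ) :
    D.ΓV * (D.field a)[[n]] * D.ΓV = (D.field (D.Γ a))[[n]] := by
  rw [ncoeff_field, ncoeff_field, conj_act, parityU_gen]

theorem fieldPar_field {p : ZMod 2} {a : P} (ha : D.Γ a = sg p • a) :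
    FieldPar D.ΓV p (D.field a) := by
  intro n
  rw [IsPar, conj_field, ha, ← fieldL_apply, map_smul, map_smul]
  rfl

/-- `Γ ^ p` on the space of currents. -/
def ΓPow (p : ZMod 2) : P →ₗ[ℂ] P := if p = 0 then LinearMap.id else D.Γ

theorem isConj_field (p : ZMod 2) (a : P) :
    IsConj D.ΓV p (D.field a) (D.field (D.ΓPow p a)) := by
  intro n
  induction p using zmod_two_cases with
  | h0 => simp [ΓPow]
  | h1 => rw [conj_one_left, conj_field, ΓPow, if_neg one_ne_zero]

/-- The defining relations of the algebra of modes already are the commutator formula: δ_{m+n,-1} is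
the mode of the field 1 in the λ⁰ term, and m δ_{m+n,0} the one in the λ¹ term. -/
theorem OPE_field_of_homogeneous {p q : ZMod 2} {a b : P} (ha : D.Γ a = sg p • a)
    (hb : D.Γ b = sg q • b) :
    OPE D.ΓV (D.field a) (D.field b) (D.field (D.br a b) + D.α a b • oneField)
      (D.β a b • oneField) 0 := by
  intro m n
  have hc : conj D.ΓV p ((D.field b)[[n]]) = sg (p * q) • (D.field b)[[n]] := by
    rw [← isConj_field D p b n, ← fieldL_apply, ← fieldL_apply, ← Pi.smul_apply, ← map_smul,
      ← map_smul]
    induction p using zmod_two_cases with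
    | h0 => simp [ΓPow, sg_zero]
    | h1 => simp [ΓPow, hb]
  rw [scomm_of_isPar (D.fieldPar_field ha m), hc]
  simp only [map_add, map_smul, Pi.add_apply, Pi.smul_apply, ncoeff_oneField, ncoeff_field,
    map_zero, Pi.zero_apply, smul_zero, add_zero]
  rw [← act_mul, D.gen_mul_gen p q a b m n ha hb, smul_mul_assoc, ← act_mul, act_add, act_add,
    act_smul, act_algebraMap]
  split_ifs <;> first | omega | module

theorem OPE_field (a b : P) :
    OPE D.ΓV (D.field a) (D.field b) (D.field (D.br a b) + D.α a b • oneField)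
      (D.β a b • oneField) 0 := by
  obtain ⟨a₀, a₁, rfl, ha₀, ha₁⟩ := D.exists_homogeneous a
  obtain ⟨b₀, b₁, rfl, hb₀, hb₁⟩ := D.exists_homogeneous b
  have h := ((D.OPE_field_of_homogeneous ha₀ hb₀).add_right
    (D.OPE_field_of_homogeneous ha₀ hb₁)).add_left
      ((D.OPE_field_of_homogeneous ha₁ hb₀).add_right (D.OPE_field_of_homogeneous ha₁ hb₁))
  simp only [← fieldL_apply, ← map_add] at h
  simp only [← fieldL_apply]
  refine h.of_eq ?_ ?_ ?_
  · simp only [map_add, LinearMap.add_apply]; module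
  · simp only [map_add, LinearMap.add_apply]; module
  · simp

end CurrentData

/-! ### Lie superalgebra identities with a single homogeneous argument. -/

section Super

variable {g : Type*} [AddCommGroup g] [Module ℂ g] [LieSuperalgebra g]

theorem ext_homogeneous {M : Type*} [AddCommGroup M] [Module ℂ M] {f h : g →ₗ[ℂ] M}
    (H : ∀ (q : ZMod 2) (a : g), parity a = sg q • a → f a = h a) : f = h := by
  ext a
  have ha : a = (1 / 2 : ℂ) • (a + parity a) + (1 / 2 : ℂ) • (a - parity a) := by module
  have h0 := H 0 (a + parity a) (by
    rw [map_add, LieSuperalgebra.parity_parity, sg_zero, one_smul, add_comm])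
  have h1 := H 1 (a - parity a) (by
    rw [map_sub, LieSuperalgebra.parity_parity, sg_one]; module)
  rw [ha, map_add f, map_add h, map_smul f, map_smul f, map_smul h, map_smul h, h0, h1]

/-- `Γ ^ p` for the parity operator `Γ`. -/
def parPow (p : ZMod 2) : g →ₗ[ℂ] g := if p = 0 then LinearMap.id else parity

@[simp] theorem parPow_zero (a : g) : parPow 0 a = a := by simp [parPow]

@[simp] theorem parPow_one (a : g) : parPow 1 a = parity a := by simp [parPow]

theorem parPow_of_parity (p : ZMod 2) {q : ZMod 2} {a : g} (ha : parity a = sg q • a) :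
    parPow p a = sg (p * q) • a := by
  induction p using zmod_two_cases with
  | h0 => simp [sg_zero]
  | h1 => rw [parPow_one, ha, one_mul]

theorem parPow_parPow (p : ZMod 2) (a : g) : parPow p (parPow p a) = a := by
  induction p using zmod_two_cases <;> simp [LieSuperalgebra.parity_parity]

theorem parity_parPow (p : ZMod 2) (a : g) : parity (parPow p a) = parPow p (parity a) := by
  induction p using zmod_two_cases <;> simp

theorem parPow_br (p : ZMod 2) (a b : g) : parPow p (br a b) = br (parPow p a) (parPow p b) := by
  induction p using zmod_two_cases <;> simp [LieSuperalgebra.parity_br]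

variable {p : ZMod 2} {v : g} (hv : parity v = sg p • v)
include hv

theorem parity_br_of_parity (a : g) : parity (br v a) = sg p • br v (parity a) := by
  rw [LieSuperalgebra.parity_br, hv, map_smul, LinearMap.smul_apply]

/-- The sign of the super Jacobi identity depends on `a` only through its parity, so it can be
carried by `parPow p a`; `a` and `b` are then arbitrary. -/
theorem br_br_of_parity (a b : g) :
    br v (br a b) = br (br v a) b + br (parPow p a) (br v b) := by
  have := ext_homogeneous (f := br v ∘ₗ br.flip b)
    (h := br.flip b ∘ₗ br v + br.flip (br v b) ∘ₗ parPow p) fun q a ha => by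
      simpa [parPow_of_parity p ha] using LieSuperalgebra.jacobi p q v a b hv ha
  simpa using DFunLike.congr_fun this a

theorem br_skew_of_parity (a : g) : br v a = -br (parPow p a) v := by
  have := ext_homogeneous (f := br v) (h := -(br.flip v ∘ₗ parPow p)) fun q a ha => by
      simpa [parPow_of_parity p ha] using LieSuperalgebra.skew p q v a hv ha
  simpa using DFunLike.congr_fun this a

end Super

section Canonical

/-- Adjoint operators can be moved across the canonical element of a perfect pairing. -/
theorem sum_canonical_adjoint {E E' M J : Type*} [AddCommGroup E] [Module ℂ E] [AddCommGroup E']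
    [Module ℂ E'] [AddCommGroup M] [Module ℂ M] [Fintype J] (e : J → E) (e' : J → E')
    (pr : E →ₗ[ℂ] E' →ₗ[ℂ] ℂ) (he : ∀ a, ∑ j, pr a (e' j) • e j = a)
    (he' : ∀ w, ∑ j, pr (e j) w • e' j = w) (B : E →ₗ[ℂ] E' →ₗ[ℂ] M) (A : E →ₗ[ℂ] E)
    (A' : E' →ₗ[ℂ] E') (hA : ∀ a w, pr (A a) w = pr a (A' w)) :
    ∑ j, B (A (e j)) (e' j) = ∑ j, B (e j) (A' (e' j)) := by
  -- Expanding both sides in the two families gives double sums whose coefficient matrices are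
  -- transposes of each other, by adjointness.
  have h1 : ∀ j, B (A (e j)) (e' j) = ∑ i, pr (A (e j)) (e' i) • B (e i) (e' j) := by
    intro j
    conv_lhs => rw [← he (A (e j))]
    simp
  have h2 : ∀ j, B (e j) (A' (e' j)) = ∑ i, pr (e i) (A' (e' j)) • B (e j) (e' i) := by
    intro j
    conv_lhs => rw [← he' (A' (e' j))]
    simp
  simp only [h1, h2]
  rw [Finset.sum_comm]
  simp only [hA]

end Canonical

/-! ### The gradation by ad x, bases of g_+ and g_{1/2}, projections and compressions. -/

namespace ReductionData

variable {g : Type*} [AddCommGroup g] [Module ℂ g] [LieSuperalgebra g] (Q : ReductionData g)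

theorem form_symm_of_parity {p : ZMod 2} {v : g} (hv : parity v = sg p • v) (a : g) :
    Q.form v a = Q.form (parPow p a) v := by
  have := ext_homogeneous (f := Q.form v) (h := Q.form.flip v ∘ₗ parPow p) fun q a ha => by
      simpa [parPow_of_parity p ha] using Q.form_symm p q v a hv ha
  simpa using DFunLike.congr_fun this a

theorem form_br_of_parity {p : ZMod 2} {v : g} (hv : parity v = sg p • v) (a b : g) :
    Q.form (br v a) b = -Q.form (parPow p a) (br v b) := by
  rw [br_skew_of_parity hv, map_neg, LinearMap.neg_apply, Q.form_inv]

theorem x_parity : parity Q.x = sg 0 • Q.x := by rw [Q.x_even, sg_zero, one_smul]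

theorem f_parity : parity Q.f = sg 0 • Q.f := by rw [Q.f_even, sg_zero, one_smul]

theorem mem_gr_iff {x a : g} {n : ℤ} : a ∈ gr x n ↔ br x a = ((n : ℂ) / 2) • a := by
  rw [gr, Module.End.mem_eigenspace_iff]

theorem br_mem_gr {m n : ℤ} {a b : g} (ha : a ∈ gr Q.x m) (hb : b ∈ gr Q.x n) :
    br a b ∈ gr Q.x (m + n) := by
  rw [mem_gr_iff] at *
  rw [br_br_of_parity Q.x_parity, ha, parPow_zero, hb, map_smul, map_smul, LinearMap.smul_apply]
  push_cast
  module

/-- Invariance under ad x says that (m+n)/2 times the pairing is zero. -/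
theorem form_eq_zero {m n : ℤ} {a b : g} (ha : a ∈ gr Q.x m) (hb : b ∈ gr Q.x n)
    (h : m + n ≠ 0) : Q.form a b = 0 := by
  have := Q.form_br_of_parity Q.x_parity a b
  rw [mem_gr_iff] at ha hb
  rw [ha, parPow_zero, hb, map_smul, map_smul, LinearMap.smul_apply, smul_eq_mul, smul_eq_mul]
    at this
  have h2 : ((m + n : ℤ) : ℂ) * Q.form a b = 0 := by
    push_cast
    linear_combination 2 * this
  exact (mul_eq_zero.1 h2).resolve_left (by exact_mod_cast h)

theorem x_mem : Q.x ∈ gr Q.x 0 := by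
  rw [mem_gr_iff]
  have := br_skew_of_parity Q.x_parity Q.x
  rw [parPow_zero] at this
  have h : (2 : ℂ) • br Q.x Q.x = 0 := by
    rw [two_smul]; nth_rewrite 1 [this]; simp
  simpa using h

namespace AdaptedBasis

variable {Q} {ι : Type*} [Fintype ι] (𝔲 : Q.AdaptedBasis ι)

theorem coord_br_x (i : ι) (a : g) :
    𝔲.u.coord i (br Q.x a) = 𝔲.m i * 𝔲.u.coord i a := by
  classical
  have h1 : 𝔲.u.coord i ∘ₗ br Q.x = 𝔲.m i • 𝔲.u.coord i := by
    refine 𝔲.u.ext fun j => ?_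
    have := mem_gr_iff.1 (𝔲.u_mem j)
    rw [LinearMap.comp_apply, this]
    simp only [map_smul, Module.Basis.coord_apply, Module.Basis.repr_self, LinearMap.smul_apply,
      Finsupp.single_apply]
    split_ifs with h
    · rw [h, m]
    · simp
  exact DFunLike.congr_fun h1 a

theorem coord_eq_zero {n : ℤ} {a : g} (ha : a ∈ gr Q.x n) {i : ι} (hi : 𝔲.deg i ≠ n) :
    𝔲.u.coord i a = 0 := by
  have h2 := 𝔲.coord_br_x i a
  rw [mem_gr_iff.1 ha, map_smul, smul_eq_mul, m] at h2
  have h3 : ((n - 𝔲.deg i : ℤ) : ℂ) * 𝔲.u.coord i a = 0 := by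
    push_cast
    linear_combination 2 * h2
  exact (mul_eq_zero.1 h3).resolve_left (by exact_mod_cast sub_ne_zero.2 (Ne.symm hi))

theorem coord_parity (i : ι) (a : g) :
    𝔲.u.coord i (parity a) = sg (𝔲.par i) * 𝔲.u.coord i a := by
  classical
  have : 𝔲.u.coord i ∘ₗ parity = sg (𝔲.par i) • 𝔲.u.coord i := by
    refine 𝔲.u.ext fun j => ?_
    rw [LinearMap.comp_apply, 𝔲.parity_u]
    simp only [map_smul, Module.Basis.coord_apply, Module.Basis.repr_self, LinearMap.smul_apply,
      Finsupp.single_apply]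
    split_ifs with h
    · rw [h]
    · simp
  exact DFunLike.congr_fun this a

theorem coord_eq_zero_of_mem_gPlus {a : g} (ha : a ∈ Q.gPlus) {i : ι} (hi : ¬ 0 < 𝔲.deg i) :
    𝔲.u.coord i a = 0 := by
  have : Q.gPlus ≤ LinearMap.ker (𝔲.u.coord i) := iSup_le fun n a ha =>
    𝔲.coord_eq_zero ha (by have := n.2; omega)
  exact this ha

/-- The part of an adapted basis that spans a subspace `W`. -/
def subBasis (W : Submodule ℂ g) (P : ι → Prop) (h1 : ∀ i, P i → 𝔲.u i ∈ W)
    (h2 : ∀ a ∈ W, ∀ i, ¬ P i → 𝔲.u.coord i a = 0) : Module.Basis {i // P i} ℂ W :=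
  Module.Basis.mk (v := fun i : {i // P i} => (⟨𝔲.u i, h1 i i.2⟩ : W))
    (LinearIndependent.of_comp W.subtype
      (𝔲.u.linearIndependent.comp (fun i : {i // P i} => (i : ι)) Subtype.val_injective))
    (by
      classical
      rintro ⟨a, ha⟩ -
      have : (⟨a, ha⟩ : W) = ∑ i : {i // P i}, 𝔲.u.coord i a • (⟨𝔲.u i, h1 i i.2⟩ : W) := by
        refine Subtype.ext ?_
        simp only [Submodule.coe_sum, Submodule.coe_smul]
        conv_lhs => rw [← 𝔲.u.sum_repr a]
        rw [← Finset.sum_subtype (Finset.univ.filter P) (by simp)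
          (fun i => 𝔲.u.coord i a • 𝔲.u i)]
        refine (Finset.sum_filter_of_ne fun i _ hi => ?_).symm
        by_contra hP
        exact hi (by rw [← Module.Basis.coord_apply, h2 a ha i hP, zero_smul])
      rw [this]
      exact Submodule.sum_mem _ fun i _ => Submodule.smul_mem _ _ (Submodule.subset_span ⟨i, rfl⟩))

theorem subBasis_apply (W : Submodule ℂ g) (P : ι → Prop) (h1 : ∀ i, P i → 𝔲.u i ∈ W)
    (h2 : ∀ a ∈ W, ∀ i, ¬ P i → 𝔲.u.coord i a = 0) (i : {i // P i}) :
    (𝔲.subBasis W P h1 h2 i : g) = 𝔲.u i := by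
  simp [subBasis]

theorem subBasis_coord (W : Submodule ℂ g) (P : ι → Prop) (h1 : ∀ i, P i → 𝔲.u i ∈ W)
    (h2 : ∀ a ∈ W, ∀ i, ¬ P i → 𝔲.u.coord i a = 0) (i : {i // P i}) :
    (𝔲.subBasis W P h1 h2).coord i = 𝔲.u.coord i ∘ₗ W.subtype := by
  refine (𝔲.subBasis W P h1 h2).ext fun j => ?_
  classical
  simp [subBasis_apply, Finsupp.single_apply, Subtype.ext_iff]

/-- The basis of `g_+`. -/
def bPlus : Module.Basis 𝔲.S ℂ Q.gPlus :=
  𝔲.subBasis Q.gPlus (fun i => 0 < 𝔲.deg i)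
    (fun i hi => Submodule.mem_iSup_of_mem (⟨𝔲.deg i, hi⟩ : {n : ℤ // 0 < n}) (𝔲.u_mem i))
    (fun _ ha _ hi => 𝔲.coord_eq_zero_of_mem_gPlus ha hi)

@[simp] theorem bPlus_apply (i : 𝔲.S) : (𝔲.bPlus i : g) = 𝔲.u i := 𝔲.subBasis_apply _ _ _ _ i

theorem bPlus_coord (i : 𝔲.S) : 𝔲.bPlus.coord i = 𝔲.u.coord i ∘ₗ Q.gPlus.subtype :=
  𝔲.subBasis_coord _ _ _ _ i

/-- The basis of `g_{1/2}`. -/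
def bHalf : Module.Basis 𝔲.S' ℂ Q.gHalf :=
  𝔲.subBasis Q.gHalf (fun i => 𝔲.deg i = 1) (fun i hi => Q.mem_gHalf hi (𝔲.u_mem i))
    (fun _ ha _ hi => 𝔲.coord_eq_zero ha hi)

@[simp] theorem bHalf_apply (i : 𝔲.S') : (𝔲.bHalf i : g) = 𝔲.u i := 𝔲.subBasis_apply _ _ _ _ i

theorem bHalf_coord (i : 𝔲.S') : 𝔲.bHalf.coord i = 𝔲.u.coord i ∘ₗ Q.gHalf.subtype :=
  𝔲.subBasis_coord _ _ _ _ i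

/-- The projection of `g` onto `g_+`. -/
def projPlus : g →ₗ[ℂ] Q.gPlus := ∑ i : 𝔲.S, (𝔲.u.coord i).smulRight (𝔲.bPlus i)

/-- The projection of `g` onto `g_{1/2}`. -/
def projHalf : g →ₗ[ℂ] Q.gHalf := ∑ i : 𝔲.S', (𝔲.u.coord i).smulRight (𝔲.bHalf i)

theorem projPlus_apply (a : g) : 𝔲.projPlus a = ∑ i : 𝔲.S, 𝔲.u.coord i a • 𝔲.bPlus i := by
  simp [projPlus]

theorem projHalf_apply (a : g) : 𝔲.projHalf a = ∑ i : 𝔲.S', 𝔲.u.coord i a • 𝔲.bHalf i := by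
  simp [projHalf]

@[simp] theorem projPlus_coe (a : Q.gPlus) : 𝔲.projPlus a = a := by
  rw [projPlus_apply]
  conv_rhs => rw [← 𝔲.bPlus.sum_repr a]
  refine Finset.sum_congr rfl fun i _ => ?_
  rw [← Module.Basis.coord_apply, bPlus_coord]
  rfl

@[simp] theorem projHalf_coe (a : Q.gHalf) : 𝔲.projHalf a = a := by
  rw [projHalf_apply]
  conv_rhs => rw [← 𝔲.bHalf.sum_repr a]
  refine Finset.sum_congr rfl fun i _ => ?_
  rw [← Module.Basis.coord_apply, bHalf_coord]
  rfl

theorem projPlus_eq_zero {n : ℤ} (hn : n ≤ 0) {a : g} (ha : a ∈ gr Q.x n) :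
    𝔲.projPlus a = 0 := by
  rw [projPlus_apply]
  refine Finset.sum_eq_zero fun i _ => ?_
  rw [𝔲.coord_eq_zero ha (by have := i.2; omega), zero_smul]

theorem coe_projPlus {a : g} (ha : a ∈ Q.gPlus) : (𝔲.projPlus a : g) = a :=
  congrArg Subtype.val (𝔲.projPlus_coe ⟨a, ha⟩)

theorem coe_projHalf {a : g} (ha : a ∈ Q.gHalf) : (𝔲.projHalf a : g) = a :=
  congrArg Subtype.val (𝔲.projHalf_coe ⟨a, ha⟩)

theorem parityPlus_bPlus (i : 𝔲.S) : Q.parityPlus (𝔲.bPlus i) = sg (𝔲.par i) • 𝔲.bPlus i :=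
  Subtype.ext (by simpa [parityPlus] using 𝔲.parity_u i)

theorem parityHalf_bHalf (i : 𝔲.S') : Q.parityHalf (𝔲.bHalf i) = sg (𝔲.par i) • 𝔲.bHalf i :=
  Subtype.ext (by simpa [parityHalf] using 𝔲.parity_u i)

theorem projPlus_parity (a : g) : 𝔲.projPlus (parity a) = Q.parityPlus (𝔲.projPlus a) := by
  simp only [projPlus_apply, map_sum, map_smul, parityPlus_bPlus, coord_parity]
  refine Finset.sum_congr rfl fun i _ => ?_
  module

theorem projHalf_parity (a : g) : 𝔲.projHalf (parity a) = Q.parityHalf (𝔲.projHalf a) := by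
  simp only [projHalf_apply, map_sum, map_smul, parityHalf_bHalf, coord_parity]
  refine Finset.sum_congr rfl fun i _ => ?_
  module

/-- The compression of `ad v` to `g_+`. -/
def adPlus : g →ₗ[ℂ] Module.End ℂ Q.gPlus :=
  LinearMap.mk₂ ℂ (fun v a => 𝔲.projPlus (br v (a : g))) (by intros; simp) (by intros; simp)
    (by intros; simp) (by intros; simp)

/-- The compression of `ad v` to `g_{1/2}`. -/
def adHalf : g →ₗ[ℂ] Module.End ℂ Q.gHalf :=
  LinearMap.mk₂ ℂ (fun v a => 𝔲.projHalf (br v (a : g))) (by intros; simp) (by intros; simp)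
    (by intros; simp) (by intros; simp)

theorem adPlus_apply (v : g) (a : Q.gPlus) : 𝔲.adPlus v a = 𝔲.projPlus (br v (a : g)) := rfl

theorem adHalf_apply (v : g) (a : Q.gHalf) : 𝔲.adHalf v a = 𝔲.projHalf (br v (a : g)) := rfl

end AdaptedBasis
end ReductionData

/-! ### Dual bases, the Casimir operator and the dual Coxeter number. -/

namespace ReductionData

variable {g : Type*} [AddCommGroup g] [Module ℂ g] [LieSuperalgebra g] (Q : ReductionData g)

theorem form_parPow (p : ZMod 2) (a b : g) : Q.form (parPow p a) (parPow p b) = Q.form a b := by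
  induction p using zmod_two_cases with
  | h0 => simp
  | h1 => simp [Q.form_even]

theorem form_nondeg_right {a : g} (h : ∀ b, Q.form b a = 0) : a = 0 := by
  refine Q.form_nondeg a fun b => ?_
  have := ext_homogeneous (f := Q.form a) (h := 0) fun q b hb => by
    have h1 := Q.form_symm_of_parity hb (parPow q a)
    rw [parPow_parPow] at h1
    rw [← h1, ← Q.form_parPow q, parPow_parPow, h, LinearMap.zero_apply]
  exact DFunLike.congr_fun this b

theorem br_mem_gPlus {n : ℤ} (hn : 0 ≤ n) {v : g} (hv : v ∈ gr Q.x n) {a : g}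
    (ha : a ∈ Q.gPlus) : br v a ∈ Q.gPlus := by
  have : Q.gPlus ≤ Q.gPlus.comap (br v) := by
    refine iSup_le fun l a ha => ?_
    have hl := l.2
    exact Submodule.mem_iSup_of_mem (⟨n + l, by omega⟩ : {n : ℤ // 0 < n}) (Q.br_mem_gr hv ha)
  exact this ha

theorem br_mem_gHalf {v : g} (hv : v ∈ gr Q.x 0) {a : g} (ha : a ∈ Q.gHalf) :
    br v a ∈ Q.gHalf := by
  have := Q.br_mem_gr hv ha
  rwa [zero_add] at this

@[simp] theorem coe_parityPlus (a : Q.gPlus) : (Q.parityPlus a : g) = parity (a : g) := rfl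

@[simp] theorem coe_parityHalf (a : Q.gHalf) : (Q.parityHalf a : g) = parity (a : g) := rfl

@[simp] theorem parityPlus_parityPlus (a : Q.gPlus) : Q.parityPlus (Q.parityPlus a) = a :=
  Subtype.ext (LieSuperalgebra.parity_parity _)

@[simp] theorem parityHalf_parityHalf (a : Q.gHalf) : Q.parityHalf (Q.parityHalf a) = a :=
  Subtype.ext (LieSuperalgebra.parity_parity _)

/-- The form `⟨a, b⟩` on `g_{1/2}` as a bilinear map. -/
def formHalfB : Q.gHalf →ₗ[ℂ] Q.gHalf →ₗ[ℂ] ℂ :=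
  LinearMap.mk₂ ℂ Q.formHalf (by intros; simp [formHalf]) (by intros; simp [formHalf])
    (by intros; simp [formHalf]) (by intros; simp [formHalf])

@[simp] theorem formHalfB_apply (a b : Q.gHalf) : Q.formHalfB a b = Q.formHalf a b := rfl

theorem formHalf_parityHalf (a b : Q.gHalf) :
    Q.formHalf (Q.parityHalf a) (Q.parityHalf b) = Q.formHalf a b := by
  have := Q.form_even Q.f (br (a : g) (b : g))
  rw [Q.f_even, LieSuperalgebra.parity_br] at this
  exact this

/-- By invariance ⟨a,w⟩ = ([f,a]|w), and ad f maps g_{1/2} onto g_{-1/2}; so `w` is orthogonal to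
g_{-1/2}. It is orthogonal to all other degrees by `form_eq_zero`. -/
theorem formHalf_nondeg_right {w : Q.gHalf} (h : ∀ a, Q.formHalf a w = 0) : w = 0 := by
  have h1 : ∀ c ∈ gr Q.x (-1), Q.form c w = 0 := by
    intro c hc
    obtain ⟨a, ha, rfl⟩ := Q.f_bij.surjOn hc
    rw [Q.form_inv]
    exact h ⟨a, ha⟩
  refine Subtype.ext (Q.form_nondeg_right fun b => ?_)
  have h2 : (⨆ n : ℤ, gr Q.x n) ≤ LinearMap.ker (Q.form.flip (w : g)) := by
    refine iSup_le fun n b hb => ?_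
    by_cases hn : n = -1
    · subst hn; exact h1 b hb
    · exact Q.form_eq_zero hb w.2 (by omega)
  rw [Q.x_diag] at h2
  exact h2 (Submodule.mem_top (x := b))

/-- Invariance moves v onto f, and [v,f] = 0. This is how membership in g_0^f enters both the
skewness on g_{1/2} and the invariance of the linear term of d. -/
theorem form_f_br_eq_zero {p : ZMod 2} {v : g} (hv : parity v = sg p • v)
    (hf : v ∈ Q.centralizer₀) (a : g) : Q.form Q.f (br v a) = 0 := by
  have h1 : br v Q.f = 0 := by
    have h := br_skew_of_parity Q.f_parity v
    have h0 : br Q.f v = 0 := hf.2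
    rw [h0, parPow_zero] at h
    exact neg_eq_zero.1 h.symm
  have h2 := Q.form_br_of_parity hv Q.f a
  rw [h1, parPow_of_parity p Q.f_parity, mul_zero, sg_zero, one_smul] at h2
  simpa using h2.symm

namespace AdaptedBasis

variable {Q} {ι : Type*} [Fintype ι] (𝔲 : Q.AdaptedBasis ι)

theorem form_uDual (a : g) (j : ι) : Q.form a (𝔲.uDual j) = 𝔲.u.coord j a := by
  classical
  have : Q.form.flip (𝔲.uDual j) = 𝔲.u.coord j := 𝔲.u.ext fun i => by
    rw [LinearMap.flip_apply, 𝔲.form_u, Module.Basis.coord_apply, Module.Basis.repr_self,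
      Finsupp.single_apply]
  exact DFunLike.congr_fun this a

theorem sum_form_uDual (a : g) : ∑ j, Q.form a (𝔲.uDual j) • 𝔲.u j = a := by
  simp only [form_uDual, Module.Basis.coord_apply, 𝔲.u.sum_repr]

theorem eq_of_form_u {a b : g} (h : ∀ i, Q.form (𝔲.u i) a = Q.form (𝔲.u i) b) : a = b := by
  rw [← sub_eq_zero]
  refine Q.form_nondeg_right fun c => ?_
  have : Q.form.flip (a - b) = 0 := 𝔲.u.ext fun i => by simp [h i]
  exact DFunLike.congr_fun this c

theorem sum_form_u (w : g) : ∑ j, Q.form (𝔲.u j) w • 𝔲.uDual j = w := by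
  classical
  refine 𝔲.eq_of_form_u fun i => ?_
  simp only [map_sum, map_smul, 𝔲.form_u, smul_eq_mul]
  rw [Finset.sum_eq_single i]
  · simp
  · intro j _ hj
    rw [if_neg (Ne.symm hj), mul_zero]
  · simp

theorem parity_uDual (i : ι) : parity (𝔲.uDual i) = sg (𝔲.par i) • 𝔲.uDual i := by
  refine 𝔲.eq_of_form_u fun j => ?_
  have h := Q.form_even (𝔲.u j) (parity (𝔲.uDual i))
  rw [LieSuperalgebra.parity_parity, 𝔲.parity_u, map_smul, LinearMap.smul_apply] at h
  rw [← h, map_smul, 𝔲.form_u]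
  split_ifs with hij
  · rw [hij]
  · simp

theorem uDual_mem (i : ι) : 𝔲.uDual i ∈ gr Q.x (-𝔲.deg i) := by
  rw [mem_gr_iff]
  refine 𝔲.eq_of_form_u fun j => ?_
  have h := Q.form_br_of_parity Q.x_parity (𝔲.u j) (𝔲.uDual i)
  rw [mem_gr_iff.1 (𝔲.u_mem j), parPow_zero, map_smul, LinearMap.smul_apply] at h
  rw [map_smul, ← neg_eq_iff_eq_neg.2 h, 𝔲.form_u]
  split_ifs with hij
  · rw [hij]; push_cast; simp; ring
  · simp

theorem sum_u_adjoint {M : Type*} [AddCommGroup M] [Module ℂ M] (B : g →ₗ[ℂ] g →ₗ[ℂ] M)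
    (A A' : g →ₗ[ℂ] g) (hA : ∀ a w, Q.form (A a) w = Q.form a (A' w)) :
    ∑ j, B (A (𝔲.u j)) (𝔲.uDual j) = ∑ j, B (𝔲.u j) (A' (𝔲.uDual j)) :=
  sum_canonical_adjoint _ _ Q.form 𝔲.sum_form_uDual 𝔲.sum_form_u B A A' hA

/-- Behaviour of the Casimir element under exchange of its two factors. -/
theorem sum_uDual_u {M : Type*} [AddCommGroup M] [Module ℂ M] (F : ℤ → ℂ)
    (B : g →ₗ[ℂ] g →ₗ[ℂ] M) :
    ∑ i, F (𝔲.deg i) • B (𝔲.uDual i) (𝔲.u i) =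
      ∑ i, (F (-𝔲.deg i) * sg (𝔲.par i)) • B (𝔲.u i) (𝔲.uDual i) := by
  have h1 : ∀ i, F (𝔲.deg i) • B (𝔲.uDual i) (𝔲.u i) =
      ∑ j, (F (𝔲.deg i) * Q.form (𝔲.uDual i) (𝔲.uDual j)) • B (𝔲.u j) (𝔲.u i) := by
    intro i
    conv_lhs => rw [← 𝔲.sum_form_uDual (𝔲.uDual i)]
    simp [Finset.smul_sum, smul_smul]
  have h2 : ∀ j, (F (-𝔲.deg j) * sg (𝔲.par j)) • B (𝔲.u j) (𝔲.uDual j) =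
      ∑ i, (F (-𝔲.deg j) * sg (𝔲.par j) * Q.form (𝔲.uDual j) (𝔲.uDual i)) •
        B (𝔲.u j) (𝔲.u i) := by
    intro j
    conv_lhs => rw [← 𝔲.sum_form_uDual (𝔲.uDual j)]
    simp only [map_sum, map_smul, Finset.smul_sum, smul_smul]
  simp only [h1, h2]
  rw [Finset.sum_comm]
  refine Finset.sum_congr rfl fun j _ => Finset.sum_congr rfl fun i _ => ?_
  congr 1
  -- The Gram matrix (u^i|u^j) vanishes unless the degrees are opposite and the parities agree. The
  -- first fact replaces the weight at `i` by the weight at minus the degree of `j`, the second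
  -- reduces the sign of supersymmetry to that of one index.
  by_cases hd : -𝔲.deg i + -𝔲.deg j = 0
  · have h3 := Q.form_symm_of_parity (𝔲.parity_uDual i) (𝔲.uDual j)
    rw [parPow_of_parity _ (𝔲.parity_uDual j), map_smul, LinearMap.smul_apply, smul_eq_mul] at h3
    have h4 := Q.form_even (𝔲.uDual j) (𝔲.uDual i)
    rw [parity_uDual, parity_uDual, map_smul, map_smul, LinearMap.smul_apply, smul_eq_mul,
      smul_eq_mul, ← mul_assoc] at h4
    rw [show -𝔲.deg j = 𝔲.deg i by omega, h3, mul_assoc]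
    congr 1
    generalize Q.form (𝔲.uDual j) (𝔲.uDual i) = t at *
    revert h4
    generalize 𝔲.par i = a
    generalize 𝔲.par j = b
    induction a using zmod_two_cases <;> induction b using zmod_two_cases <;>
      (simp [sg]; try intro h) <;> first | linear_combination (-1 / 2 : ℂ) * h | linear_combination -h
  · rw [Q.form_eq_zero (𝔲.uDual_mem i) (𝔲.uDual_mem j) hd, Q.form_eq_zero (𝔲.uDual_mem j)
      (𝔲.uDual_mem i) (by omega)]
    simp

/-- Invariance of the Casimir element. -/
theorem sum_casimir_invariant {M : Type*} [AddCommGroup M] [Module ℂ M]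
    (B : g →ₗ[ℂ] g →ₗ[ℂ] M) {p : ZMod 2} {v : g} (hv : parity v = sg p • v) :
    ∑ i, sg (𝔲.par i) • B (br v (𝔲.u i)) (𝔲.uDual i) +
      ∑ i, sg (𝔲.par i) • B (parPow p (𝔲.u i)) (br v (𝔲.uDual i)) = 0 := by
  -- The weights (-1)^{p(u_i)} are produced by the parity operator in the first slot. With respect
  -- to the form, -(ad v)Γ^p and ad v are adjoint, so ad v can be carried across the Casimir
  -- element.
  have h := 𝔲.sum_u_adjoint (B ∘ₗ parPow p ∘ₗ parity) (-(br v ∘ₗ parPow p)) (br v) fun a w => by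
    rw [LinearMap.neg_apply, map_neg, LinearMap.neg_apply, LinearMap.comp_apply,
      Q.form_br_of_parity hv, parPow_parPow, neg_neg]
  have h1 : ∀ i, (B ∘ₗ parPow p ∘ₗ parity) ((-(br v ∘ₗ parPow p)) (𝔲.u i)) (𝔲.uDual i) =
      -(sg (𝔲.par i) • B (br v (𝔲.u i)) (𝔲.uDual i)) := by
    intro i
    simp only [LinearMap.neg_apply, LinearMap.comp_apply, map_neg]
    rw [parity_br_of_parity hv, map_smul, parPow_br, parPow_of_parity p hv, parity_parPow,
      parPow_parPow, 𝔲.parity_u]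
    simp only [map_smul, LinearMap.smul_apply, smul_smul]
    congr 2
    generalize 𝔲.par i = q
    clear h
    induction p using zmod_two_cases <;> induction q using zmod_two_cases <;> simp [sg]
  have h2 : ∀ i, (B ∘ₗ parPow p ∘ₗ parity) (𝔲.u i) (br v (𝔲.uDual i)) =
      sg (𝔲.par i) • B (parPow p (𝔲.u i)) (br v (𝔲.uDual i)) := by
    intro i
    simp only [LinearMap.comp_apply, 𝔲.parity_u, map_smul, LinearMap.smul_apply]
  simp only [h1, h2, Finset.sum_neg_distrib] at h
  rw [← h]
  abel

theorem casimir_apply (a : g) :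
    𝔲.casimir a = ∑ i, sg (𝔲.par i) • br (𝔲.u i) (br (𝔲.uDual i) a) := by
  simp [casimir]

theorem parity_casimir (a : g) : parity (𝔲.casimir a) = 𝔲.casimir (parity a) := by
  simp only [casimir_apply, map_sum, map_smul, LieSuperalgebra.parity_br, 𝔲.parity_u,
    𝔲.parity_uDual, LinearMap.smul_apply]
  refine Finset.sum_congr rfl fun i _ => ?_
  rw [smul_smul (sg (𝔲.par i)) (sg (𝔲.par i)), sg_mul_self, one_smul]

/-- Apply invariance of the Casimir element to the bilinear map (a, c) ↦ [a,[c,b]]; Jacobi, used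
twice, turns the result into commutation with ad v. -/
theorem casimir_br (a b : g) : 𝔲.casimir (br a b) = br a (𝔲.casimir b) := by
  have : 𝔲.casimir ∘ₗ br.flip b = br.flip (𝔲.casimir b) := ext_homogeneous fun p v hv => by
    have h := 𝔲.sum_casimir_invariant
      (LinearMap.mk₂ ℂ (fun a c => br a (br c b)) (by intros; simp) (by intros; simp)
        (by intros; simp) (by intros; simp)) hv
    simp only [LinearMap.mk₂_apply] at h
    simp only [LinearMap.comp_apply, LinearMap.flip_apply, casimir_apply, map_sum, map_smul,
      LinearMap.sum_apply, LinearMap.smul_apply]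
    rw [← sub_eq_zero, ← neg_eq_zero, ← h, ← Finset.sum_sub_distrib, ← Finset.sum_add_distrib,
      ← Finset.sum_neg_distrib]
    refine Finset.sum_congr rfl fun i _ => ?_
    rw [br_br_of_parity hv (𝔲.u i), br_br_of_parity hv (𝔲.uDual i), map_add,
      parPow_of_parity p (𝔲.parity_u i), parPow_of_parity p (𝔲.parity_uDual i)]
    simp only [map_smul, LinearMap.smul_apply]
    rw [smul_smul (sg (p * 𝔲.par i)) (sg (p * 𝔲.par i)), sg_mul_self]
    module
  exact DFunLike.congr_fun this a

/-- Schur's lemma: an eigenspace of the Casimir operator is a nonzero graded ideal, hence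
everything. This shows that the value chosen in `hDual` really is half of the eigenvalue. -/
theorem exists_casimir_eq [FiniteDimensional ℂ g] (hg : IsSimple g) :
    ∃ h : ℂ, 𝔲.casimir = (2 * h) • LinearMap.id := by
  obtain ⟨⟨a, b, hab⟩, hI⟩ := hg
  have : Nontrivial g := ⟨⟨_, _, hab⟩⟩
  obtain ⟨c, hc⟩ := Module.End.exists_eigenvalue 𝔲.casimir
  refine ⟨c / 2, ?_⟩
  have := (hI (Module.End.eigenspace 𝔲.casimir c) (fun a ha => ?_) (fun a b hb => ?_)).resolve_left
    hc
  · ext a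
    have ha : a ∈ Module.End.eigenspace 𝔲.casimir c := this ▸ Submodule.mem_top
    rw [Module.End.mem_eigenspace_iff] at ha
    rw [ha, LinearMap.smul_apply, LinearMap.id_apply, mul_div_cancel₀ _ two_ne_zero]
  · rw [Module.End.mem_eigenspace_iff] at ha ⊢
    rw [← parity_casimir, ha, map_smul]
  · rw [Module.End.mem_eigenspace_iff] at hb ⊢
    rw [casimir_br, hb, map_smul]

theorem casimir_eq [FiniteDimensional ℂ g] (hg : IsSimple g) (a : g) :
    𝔲.casimir a = (2 * 𝔲.hDual) • a := by
  have := Classical.epsilon_spec (𝔲.exists_casimir_eq hg)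
  exact DFunLike.congr_fun this a

/-- Invariance of the Casimir element applied to the bracket itself. The sum is the double
contraction in the λ-bracket of a current with the Sugawara field, and is how h^∨ appears there. -/
theorem sum_br_br {p : ZMod 2} {v : g} (hv : parity v = sg p • v) :
    ∑ i, sg (𝔲.par i) • br (br v (𝔲.u i)) (𝔲.uDual i) = 𝔲.casimir v := by
  have h := 𝔲.sum_casimir_invariant br hv
  rw [add_eq_zero_iff_eq_neg] at h
  rw [h, casimir_apply, ← Finset.sum_neg_distrib]
  refine Finset.sum_congr rfl fun i _ => ?_
  rw [br_skew_of_parity hv (𝔲.uDual i), parPow_of_parity p (𝔲.parity_u i),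
    parPow_of_parity p (𝔲.parity_uDual i)]
  simp only [map_smul, map_neg, LinearMap.smul_apply, smul_neg, neg_neg]
  rw [smul_smul (sg (p * 𝔲.par i)) (sg (p * 𝔲.par i)), sg_mul_self, one_smul]

/-- Exchanging the two factors of the Casimir element preserves the sum, whereas skew-symmetry of
the bracket negates it. -/
theorem sum_br_u_uDual : ∑ i, sg (𝔲.par i) • br (𝔲.u i) (𝔲.uDual i) = 0 := by
  have h := 𝔲.sum_uDual_u (fun _ => 1) br
  simp only [one_smul, one_mul] at h
  have h1 : ∀ i, br (𝔲.uDual i) (𝔲.u i) = -(sg (𝔲.par i) • br (𝔲.u i) (𝔲.uDual i)) := by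
    intro i
    rw [br_skew_of_parity (𝔲.parity_uDual i), parPow_of_parity _ (𝔲.parity_u i), map_smul,
      LinearMap.smul_apply]
    generalize 𝔲.par i = q
    induction q using zmod_two_cases <;> simp [sg]
  simp only [h1, Finset.sum_neg_distrib] at h
  have h2 : (2 : ℂ) • ∑ i, sg (𝔲.par i) • br (𝔲.u i) (𝔲.uDual i) = 0 := by
    rw [two_smul]; nth_rewrite 1 [← h]; simp
  simpa using h2

/-- By invariance this is (v | ∑ ±[u_i,u^i]). Its vanishing removes the λ² term from the bracket of
a current with the Sugawara field. -/
theorem sum_form_br (v : g) :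
    ∑ i, sg (𝔲.par i) * Q.form (br v (𝔲.u i)) (𝔲.uDual i) = 0 := by
  have h := congrArg (Q.form v) 𝔲.sum_br_u_uDual
  simpa [Q.form_inv] using h

/-- Pair the eigenvalue equation for the Casimir operator on v with x and move x inside by
invariance: x then acts on the coordinate u_i^* by m_i. The left side is the supertrace of (ad x)(ad
v) over g. -/
theorem sum_m_mul_c [FiniteDimensional ℂ g] (hg : IsSimple g) (v : g) :
    ∑ i, sg (𝔲.par i) * (𝔲.m i * 𝔲.u.coord i (br v (𝔲.u i))) =
      2 * 𝔲.hDual * Q.form Q.x v := by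
  have key : (∑ i, (sg (𝔲.par i) * 𝔲.m i) • (𝔲.u.coord i ∘ₗ br.flip (𝔲.u i))) =
      (2 * 𝔲.hDual) • Q.form Q.x := ext_homogeneous fun p v hv => by
    have h := congrArg (Q.form Q.x) (𝔲.sum_br_br hv)
    rw [𝔲.casimir_eq hg, map_smul] at h
    rw [LinearMap.smul_apply, ← h, LinearMap.sum_apply, map_sum]
    refine Finset.sum_congr rfl fun i _ => ?_
    rw [map_smul, ← Q.form_inv, form_uDual, coord_br_x]
    simp [mul_assoc]
  have := DFunLike.congr_fun key v
  simpa [mul_assoc] using this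

/-- Exchanging u_i and u^i reverses degrees and shows that the negative degrees contribute as much
as the positive ones, so the sum over g_+ is half of `sum_m_mul_c`. For odd v both sides vanish by
parity. -/
theorem sum_m_mul_c_pos [FiniteDimensional ℂ g] (hg : IsSimple g) (v : g) :
    ∑ i : 𝔲.S, sg (𝔲.par i) * (𝔲.m i * 𝔲.u.coord i (br v (𝔲.u i))) =
      𝔲.hDual * Q.form v Q.x := by
  classical
  have key : (∑ i : 𝔲.S, (sg (𝔲.par i) * 𝔲.m i) • (𝔲.u.coord i ∘ₗ br.flip (𝔲.u i))) =
      𝔲.hDual • Q.form.flip Q.x := ext_homogeneous fun p v hv => by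
    have hx : Q.form v Q.x = Q.form Q.x v := by
      rw [Q.form_symm_of_parity Q.x_parity, parPow_zero]
    simp only [LinearMap.sum_apply, LinearMap.smul_apply, LinearMap.comp_apply,
      LinearMap.flip_apply, smul_eq_mul, hx]
    induction p using zmod_two_cases with
    | h1 =>
      have h0 : Q.form Q.x v = 0 := by
        have := Q.form_even Q.x v
        rw [Q.x_even, hv, sg_one, map_smul, smul_eq_mul] at this
        linear_combination (-1 / 2 : ℂ) * this
      rw [h0, mul_zero]
      refine Finset.sum_eq_zero fun i _ => ?_
      have h1 := 𝔲.coord_parity i (br v (𝔲.u i))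
      rw [parity_br_of_parity hv, 𝔲.parity_u, sg_one] at h1
      simp only [map_smul, smul_eq_mul] at h1
      have h2 := sg_mul_self (𝔲.par i)
      linear_combination (-1 / 2 * 𝔲.m i) * h1
    | h0 =>
      have h := 𝔲.sum_m_mul_c hg v
      set t : ι → ℂ := fun i => 𝔲.u.coord i (br v (𝔲.u i)) with ht
      -- The weight is the degree cut off to its negative part; exchanging the factors turns it into
      -- minus the cut-off to the positive part.
      have hneg := 𝔲.sum_uDual_u (fun n => if n < 0 then (n : ℂ) / 2 else 0)
        (Q.form ∘ₗ br v)
      have e1 : ∀ i, Q.form (br v (𝔲.uDual i)) (𝔲.u i) = -(sg (𝔲.par i) * t i) := by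
        intro i
        rw [Q.form_br_of_parity hv, parPow_zero, Q.form_symm_of_parity (𝔲.parity_uDual i),
          parPow_br, parPow_of_parity _ (𝔲.parity_u i), parPow_of_parity _ hv, form_uDual, mul_zero,
          sg_zero, one_smul, map_smul, map_smul, smul_eq_mul]
        generalize 𝔲.par i = q
        induction q using zmod_two_cases <;> simp [sg, ht]
      simp only [LinearMap.comp_apply, e1, form_uDual, smul_eq_mul] at hneg
      rw [← Finset.sum_subtype (Finset.univ.filter fun i => 0 < 𝔲.deg i) (by simp)
          (fun i => sg (𝔲.par i) * 𝔲.m i * t i), Finset.sum_filter]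
      have e2 : ∑ i, sg (𝔲.par i) * (𝔲.m i * t i) =
          ∑ i, (if 0 < 𝔲.deg i then sg (𝔲.par i) * 𝔲.m i * t i else 0) +
          ∑ i, (if 𝔲.deg i < 0 then (𝔲.deg i : ℂ) / 2 else 0) * (sg (𝔲.par i) * t i) := by
        rw [← Finset.sum_add_distrib]
        refine Finset.sum_congr rfl fun i _ => ?_
        rw [m]
        rcases lt_trichotomy (𝔲.deg i) 0 with hi | hi | hi
        · rw [if_neg (by omega), if_pos hi]; ring
        · rw [hi]; simp
        · rw [if_pos hi, if_neg (by omega)]; ring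
      have e3 : ∑ i, (if 𝔲.deg i < 0 then (𝔲.deg i : ℂ) / 2 else 0) * (sg (𝔲.par i) * t i) =
          ∑ i, (if 0 < 𝔲.deg i then sg (𝔲.par i) * 𝔲.m i * t i else 0) := by
        rw [← neg_inj, ← Finset.sum_neg_distrib, ← Finset.sum_neg_distrib]
        simp only [mul_neg] at hneg
        rw [hneg]
        refine Finset.sum_congr rfl fun i _ => ?_
        simp only [Left.neg_neg_iff, m]
        split_ifs <;> push_cast <;> ring
      rw [e2, e3] at h
      linear_combination (1 / 2 : ℂ) * h
  have := DFunLike.congr_fun key v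
  simpa [mul_assoc] using this

end AdaptedBasis
end ReductionData

/-! ### Supertraces, and the algebra of compressions of ad v. -/

theorem trace_eq_sum_coord {W J : Type*} [AddCommGroup W] [Module ℂ W] [Fintype J]
    (b : Module.Basis J ℂ W) (T : Module.End ℂ W) :
    LinearMap.trace ℂ W T = ∑ j, b.coord j (T (b j)) := by
  classical
  rw [LinearMap.trace_eq_matrix_trace ℂ b, Matrix.trace]
  simp [LinearMap.toMatrix_apply]

namespace ReductionData

variable {g : Type*} [AddCommGroup g] [Module ℂ g] [LieSuperalgebra g] (Q : ReductionData g)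

/-- Stability of g_+ selects the meaningful branch of `strOn`, so its default value 0 plays no part.
-/
theorem strOn_gPlus_eq {T : g →ₗ[ℂ] g} (hT : ∀ a ∈ Q.gPlus, T a ∈ Q.gPlus)
    (K : Module.End ℂ Q.gPlus) (hK : ∀ a, (K a : g) = T a) :
    strOn Q.gPlus T = LinearMap.trace ℂ Q.gPlus (Q.parityPlus ∘ₗ K) := by
  have h : ∀ w ∈ Q.gPlus, ((parity : g →ₗ[ℂ] g) ∘ₗ T) w ∈ Q.gPlus := fun w hw =>
    Q.parity_mem_gPlus (hT w hw)
  rw [strOn, dif_pos h]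
  congr 1
  ext a
  simp [hK]

theorem strOn_gHalf_eq {T : g →ₗ[ℂ] g} (hT : ∀ a ∈ Q.gHalf, T a ∈ Q.gHalf)
    (K : Module.End ℂ Q.gHalf) (hK : ∀ a, (K a : g) = T a) :
    strOn Q.gHalf T = LinearMap.trace ℂ Q.gHalf (Q.parityHalf ∘ₗ K) := by
  have h : ∀ w ∈ Q.gHalf, ((parity : g →ₗ[ℂ] g) ∘ₗ T) w ∈ Q.gHalf := fun w hw =>
    Q.parity_mem_gr 1 (hT w hw)
  rw [strOn, dif_pos h]
  congr 1
  ext a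
  simp [hK]

namespace AdaptedBasis

variable {Q} {ι : Type*} [Fintype ι] (𝔲 : Q.AdaptedBasis ι)

theorem sum_bPlus_adjoint {M : Type*} [AddCommGroup M] [Module ℂ M]
    (B : Q.gPlus →ₗ[ℂ] Module.Dual ℂ Q.gPlus →ₗ[ℂ] M) (A : Module.End ℂ Q.gPlus) :
    ∑ j, B (A (𝔲.bPlus j)) (𝔲.bPlus.coord j) =
      ∑ j, B (𝔲.bPlus j) (𝔲.bPlus.coord j ∘ₗ A) := by
  have := sum_canonical_adjoint 𝔲.bPlus 𝔲.bPlus.coord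
    (LinearMap.applyₗ : Q.gPlus →ₗ[ℂ] Module.Dual ℂ Q.gPlus →ₗ[ℂ] ℂ)
    (fun a => by simp)
    (fun w => by
      refine 𝔲.bPlus.ext fun i => ?_
      simp) B A (LinearMap.dualMap A) (fun a w => rfl)
  exact this

theorem formHalf_halfDual (a : Q.gHalf) (j : 𝔲.S') :
    Q.formHalf a (𝔲.halfDual j) = 𝔲.bHalf.coord j a := by
  classical
  have : Q.formHalfB.flip (𝔲.halfDual j) = 𝔲.bHalf.coord j := 𝔲.bHalf.ext fun i => by
    have h := 𝔲.formHalf_u i j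
    have hi : (⟨𝔲.u i, Q.mem_gHalf i.2 (𝔲.u_mem i)⟩ : Q.gHalf) = 𝔲.bHalf i :=
      Subtype.ext (𝔲.bHalf_apply i).symm
    rw [hi] at h
    rw [LinearMap.flip_apply, formHalfB_apply, h, Module.Basis.coord_apply,
      Module.Basis.repr_self, Finsupp.single_apply]
  exact DFunLike.congr_fun this a

theorem sum_formHalf_halfDual (a : Q.gHalf) :
    ∑ j, Q.formHalf a (𝔲.halfDual j) • 𝔲.bHalf j = a := by
  simp only [formHalf_halfDual, Module.Basis.coord_apply, 𝔲.bHalf.sum_repr]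

theorem sum_formHalf_bHalf (w : Q.gHalf) :
    ∑ j, Q.formHalf (𝔲.bHalf j) w • 𝔲.halfDual j = w := by
  classical
  rw [← sub_eq_zero]
  refine Q.formHalf_nondeg_right fun a => ?_
  have : Q.formHalfB.flip (∑ j, Q.formHalf (𝔲.bHalf j) w • 𝔲.halfDual j - w) = 0 :=
    𝔲.bHalf.ext fun i => by
      rw [LinearMap.flip_apply, map_sub, map_sum]
      simp only [map_smul, formHalfB_apply, formHalf_halfDual, smul_eq_mul,
        Module.Basis.coord_apply, Module.Basis.repr_self, Finsupp.single_apply]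
      simp
  exact DFunLike.congr_fun this a

theorem sum_bHalf_adjoint {M : Type*} [AddCommGroup M] [Module ℂ M]
    (B : Q.gHalf →ₗ[ℂ] Q.gHalf →ₗ[ℂ] M) (A A' : Module.End ℂ Q.gHalf)
    (hA : ∀ a w, Q.formHalf (A a) w = Q.formHalf a (A' w)) :
    ∑ j, B (A (𝔲.bHalf j)) (𝔲.halfDual j) = ∑ j, B (𝔲.bHalf j) (A' (𝔲.halfDual j)) :=
  sum_canonical_adjoint _ _ Q.formHalfB 𝔲.sum_formHalf_halfDual 𝔲.sum_formHalf_bHalf B A A' hA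

-- Since f is even, ⟨w,b⟩ vanishes unless w and b have equal parity. The sign (-1)^{p(w)p(b)} then
-- depends on w alone and becomes the parity operator on w.
include 𝔲 in
theorem formHalf_skew (w b : Q.gHalf) :
    Q.formHalf w b = -Q.formHalf b (Q.parityHalf w) := by
  have : Q.formHalfB.flip b = -(Q.formHalfB b ∘ₗ Q.parityHalf) := 𝔲.bHalf.ext fun j => by
    have hj : parity (𝔲.bHalf j : g) = sg (𝔲.par j) • (𝔲.bHalf j : g) := by
      simpa using 𝔲.parity_u j
    simp only [LinearMap.flip_apply, LinearMap.neg_apply, LinearMap.comp_apply, formHalfB_apply,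
      formHalf, coe_parityHalf]
    rw [br_skew_of_parity hj, map_neg]
    congr 1
    have h := Q.form_parPow (𝔲.par j) Q.f (br (b : g) (parity (𝔲.bHalf j : g)))
    rw [← h, parPow_br, parPow_of_parity _ Q.f_parity, hj, map_smul (parPow (𝔲.par j)),
      parPow_of_parity _ hj, mul_zero, sg_zero, one_smul, smul_smul]
    have : sg (𝔲.par j) * sg (𝔲.par j * 𝔲.par j) = 1 := by
      generalize 𝔲.par j = q
      induction q using zmod_two_cases <;> simp [sg]
    rw [this, one_smul]
  exact DFunLike.congr_fun this w

theorem parityPlus_adPlus {p : ZMod 2} {v : g} (hv : parity v = sg p • v) (a : Q.gPlus) :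
    Q.parityPlus (𝔲.adPlus v a) = sg p • 𝔲.adPlus v (Q.parityPlus a) := by
  rw [adPlus_apply, ← projPlus_parity, parity_br_of_parity hv, map_smul]
  rfl

theorem parityHalf_adHalf {p : ZMod 2} {v : g} (hv : parity v = sg p • v) (a : Q.gHalf) :
    Q.parityHalf (𝔲.adHalf v a) = sg p • 𝔲.adHalf v (Q.parityHalf a) := by
  rw [adHalf_apply, ← projHalf_parity, parity_br_of_parity hv, map_smul]
  rfl

theorem coe_adHalf {v : g} (hv : v ∈ gr Q.x 0) (a : Q.gHalf) :
    (𝔲.adHalf v a : g) = br v (a : g) :=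
  𝔲.coe_projHalf (Q.br_mem_gHalf hv a.2)

theorem coe_adPlus {n : ℤ} (hn : 0 ≤ n) {v : g} (hv : v ∈ gr Q.x n) (a : Q.gPlus) :
    (𝔲.adPlus v a : g) = br v (a : g) :=
  𝔲.coe_projPlus (Q.br_mem_gPlus hn hv a.2)

/-- The discarded components have degree at most 0, and an operator of nonpositive degree keeps them
there. -/
theorem projPlus_br_projPlus {n : ℤ} (hn : n ≤ 0) {v : g} (hv : v ∈ gr Q.x n) (a : g) :
    𝔲.projPlus (br v (𝔲.projPlus a : g)) = 𝔲.projPlus (br v a) := by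
  have : 𝔲.projPlus ∘ₗ br v ∘ₗ Q.gPlus.subtype ∘ₗ 𝔲.projPlus = 𝔲.projPlus ∘ₗ br v :=
    𝔲.u.ext fun i => by
      simp only [LinearMap.comp_apply, Submodule.subtype_apply]
      by_cases hi : 0 < 𝔲.deg i
      · rw [𝔲.coe_projPlus]
        exact Submodule.mem_iSup_of_mem (⟨𝔲.deg i, hi⟩ : {n : ℤ // 0 < n}) (𝔲.u_mem i)
      · rw [𝔲.projPlus_eq_zero (by omega) (𝔲.u_mem i),
          𝔲.projPlus_eq_zero (by omega) (Q.br_mem_gr hv (𝔲.u_mem i))]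
        simp
  exact DFunLike.congr_fun this a

/-- If m ≤ 0, the inner projection loses nothing by `projPlus_br_projPlus`. If m > 0, then n ≥ 0, so
ad v' preserves g_+ and the inner projection is the identity. This is the source of the condition ij
≥ 0 in (c). -/
theorem adPlus_comp {m n : ℤ} (hmn : 0 ≤ m * n) {v v' : g} (hv : v ∈ gr Q.x m)
    (hv' : v' ∈ gr Q.x n) (a : Q.gPlus) :
    𝔲.adPlus v (𝔲.adPlus v' a) = 𝔲.projPlus (br v (br v' (a : g))) := by
  rw [adPlus_apply, adPlus_apply]
  rcases le_or_gt m 0 with hm | hm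
  · exact 𝔲.projPlus_br_projPlus hm hv _
  · rw [𝔲.coe_projPlus (Q.br_mem_gPlus (by nlinarith) hv' a.2)]

theorem parPow_mem_gr (p : ZMod 2) {n : ℤ} {a : g} (ha : a ∈ gr Q.x n) :
    parPow p a ∈ gr Q.x n := by
  induction p using zmod_two_cases with
  | h0 => simpa using ha
  | h1 => simpa using Q.parity_mem_gr n ha

theorem adPlus_br {m n : ℤ} (hmn : 0 ≤ m * n) {p : ZMod 2} {v v' : g}
    (hp : parity v = sg p • v) (hv : v ∈ gr Q.x m) (hv' : v' ∈ gr Q.x n) (a : Q.gPlus) :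
    𝔲.adPlus (br v v') a =
      𝔲.adPlus v (𝔲.adPlus v' a) - 𝔲.adPlus (parPow p v') (𝔲.adPlus v a) := by
  rw [𝔲.adPlus_comp hmn hv hv', 𝔲.adPlus_comp (by linarith) (parPow_mem_gr p hv') hv,
    adPlus_apply, br_br_of_parity hp, map_add, add_sub_cancel_right]

theorem adHalf_br {p : ZMod 2} {v v' : g}
    (hp : parity v = sg p • v) (hv : v ∈ gr Q.x 0) (hv' : v' ∈ gr Q.x 0) (a : Q.gHalf) :
    𝔲.adHalf (br v v') a =
      𝔲.adHalf v (𝔲.adHalf v' a) - 𝔲.adHalf (parPow p v') (𝔲.adHalf v a) := by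
  refine Subtype.ext ?_
  have h : br v v' ∈ gr Q.x 0 := by simpa using Q.br_mem_gr hv hv'
  rw [Submodule.coe_sub, 𝔲.coe_adHalf h, 𝔲.coe_adHalf hv, 𝔲.coe_adHalf hv',
    𝔲.coe_adHalf (parPow_mem_gr p hv'), 𝔲.coe_adHalf hv, br_br_of_parity hp, add_sub_cancel_right]

theorem adPlus_x_bPlus (j : 𝔲.S) : 𝔲.adPlus Q.x (𝔲.bPlus j) = 𝔲.m j • 𝔲.bPlus j := by
  rw [adPlus_apply, bPlus_apply, mem_gr_iff.1 (𝔲.u_mem j), map_smul, ← bPlus_apply, projPlus_coe]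
  rfl

theorem bPlus_coord_adPlus_x (j : 𝔲.S) :
    𝔲.bPlus.coord j ∘ₗ 𝔲.adPlus Q.x = 𝔲.m j • 𝔲.bPlus.coord j := by
  classical
  refine 𝔲.bPlus.ext fun i => ?_
  rw [LinearMap.comp_apply, adPlus_x_bPlus]
  simp only [map_smul, Module.Basis.coord_apply, Module.Basis.repr_self, LinearMap.smul_apply,
    Finsupp.single_apply]
  split_ifs with h
  · rw [h]
  · simp

theorem adPlus_x_adPlus {n : ℤ} {v : g} (hv : v ∈ gr Q.x n) (a : Q.gPlus) :
    𝔲.adPlus Q.x (𝔲.adPlus v a) = 𝔲.adPlus v (𝔲.adPlus Q.x a) +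
      ((n : ℂ) / 2) • 𝔲.adPlus v a := by
  have h := 𝔲.adPlus_br (by simp) Q.x_parity Q.x_mem hv a
  rw [mem_gr_iff.1 hv, parPow_zero, map_smul] at h
  rw [← sub_eq_iff_eq_add', ← h, LinearMap.smul_apply]

theorem coord_adPlus (v : g) (i j : 𝔲.S) :
    𝔲.bPlus.coord i (𝔲.adPlus v (𝔲.bPlus j)) = 𝔲.c v i j := by
  rw [bPlus_coord, adPlus_apply, LinearMap.comp_apply, Submodule.subtype_apply, projPlus_apply,
    Submodule.coe_sum]
  simp only [Submodule.coe_smul, bPlus_apply]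
  classical
  rw [map_sum, Finset.sum_eq_single i]
  · simp [c]
  · intro l _ hl
    simp [Subtype.val_injective.ne hl]
  · simp

theorem adPlus_bPlus (v : g) (j : 𝔲.S) :
    𝔲.adPlus v (𝔲.bPlus j) = ∑ i : 𝔲.S, 𝔲.c v i j • 𝔲.bPlus i := by
  rw [adPlus_apply, projPlus_apply, bPlus_apply]
  rfl

theorem adHalf_bHalf (v : g) (j : 𝔲.S') :
    𝔲.adHalf v (𝔲.bHalf j) = ∑ i : 𝔲.S', 𝔲.c v i j • 𝔲.bHalf i := by
  rw [adHalf_apply, projHalf_apply, bHalf_apply]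
  rfl

theorem c_eq_zero {n : ℤ} {v : g} (hv : v ∈ gr Q.x n) {i j : ι} (h : 𝔲.deg i ≠ n + 𝔲.deg j) :
    𝔲.c v i j = 0 :=
  𝔲.coord_eq_zero (Q.br_mem_gr hv (𝔲.u_mem j)) h

theorem bPlus_coord_parityPlus (j : 𝔲.S) (a : Q.gPlus) :
    𝔲.bPlus.coord j (Q.parityPlus a) = sg (𝔲.par j) * 𝔲.bPlus.coord j a := by
  rw [bPlus_coord]
  exact 𝔲.coord_parity j a

/-- An operator that shifts the degree has zero diagonal in a homogeneous basis. -/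
theorem trace_adPlus_eq_zero {n : ℤ} (hn : n ≠ 0) {v : g} (hv : v ∈ gr Q.x n) :
    LinearMap.trace ℂ Q.gPlus (Q.parityPlus ∘ₗ 𝔲.adPlus v) = 0 := by
  rw [trace_eq_sum_coord 𝔲.bPlus]
  refine Finset.sum_eq_zero fun j _ => ?_
  rw [LinearMap.comp_apply, bPlus_coord_parityPlus, coord_adPlus, 𝔲.c_eq_zero hv (by omega),
    mul_zero]

theorem trace_adPlus_adPlus_eq_zero {m n : ℤ} (hmn : m + n ≠ 0) {v v' : g} (hv : v ∈ gr Q.x m)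
    (hv' : v' ∈ gr Q.x n) :
    LinearMap.trace ℂ Q.gPlus (Q.parityPlus ∘ₗ 𝔲.adPlus v ∘ₗ 𝔲.adPlus v') = 0 := by
  rw [trace_eq_sum_coord 𝔲.bPlus]
  refine Finset.sum_eq_zero fun j _ => ?_
  rw [LinearMap.comp_apply, LinearMap.comp_apply, bPlus_coord_parityPlus, adPlus_bPlus, map_sum,
    map_sum, Finset.sum_eq_zero, mul_zero]
  intro i _
  rw [map_smul, map_smul, coord_adPlus, smul_eq_mul]
  by_cases h : 𝔲.deg i = n + 𝔲.deg j
  · rw [𝔲.c_eq_zero hv (by omega), mul_zero]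
  · rw [𝔲.c_eq_zero hv' h, zero_mul]

theorem strOn_br {v : g} (hv : v ∈ gr Q.x 0) :
    strOn Q.gPlus (br v) = LinearMap.trace ℂ Q.gPlus (Q.parityPlus ∘ₗ 𝔲.adPlus v) :=
  Q.strOn_gPlus_eq (fun _ ha => Q.br_mem_gPlus le_rfl hv ha) _ (𝔲.coe_adPlus le_rfl hv)

theorem strOn_br_br {v v' : g} (hv : v ∈ gr Q.x 0) (hv' : v' ∈ gr Q.x 0) :
    strOn Q.gPlus (br v ∘ₗ br v') =
      LinearMap.trace ℂ Q.gPlus (Q.parityPlus ∘ₗ 𝔲.adPlus v ∘ₗ 𝔲.adPlus v') :=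
  Q.strOn_gPlus_eq (T := br v ∘ₗ br v')
    (fun _ ha => Q.br_mem_gPlus le_rfl hv (Q.br_mem_gPlus le_rfl hv' ha)) _
    fun a => by
      rw [LinearMap.comp_apply, 𝔲.coe_adPlus le_rfl hv, 𝔲.coe_adPlus le_rfl hv']; rfl

theorem strOn_gHalf_br_br {v v' : g} (hv : v ∈ gr Q.x 0) (hv' : v' ∈ gr Q.x 0) :
    strOn Q.gHalf (br v ∘ₗ br v') =
      LinearMap.trace ℂ Q.gHalf (Q.parityHalf ∘ₗ 𝔲.adHalf v ∘ₗ 𝔲.adHalf v') :=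
  Q.strOn_gHalf_eq (T := br v ∘ₗ br v')
    (fun _ ha => Q.br_mem_gHalf hv (Q.br_mem_gHalf hv' ha)) _ fun a => by
    rw [LinearMap.comp_apply, 𝔲.coe_adHalf hv, 𝔲.coe_adHalf hv']; rfl

/-- On the basis of g_+ the operator ad x is diagonal with entries m_i, so the trace is the sum in
`sum_m_mul_c_pos`. This is where h^∨ enters through the ghosts. -/
theorem trace_x_adPlus [FiniteDimensional ℂ g] (hg : IsSimple g) (v : g) :
    LinearMap.trace ℂ Q.gPlus (Q.parityPlus ∘ₗ 𝔲.adPlus Q.x ∘ₗ 𝔲.adPlus v) =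
      𝔲.hDual * Q.form v Q.x := by
  rw [trace_eq_sum_coord 𝔲.bPlus, ← 𝔲.sum_m_mul_c_pos hg]
  refine Finset.sum_congr rfl fun j _ => ?_
  rw [LinearMap.comp_apply, bPlus_coord_parityPlus, ← LinearMap.comp_apply, ← LinearMap.comp_apply,
    ← LinearMap.comp_assoc, bPlus_coord_adPlus_x, LinearMap.comp_apply, LinearMap.smul_apply,
    coord_adPlus]
  rfl

/-- Invariance of the form on `g_{1/2}` under the centralizer of `f` in `g_0`. -/
theorem formHalf_adHalf {p : ZMod 2} {v : g} (hv : parity v = sg p • v)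
    (hf : v ∈ Q.centralizer₀) (a b a' : Q.gHalf) (ha : (a' : g) = parPow p (a : g)) :
    Q.formHalf (𝔲.adHalf v a) b = -Q.formHalf a' (𝔲.adHalf v b) := by
  have h := Q.form_f_br_eq_zero hv hf (br (a : g) (b : g))
  rw [br_br_of_parity hv, map_add] at h
  rw [formHalf, formHalf, 𝔲.coe_adHalf hf.1, 𝔲.coe_adHalf hf.1, ha]
  exact eq_neg_of_add_eq_zero_left h

end AdaptedBasis
end ReductionData

attribute [local irreducible] sg

/-! ### Conjugation of fields by the parity operator. -/

section Conj

variable {V : Type*} [AddCommGroup V] [Module ℂ V] {Γ : Module.End ℂ V}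

theorem conj_add (p : ZMod 2) (X Y : Module.End ℂ V) :
    conj Γ p (X + Y) = conj Γ p X + conj Γ p Y := by
  induction p using zmod_two_cases <;> simp [mul_add, add_mul]

theorem conj_smul (p : ZMod 2) (c : ℂ) (X : Module.End ℂ V) :
    conj Γ p (c • X) = c • conj Γ p X := by
  induction p using zmod_two_cases <;> simp

theorem conj_swapMul (hΓ : Γ * Γ = 1) (X Y : Module.End ℂ V) :
    Γ * swapMul Γ X Y * Γ = swapMul Γ (Γ * X * Γ) (Γ * Y * Γ) := by
  simp only [swapMul, mul_smul_comm, smul_mul_assoc, mul_add, add_mul, mul_sub, sub_mul,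
    conj_mul hΓ Y, conj_mul hΓ (Γ * Y * Γ)]

theorem isConj_zero (p : ZMod 2) : IsConj Γ p 0 0 := fun n => by
  induction p using zmod_two_cases <;> simp

theorem IsConj.add {p : ZMod 2} {a a' b b' : VertexOperator ℂ V} (ha : IsConj Γ p a a')
    (hb : IsConj Γ p b b') : IsConj Γ p (a + b) (a' + b') := fun n => by
  rw [map_add, map_add, Pi.add_apply, Pi.add_apply, ha n, hb n, conj_add]

theorem IsConj.smul {p : ZMod 2} {a a' : VertexOperator ℂ V} (ha : IsConj Γ p a a') (c : ℂ) :
    IsConj Γ p (c • a) (c • a') := fun n => by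
  rw [map_smul, map_smul, Pi.smul_apply, Pi.smul_apply, ha n, conj_smul]

theorem IsConj.sum {J : Type*} {p : ZMod 2} {a a' : J → VertexOperator ℂ V} (s : Finset J)
    (h : ∀ j ∈ s, IsConj Γ p (a j) (a' j)) : IsConj Γ p (∑ j ∈ s, a j) (∑ j ∈ s, a' j) := by
  classical
  induction s using Finset.induction_on with
  | empty => simpa using isConj_zero p
  | insert i s hi ih =>
    simp only [Finset.sum_insert hi]
    exact (h i (Finset.mem_insert_self i s)).add
      (ih fun j hj => h j (Finset.mem_insert_of_mem hj))

theorem IsConj.deriv {p : ZMod 2} {a a' : VertexOperator ℂ V} (ha : IsConj Γ p a a') :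
    IsConj Γ p (deriv a) (deriv a') := fun n => by
  rw [ncoeff_deriv, ncoeff_deriv, ha, conj_smul]

theorem IsConj.nop (hΓ : Γ * Γ = 1) {p : ZMod 2} {a a' b b' : VertexOperator ℂ V}
    (ha : IsConj Γ p a a') (hb : IsConj Γ p b b') : IsConj Γ p (nop Γ a b) (nop Γ a' b') := by
  intro n
  rw [ncoeff_nop, ncoeff_nop]
  induction p using zmod_two_cases with
  | h0 =>
    have h1 : a' = a := field_ext fun n => by simpa using ha n
    have h2 : b' = b := field_ext fun n => by simpa using hb n
    rw [h1, h2, conj_zero_left]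
  | h1 =>
    rw [conj_one_left]
    ext v
    obtain ⟨M, h1, h2⟩ := ((nopMode_apply_eventually Γ a b n (Γ v)).and
      (nopMode_apply_eventually Γ a' b' n v)).exists
    rw [Module.End.mul_apply, Module.End.mul_apply, h1, h2, map_sum]
    refine Finset.sum_congr rfl fun j _ => ?_
    rw [← Module.End.mul_apply, ← Module.End.mul_apply]
    congr 1
    have ha' : ∀ n, a'[[n]] = Γ * a[[n]] * Γ := fun n => by simpa using ha n
    have hb' : ∀ n, b'[[n]] = Γ * b[[n]] * Γ := fun n => by simpa using hb n
    rw [nopTerm, nopTerm, mul_add, add_mul, conj_mul hΓ, conj_swapMul hΓ]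
    simp only [ha', hb']

theorem IsConj.congr {p : ZMod 2} {a a' a'' : VertexOperator ℂ V} (h : IsConj Γ p a a')
    (h' : a' = a'') : IsConj Γ p a a'' := h' ▸ h

theorem fieldPar_iff {p : ZMod 2} {a : VertexOperator ℂ V} :
    FieldPar Γ p a ↔ IsConj Γ 1 a (sg p • a) := by
  refine forall_congr' fun n => ?_
  rw [conj_one_left, map_smul, Pi.smul_apply, IsPar]
  exact eq_comm

/-- Skew-symmetry requires a homogeneous field in the exchanged slot. Brackets with generators are
therefore computed on homogeneous basis vectors and extended linearly. -/
theorem OPE.ext_basis {E J : Type*} [AddCommGroup E] [Module ℂ E] [Fintype J]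
    (b : Module.Basis J ℂ E) {a : VertexOperator ℂ V} (F C₀ C₁ C₂ : E →ₗ[ℂ] VertexOperator ℂ V)
    (h : ∀ j, OPE Γ a (F (b j)) (C₀ (b j)) (C₁ (b j)) (C₂ (b j))) (e : E) :
    OPE Γ a (F e) (C₀ e) (C₁ e) (C₂ e) := by
  rw [← b.sum_repr e]
  simp only [map_sum, map_smul]
  exact OPE.sum_right _ fun j _ => (h j).smul_right _

end Conj

/-! ### Abstract systems of currents and ghosts. -/

namespace ReductionData

variable {g : Type*} [AddCommGroup g] [Module ℂ g] [LieSuperalgebra g] (Q : ReductionData g)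

/-- `Γ ^ p` on `g_+`. -/
def parPowPlus (p : ZMod 2) : Module.End ℂ Q.gPlus := if p = 0 then LinearMap.id else Q.parityPlus

/-- `Γ ^ p` on `g_{1/2}`. -/
def parPowHalf (p : ZMod 2) : Module.End ℂ Q.gHalf := if p = 0 then LinearMap.id else Q.parityHalf

@[simp] theorem parPowPlus_zero (a : Q.gPlus) : Q.parPowPlus 0 a = a := by simp [parPowPlus]

@[simp] theorem parPowPlus_one (a : Q.gPlus) : Q.parPowPlus 1 a = Q.parityPlus a := by
  simp [parPowPlus]

@[simp] theorem parPowHalf_zero (a : Q.gHalf) : Q.parPowHalf 0 a = a := by simp [parPowHalf]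

@[simp] theorem parPowHalf_one (a : Q.gHalf) : Q.parPowHalf 1 a = Q.parityHalf a := by
  simp [parPowHalf]

@[simp] theorem parPowPlus_parPowPlus (p : ZMod 2) (a : Q.gPlus) :
    Q.parPowPlus p (Q.parPowPlus p a) = a := by
  induction p using zmod_two_cases <;> simp

@[simp] theorem parPowHalf_parPowHalf (p : ZMod 2) (a : Q.gHalf) :
    Q.parPowHalf p (Q.parPowHalf p a) = a := by
  induction p using zmod_two_cases <;> simp

theorem coe_parPowPlus (p : ZMod 2) (a : Q.gPlus) : (Q.parPowPlus p a : g) = parPow p (a : g) := by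
  induction p using zmod_two_cases <;> simp

theorem coe_parPowHalf (p : ZMod 2) (a : Q.gHalf) : (Q.parPowHalf p a : g) = parPow p (a : g) := by
  induction p using zmod_two_cases <;> simp

theorem formHalf_parPowHalf (p : ZMod 2) (a b : Q.gHalf) :
    Q.formHalf (Q.parPowHalf p a) b = Q.formHalf a (Q.parPowHalf p b) := by
  induction p using zmod_two_cases with
  | h0 => simp
  | h1 => rw [parPowHalf_one, parPowHalf_one, ← formHalf_parityHalf, parityHalf_parityHalf]

theorem parPowPlus_of_parity (p : ZMod 2) {q : ZMod 2} {a : Q.gPlus}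
    (ha : Q.parityPlus a = sg q • a) : Q.parPowPlus p a = sg (p * q) • a := by
  induction p using zmod_two_cases with
  | h0 => simp [sg_zero]
  | h1 => rw [parPowPlus_one, ha, one_mul]

theorem parPowHalf_of_parity (p : ZMod 2) {q : ZMod 2} {a : Q.gHalf}
    (ha : Q.parityHalf a = sg q • a) : Q.parPowHalf p a = sg (p * q) • a := by
  induction p using zmod_two_cases with
  | h0 => simp [sg_zero]
  | h1 => rw [parPowHalf_one, ha, one_mul]


/-- A representation of the currents and ghosts of a quantum reduction by fields on a superspace,
with the prescribed `λ`-brackets. -/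
structure FieldSystem (V : Type*) [AddCommGroup V] [Module ℂ V] where
  Γ : Module.End ℂ V
  Γ_Γ : Γ * Γ = 1
  cur : g →ₗ[ℂ] VertexOperator ℂ V
  gh : Q.gPlus →ₗ[ℂ] VertexOperator ℂ V
  ghDual : Module.Dual ℂ Q.gPlus →ₗ[ℂ] VertexOperator ℂ V
  ghNe : Q.gHalf →ₗ[ℂ] VertexOperator ℂ V
  isConj_cur : ∀ p a, IsConj Γ p (cur a) (cur (parPow p a))
  isConj_gh : ∀ p a, IsConj Γ p (gh a) (sg p • gh (Q.parPowPlus p a))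
  isConj_ghDual : ∀ p ψ, IsConj Γ p (ghDual ψ) (sg p • ghDual (ψ ∘ₗ Q.parPowPlus p))
  isConj_ghNe : ∀ p a, IsConj Γ p (ghNe a) (ghNe (Q.parPowHalf p a))
  cur_cur : ∀ a b, OPE Γ (cur a) (cur b) (cur (br a b)) ((Q.k * Q.form a b) • oneField) 0
  gh_ghDual : ∀ a ψ, OPE Γ (gh a) (ghDual ψ) (ψ a • oneField) 0 0
  ghDual_gh : ∀ ψ a, OPE Γ (ghDual ψ) (gh a) (ψ (Q.parityPlus a) • oneField) 0 0
  ghNe_ghNe : ∀ a b, OPE Γ (ghNe a) (ghNe b) (Q.formHalf a b • oneField) 0 0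
  cur_gh : ∀ a b, OPE Γ (cur a) (gh b) 0 0 0
  cur_ghDual : ∀ a ψ, OPE Γ (cur a) (ghDual ψ) 0 0 0
  cur_ghNe : ∀ a c, OPE Γ (cur a) (ghNe c) 0 0 0
  gh_cur : ∀ b a, OPE Γ (gh b) (cur a) 0 0 0
  gh_gh : ∀ b b', OPE Γ (gh b) (gh b') 0 0 0
  gh_ghNe : ∀ b c, OPE Γ (gh b) (ghNe c) 0 0 0
  ghDual_cur : ∀ ψ a, OPE Γ (ghDual ψ) (cur a) 0 0 0
  ghDual_ghDual : ∀ ψ ψ', OPE Γ (ghDual ψ) (ghDual ψ') 0 0 0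
  ghDual_ghNe : ∀ ψ c, OPE Γ (ghDual ψ) (ghNe c) 0 0 0
  ghNe_cur : ∀ c a, OPE Γ (ghNe c) (cur a) 0 0 0
  ghNe_gh : ∀ c b, OPE Γ (ghNe c) (gh b) 0 0 0
  ghNe_ghDual : ∀ c ψ, OPE Γ (ghNe c) (ghDual ψ) 0 0 0

namespace FieldSystem

variable {Q} {V : Type*} [AddCommGroup V] [Module ℂ V] (R : Q.FieldSystem V)

theorem fieldPar_cur {p : ZMod 2} {a : g} (ha : parity a = sg p • a) :
    FieldPar R.Γ p (R.cur a) :=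
  fieldPar_iff.2 ((R.isConj_cur 1 a).congr (by rw [parPow_one, ha, map_smul]))

/-- Parity reversal: the hypothesis on signs says q = p + 1. -/
theorem fieldPar_gh {p q : ZMod 2} (hq : sg q = -sg p) {a : Q.gPlus}
    (ha : Q.parityPlus a = sg p • a) : FieldPar R.Γ q (R.gh a) := by
  have h : sg 1 • R.gh (Q.parPowPlus 1 a) = sg q • R.gh a := by
    rw [parPowPlus_one, ha, map_smul, hq, sg_one, smul_smul, neg_one_mul]
  exact fieldPar_iff.2 (h ▸ R.isConj_gh 1 a)

theorem fieldPar_ghDual {p q : ZMod 2} (hq : sg q = -sg p) {ψ : Module.Dual ℂ Q.gPlus}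
    (hψ : ψ ∘ₗ Q.parityPlus = sg p • ψ) : FieldPar R.Γ q (R.ghDual ψ) := by
  have h : sg 1 • R.ghDual (ψ ∘ₗ Q.parPowPlus 1) = sg q • R.ghDual ψ := by
    rw [show Q.parPowPlus 1 = Q.parityPlus from if_neg one_ne_zero, hψ, map_smul, hq, sg_one,
      smul_smul, neg_one_mul]
  exact fieldPar_iff.2 (h ▸ R.isConj_ghDual 1 ψ)

theorem fieldPar_ghNe {p : ZMod 2} {a : Q.gHalf} (ha : Q.parityHalf a = sg p • a) :
    FieldPar R.Γ p (R.ghNe a) :=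
  fieldPar_iff.2 ((R.isConj_ghNe 1 a).congr (by rw [parPowHalf_one, ha, map_smul]))

end FieldSystem

end ReductionData

section Generic

variable {V : Type*} [AddCommGroup V] [Module ℂ V] {Γ : Module.End ℂ V}

theorem OPE.one_left (b : VertexOperator ℂ V) (hΓ : Γ * Γ = 1) : OPE Γ oneField b 0 0 0 := by
  intro m n
  rw [ncoeff_oneField]
  split_ifs
  · have : swapMul Γ 1 (b[[n]]) = b[[n]] := by
      simp only [swapMul, mul_one, hΓ]
      module
    simp [scomm, this]
  · simp [scomm, swapMul]

/-- The Wick formula for fields with constant `λ`-brackets. -/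
theorem OPE.nop_const (hΓ : Γ * Γ = 1) {p : ZMod 2} {a b b' c : VertexOperator ℂ V} {β γ : ℂ}
    (ha : FieldPar Γ p a) (hb : IsConj Γ p b b') (hab : OPE Γ a b (β • oneField) 0 0)
    (hac : OPE Γ a c (γ • oneField) 0 0) : OPE Γ a (QRed.nop Γ b c) (β • c + γ • b') 0 0 := by
  have h0 : OPE Γ (β • oneField) c 0 0 0 :=
    ((OPE.one_left c hΓ).smul_left β).of_eq (smul_zero β) (smul_zero β) (smul_zero β)
  refine (OPE.nop hΓ ha hb hab hac h0 (OPE.zero_left c)).of_eq ?_ ?_ ?_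
  · simp only [← nopB_apply, map_smul, LinearMap.smul_apply]
    simp [nop_oneField_left, nop_oneField_right hΓ]
  · simp only [← nopB_apply, map_zero, LinearMap.zero_apply, add_zero]
  · simp

/-- The Wick formula for a field that acts on two others without higher poles. -/
theorem OPE.nop_linear (hΓ : Γ * Γ = 1) {p : ZMod 2} {a b b' c b₀ c₀ : VertexOperator ℂ V} {ε : ℂ}
    (ha : FieldPar Γ p a) (hb : IsConj Γ p b b') (hab : OPE Γ a b b₀ 0 0)
    (hac : OPE Γ a c c₀ 0 0) (h0 : OPE Γ b₀ c (ε • oneField) 0 0) :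
    OPE Γ a (QRed.nop Γ b c) (QRed.nop Γ b₀ c + QRed.nop Γ b' c₀) (ε • oneField) 0 := by
  refine (OPE.nop hΓ ha hb hab hac h0 (OPE.zero_left c)).of_eq rfl ?_ ?_
  · simp only [← nopB_apply, map_zero, LinearMap.zero_apply, zero_add]
  · simp

end Generic

/-! ### Quadratic ghost fields attached to operators on g_+ and g_{1/2}. -/

namespace ReductionData
namespace FieldSystem

variable {g : Type*} [AddCommGroup g] [Module ℂ g] [LieSuperalgebra g] {Q : ReductionData g}
  {V : Type*} [AddCommGroup V] [Module ℂ V] (R : Q.FieldSystem V) {ι : Type*} [Fintype ι]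
  (𝔲 : Q.AdaptedBasis ι)

/-- The pairing `(a, ψ) ↦ :φ_a φ^*_ψ:`. -/
def nopPlus : Q.gPlus →ₗ[ℂ] Module.Dual ℂ Q.gPlus →ₗ[ℂ] VertexOperator ℂ V :=
  (nopB R.Γ).compl₁₂ R.gh R.ghDual

@[simp] theorem nopPlus_apply (a : Q.gPlus) (ψ : Module.Dual ℂ Q.gPlus) :
    R.nopPlus a ψ = nop R.Γ (R.gh a) (R.ghDual ψ) := rfl

/-- The pairing `(a, b) ↦ :Φ_a Φ_b:`. -/
def nopHalf : Q.gHalf →ₗ[ℂ] Q.gHalf →ₗ[ℂ] VertexOperator ℂ V :=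
  (nopB R.Γ).compl₁₂ R.ghNe R.ghNe

@[simp] theorem nopHalf_apply (a b : Q.gHalf) :
    R.nopHalf a b = nop R.Γ (R.ghNe a) (R.ghNe b) := rfl

/-- The quadratic field `∑_j :φ_{K u_j} φ_j^*:` of an operator `K` on `g_+`. -/
def quadPlus : Module.End ℂ Q.gPlus →ₗ[ℂ] VertexOperator ℂ V :=
  ∑ j, ((R.nopPlus).flip (𝔲.bPlus.coord j)) ∘ₗ LinearMap.applyₗ (𝔲.bPlus j)

/-- The quadratic field `∑_j :Φ_{K u_j} Φ^j:` of an operator `K` on `g_{1/2}`. -/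
def quadHalf : Module.End ℂ Q.gHalf →ₗ[ℂ] VertexOperator ℂ V :=
  ∑ j, ((R.nopHalf).flip (𝔲.halfDual j)) ∘ₗ LinearMap.applyₗ (𝔲.bHalf j)

theorem quadPlus_apply (K : Module.End ℂ Q.gPlus) : R.quadPlus 𝔲 K =
    ∑ j, nop R.Γ (R.gh (K (𝔲.bPlus j))) (R.ghDual (𝔲.bPlus.coord j)) := by
  simp [quadPlus]

theorem quadHalf_apply (K : Module.End ℂ Q.gHalf) : R.quadHalf 𝔲 K =
    ∑ j, nop R.Γ (R.ghNe (K (𝔲.bHalf j))) (R.ghNe (𝔲.halfDual j)) := by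
  simp [quadHalf]

/-- The two ghost signs cancel, and the Γ^p on the dual basis is carried to the other slot as in any
canonical element. -/
theorem isConj_quadPlus (p : ZMod 2) (K : Module.End ℂ Q.gPlus) :
    IsConj R.Γ p (R.quadPlus 𝔲 K)
      (R.quadPlus 𝔲 (Q.parPowPlus p ∘ₗ K ∘ₗ Q.parPowPlus p)) := by
  rw [quadPlus_apply, quadPlus_apply]
  refine (IsConj.sum _ fun j _ => (R.isConj_gh p _).nop R.Γ_Γ (R.isConj_ghDual p _)).congr ?_
  have h := 𝔲.sum_bPlus_adjoint (R.nopPlus ∘ₗ (Q.parPowPlus p ∘ₗ K)) (Q.parPowPlus p)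
  simp only [LinearMap.comp_apply, nopPlus_apply] at h
  simp only [LinearMap.comp_apply, h]
  refine Finset.sum_congr rfl fun j _ => ?_
  rw [← nopB_apply, map_smul, map_smul, LinearMap.smul_apply, smul_smul, sg_mul_self, one_smul,
    nopB_apply]

theorem isConj_quadHalf (p : ZMod 2) (K : Module.End ℂ Q.gHalf) :
    IsConj R.Γ p (R.quadHalf 𝔲 K)
      (R.quadHalf 𝔲 (Q.parPowHalf p ∘ₗ K ∘ₗ Q.parPowHalf p)) := by
  rw [quadHalf_apply, quadHalf_apply]
  refine (IsConj.sum _ fun j _ => (R.isConj_ghNe p _).nop R.Γ_Γ (R.isConj_ghNe p _)).congr ?_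
  have h := 𝔲.sum_bHalf_adjoint (R.nopHalf ∘ₗ (Q.parPowHalf p ∘ₗ K)) (Q.parPowHalf p)
    (Q.parPowHalf p) (Q.formHalf_parPowHalf p)
  simp only [LinearMap.comp_apply, nopHalf_apply] at h
  simp only [LinearMap.comp_apply, h]

/-- Homogeneity of an operator on `g_+`. -/
def IsParPlus (Q : ReductionData g) (p : ZMod 2) (K : Module.End ℂ Q.gPlus) : Prop :=
  ∀ a, Q.parityPlus (K a) = sg p • K (Q.parityPlus a)

/-- Homogeneity of an operator on `g_{1/2}`. -/
def IsParHalf (Q : ReductionData g) (p : ZMod 2) (K : Module.End ℂ Q.gHalf) : Prop :=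
  ∀ a, Q.parityHalf (K a) = sg p • K (Q.parityHalf a)

theorem IsParPlus.conj {p : ZMod 2} {K : Module.End ℂ Q.gPlus} (hK : IsParPlus Q p K)
    (q : ZMod 2) : Q.parPowPlus q ∘ₗ K ∘ₗ Q.parPowPlus q = sg (q * p) • K := by
  ext1 a
  induction q using zmod_two_cases with
  | h0 => simp [sg_zero]
  | h1 => simp [hK _]

theorem IsParHalf.conj {p : ZMod 2} {K : Module.End ℂ Q.gHalf} (hK : IsParHalf Q p K)
    (q : ZMod 2) : Q.parPowHalf q ∘ₗ K ∘ₗ Q.parPowHalf q = sg (q * p) • K := by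
  ext1 a
  induction q using zmod_two_cases with
  | h0 => simp [sg_zero]
  | h1 => simp [hK _]

theorem IsParPlus.parity_comp {p : ZMod 2} {K : Module.End ℂ Q.gPlus} (hK : IsParPlus Q p K) :
    IsParPlus Q p (Q.parityPlus ∘ₗ K) := fun a => by
  rw [LinearMap.comp_apply, hK, map_smul, LinearMap.comp_apply]

theorem IsParHalf.parity_comp {p : ZMod 2} {K : Module.End ℂ Q.gHalf} (hK : IsParHalf Q p K) :
    IsParHalf Q p (Q.parityHalf ∘ₗ K) := fun a => by
  rw [LinearMap.comp_apply, hK, map_smul, LinearMap.comp_apply]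

theorem fieldPar_quadPlus {p : ZMod 2} {K : Module.End ℂ Q.gPlus} (hK : IsParPlus Q p K) :
    FieldPar R.Γ p (R.quadPlus 𝔲 K) :=
  fieldPar_iff.2 ((R.isConj_quadPlus 𝔲 1 K).congr (by rw [hK.conj, one_mul, map_smul]))

theorem fieldPar_quadHalf {p : ZMod 2} {K : Module.End ℂ Q.gHalf} (hK : IsParHalf Q p K) :
    FieldPar R.Γ p (R.quadHalf 𝔲 K) :=
  fieldPar_iff.2 ((R.isConj_quadHalf 𝔲 1 K).congr (by rw [hK.conj, one_mul, map_smul]))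

theorem exists_sg_eq_neg (p : ZMod 2) : ∃ q : ZMod 2, sg q = -sg p := by
  induction p using zmod_two_cases
  · exact ⟨1, by simp [sg_one, sg_zero]⟩
  · exact ⟨0, by simp [sg_one, sg_zero]⟩

theorem coord_comp_parityPlus (i : 𝔲.S) :
    𝔲.bPlus.coord i ∘ₗ Q.parityPlus = sg (𝔲.par i) • 𝔲.bPlus.coord i := by
  ext1 a
  simpa using 𝔲.bPlus_coord_parityPlus i a

/-- Only φ_j^* contracts with φ_i, and only for j = i. What is left is φ_{K u_i}, conjugated because
φ_i was moved past it. -/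
theorem gh_quadPlus (i : 𝔲.S) {q : ZMod 2} (hq : sg q = -sg (𝔲.par i))
    (K : Module.End ℂ Q.gPlus) : OPE R.Γ (R.gh (𝔲.bPlus i)) (R.quadPlus 𝔲 K)
      (sg q • R.gh (Q.parPowPlus q (K (𝔲.bPlus i)))) 0 0 := by
  classical
  rw [quadPlus_apply]
  have h : ∀ j ∈ Finset.univ, OPE R.Γ (R.gh (𝔲.bPlus i))
      (nop R.Γ (R.gh (K (𝔲.bPlus j))) (R.ghDual (𝔲.bPlus.coord j)))
      (𝔲.bPlus.coord j (𝔲.bPlus i) • sg q • R.gh (Q.parPowPlus q (K (𝔲.bPlus j)))) 0 0 :=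
    fun j _ => (OPE.nop_const (β := 0) R.Γ_Γ (R.fieldPar_gh hq (𝔲.parityPlus_bPlus i))
      (R.isConj_gh q _) ((R.gh_gh _ _).of_eq (zero_smul _ _).symm rfl rfl)
      (R.gh_ghDual _ _)).of_eq (by rw [zero_smul, zero_add]) rfl rfl
  refine (OPE.sum_right _ h).of_eq ?_ Finset.sum_const_zero Finset.sum_const_zero
  rw [Finset.sum_eq_single i (by
    intro j _ hj
    simp [hj.symm]) (by simp)]
  simp

theorem ghDual_quadPlus (i : 𝔲.S) {q : ZMod 2} (hq : sg q = -sg (𝔲.par i))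
    (K : Module.End ℂ Q.gPlus) : OPE R.Γ (R.ghDual (𝔲.bPlus.coord i)) (R.quadPlus 𝔲 K)
      (R.ghDual (𝔲.bPlus.coord i ∘ₗ Q.parityPlus ∘ₗ K)) 0 0 := by
  rw [quadPlus_apply]
  have h : ∀ j ∈ Finset.univ, OPE R.Γ (R.ghDual (𝔲.bPlus.coord i))
      (nop R.Γ (R.gh (K (𝔲.bPlus j))) (R.ghDual (𝔲.bPlus.coord j)))
      (𝔲.bPlus.coord i (Q.parityPlus (K (𝔲.bPlus j))) • R.ghDual (𝔲.bPlus.coord j)) 0 0 :=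
    fun j _ => (OPE.nop_const (γ := 0) R.Γ_Γ
      (R.fieldPar_ghDual hq (coord_comp_parityPlus 𝔲 i)) (R.isConj_gh q _) (R.ghDual_gh _ _)
      ((R.ghDual_ghDual _ _).of_eq (zero_smul _ _).symm rfl rfl)).of_eq
      (by rw [zero_smul, add_zero]) rfl rfl
  refine (OPE.sum_right _ h).of_eq ?_ Finset.sum_const_zero Finset.sum_const_zero
  simp only [← map_smul, ← map_sum]
  congr 1
  refine 𝔲.bPlus.ext fun k => ?_
  classical
  rw [LinearMap.sum_apply, Finset.sum_eq_single k (by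
    intro j _ hj
    simp [hj.symm]) (by simp)]
  simp

/-- A homogeneous K makes the conjugate of the quadratic field a multiple ±1 of itself. Multiplying
by that sign puts the field itself in the first slot. -/
theorem skew_quadPlus (q : ZMod 2) {p : ZMod 2} {K : Module.End ℂ Q.gPlus}
    (hK : IsParPlus Q p K) {r c : VertexOperator ℂ V} (hr : FieldPar R.Γ q r)
    (h : OPE R.Γ r (R.quadPlus 𝔲 K) c 0 0) :
    OPE R.Γ (R.quadPlus 𝔲 K) r (-(sg (q * p) • c)) 0 0 := by
  have h1 := (h.skew R.Γ_Γ hr (R.isConj_quadPlus 𝔲 q K)).smul_left (sg (q * p))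
  rw [hK.conj, map_smul, smul_smul, sg_mul_self, one_smul] at h1
  refine h1.of_eq ?_ ?_ ?_ <;> simp [← derivL_apply]

theorem skew_quadHalf (q : ZMod 2) {p : ZMod 2} {K : Module.End ℂ Q.gHalf}
    (hK : IsParHalf Q p K) {r c : VertexOperator ℂ V} (hr : FieldPar R.Γ q r)
    (h : OPE R.Γ r (R.quadHalf 𝔲 K) c 0 0) :
    OPE R.Γ (R.quadHalf 𝔲 K) r (-(sg (q * p) • c)) 0 0 := by
  have h1 := (h.skew R.Γ_Γ hr (R.isConj_quadHalf 𝔲 q K)).smul_left (sg (q * p))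
  rw [hK.conj, map_smul, smul_smul, sg_mul_self, one_smul] at h1
  refine h1.of_eq ?_ ?_ ?_ <;> simp [← derivL_apply]

end FieldSystem
end ReductionData

/-! ### Action of the fields J on the currents and ghosts. -/

namespace ReductionData
namespace FieldSystem

variable {g : Type*} [AddCommGroup g] [Module ℂ g] [LieSuperalgebra g] {Q : ReductionData g}
  {V : Type*} [AddCommGroup V] [Module ℂ V] (R : Q.FieldSystem V) {ι : Type*} [Fintype ι]
  (𝔲 : Q.AdaptedBasis ι)

/-- The field `J` of parity `p` acts on the currents and ghosts by the operators `A`, `M`, `N`, with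
the level term `κ` on the currents. -/
structure ActsBy (J : VertexOperator ℂ V) (p : ZMod 2) (A : Module.End ℂ g)
    (M : Module.End ℂ Q.gPlus) (N : Module.End ℂ Q.gHalf) (κ : Module.Dual ℂ g) : Prop where
  par : FieldPar R.Γ p J
  cur : ∀ a, OPE R.Γ J (R.cur a) (R.cur (A a)) (κ a • oneField) 0
  gh : ∀ a, OPE R.Γ J (R.gh a) (sg p • R.gh (M a)) 0 0
  ghDual : ∀ ψ, OPE R.Γ J (R.ghDual ψ) (-(sg p • R.ghDual (ψ ∘ₗ Q.parPowPlus p ∘ₗ M))) 0 0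
  ghNe : ∀ a, OPE R.Γ J (R.ghNe a) (sg p • R.ghNe (N a)) 0 0

variable {R} in
theorem ActsBy.add {J J' : VertexOperator ℂ V} {p : ZMod 2} {A A' : Module.End ℂ g}
    {M M' : Module.End ℂ Q.gPlus} {N N' : Module.End ℂ Q.gHalf} {κ κ' : Module.Dual ℂ g}
    (h : R.ActsBy J p A M N κ) (h' : R.ActsBy J' p A' M' N' κ') :
    R.ActsBy (J + J') p (A + A') (M + M') (N + N') (κ + κ') where
  par := fieldPar_iff.2 (((fieldPar_iff.1 h.par).add (fieldPar_iff.1 h'.par)).congr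
    (smul_add _ _ _).symm)
  cur a := ((h.cur a).add_left (h'.cur a)).of_eq (by simp) (by simp [add_smul]) (add_zero 0)
  gh a := ((h.gh a).add_left (h'.gh a)).of_eq (by simp) (add_zero 0) (add_zero 0)
  ghDual ψ := ((h.ghDual ψ).add_left (h'.ghDual ψ)).of_eq
    (by simp only [LinearMap.comp_add, map_add, smul_add, neg_add]) (add_zero 0) (add_zero 0)
  ghNe a := ((h.ghNe a).add_left (h'.ghNe a)).of_eq (by simp) (add_zero 0) (add_zero 0)

theorem actsBy_cur {p : ZMod 2} {v : g} (hv : parity v = sg p • v) :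
    R.ActsBy (R.cur v) p (br v) 0 0 (Q.k • Q.form v) where
  par := R.fieldPar_cur hv
  cur a := R.cur_cur v a
  gh a := (R.cur_gh v a).of_eq (by simp) rfl rfl
  ghDual ψ := (R.cur_ghDual v ψ).of_eq (by simp) rfl rfl
  ghNe a := (R.cur_ghNe v a).of_eq (by simp) rfl rfl

theorem cur_quadPlus {p : ZMod 2} {v : g} (hv : parity v = sg p • v)
    (K : Module.End ℂ Q.gPlus) : OPE R.Γ (R.cur v) (R.quadPlus 𝔲 K) 0 0 0 := by
  rw [quadPlus_apply]
  have h : ∀ j ∈ Finset.univ, OPE R.Γ (R.cur v)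
      (nop R.Γ (R.gh (K (𝔲.bPlus j))) (R.ghDual (𝔲.bPlus.coord j))) 0 0 0 :=
    fun j _ => (OPE.nop_const (β := 0) (γ := 0) R.Γ_Γ (R.fieldPar_cur hv) (R.isConj_gh p _)
      ((R.cur_gh _ _).of_eq (zero_smul _ _).symm rfl rfl)
      ((R.cur_ghDual _ _).of_eq (zero_smul _ _).symm rfl rfl)).of_eq
      (by rw [zero_smul, zero_smul, zero_add]) rfl rfl
  exact (OPE.sum_right _ h).of_eq Finset.sum_const_zero Finset.sum_const_zero
    Finset.sum_const_zero

theorem ghNe_quadPlus {p : ZMod 2} {a : Q.gHalf} (ha : Q.parityHalf a = sg p • a)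
    (K : Module.End ℂ Q.gPlus) : OPE R.Γ (R.ghNe a) (R.quadPlus 𝔲 K) 0 0 0 := by
  rw [quadPlus_apply]
  have h : ∀ j ∈ Finset.univ, OPE R.Γ (R.ghNe a)
      (nop R.Γ (R.gh (K (𝔲.bPlus j))) (R.ghDual (𝔲.bPlus.coord j))) 0 0 0 :=
    fun j _ => (OPE.nop_const (β := 0) (γ := 0) R.Γ_Γ (R.fieldPar_ghNe ha) (R.isConj_gh p _)
      ((R.ghNe_gh _ _).of_eq (zero_smul _ _).symm rfl rfl)
      ((R.ghNe_ghDual _ _).of_eq (zero_smul _ _).symm rfl rfl)).of_eq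
      (by rw [zero_smul, zero_smul, zero_add]) rfl rfl
  exact (OPE.sum_right _ h).of_eq Finset.sum_const_zero Finset.sum_const_zero
    Finset.sum_const_zero

theorem quadHalf_zero_of {p : ZMod 2} {r : VertexOperator ℂ V} (hr : FieldPar R.Γ p r)
    (h0 : ∀ a, OPE R.Γ r (R.ghNe a) 0 0 0)
    (K : Module.End ℂ Q.gHalf) : OPE R.Γ r (R.quadHalf 𝔲 K) 0 0 0 := by
  rw [quadHalf_apply]
  have h : ∀ j ∈ Finset.univ, OPE R.Γ r
      (nop R.Γ (R.ghNe (K (𝔲.bHalf j))) (R.ghNe (𝔲.halfDual j))) 0 0 0 :=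
    fun j _ => (OPE.nop_const (β := 0) (γ := 0) R.Γ_Γ hr (R.isConj_ghNe p _)
      ((h0 _).of_eq (zero_smul _ _).symm rfl rfl)
      ((h0 _).of_eq (zero_smul _ _).symm rfl rfl)).of_eq
      (by rw [zero_smul, zero_smul, zero_add]) rfl rfl
  exact (OPE.sum_right _ h).of_eq Finset.sum_const_zero Finset.sum_const_zero
    Finset.sum_const_zero

theorem OPE_ext_basis_const {E J : Type*} [AddCommGroup E] [Module ℂ E] [Fintype J]
    {Γ : Module.End ℂ V} (b : Module.Basis J ℂ E) {a : VertexOperator ℂ V}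
    (F C₀ : E →ₗ[ℂ] VertexOperator ℂ V) (h : ∀ j, OPE Γ a (F (b j)) (C₀ (b j)) 0 0) (e : E) :
    OPE Γ a (F e) (C₀ e) 0 0 :=
  OPE.ext_basis b F C₀ 0 0 h e

/-- Skew-symmetry applied to `gh_quadPlus` on basis vectors. The case distinction on `q` only
verifies that all signs combine into the parity operator. -/
theorem quadPlus_gh {p : ZMod 2} {K : Module.End ℂ Q.gPlus} (hK : IsParPlus Q p K)
    (a : Q.gPlus) : OPE R.Γ (R.quadPlus 𝔲 K) (R.gh a) (R.gh (K (Q.parityPlus a))) 0 0 := by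
  refine OPE_ext_basis_const 𝔲.bPlus R.gh (R.gh ∘ₗ K ∘ₗ Q.parityPlus) (fun i => ?_) a
  obtain ⟨q, hq⟩ := exists_sg_eq_neg (𝔲.par i)
  refine (R.skew_quadPlus 𝔲 q hK (R.fieldPar_gh hq (𝔲.parityPlus_bPlus i))
    (R.gh_quadPlus 𝔲 i hq K)).of_eq ?_ rfl rfl
  simp only [LinearMap.comp_apply, 𝔲.parityPlus_bPlus, map_smul]
  induction q using zmod_two_cases with
  | h0 =>
    have h : sg (𝔲.par i) = -1 := by rw [sg_zero] at hq; linear_combination hq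
    simp only [h, sg_zero, zero_mul, one_smul, parPowPlus_zero]
    exact (neg_one_smul ℂ _).symm
  | h1 =>
    have h : sg (𝔲.par i) = 1 := by rw [sg_one] at hq; linear_combination hq
    rw [parPowPlus_one, hK, 𝔲.parityPlus_bPlus]
    simp [h, sg_one, smul_smul, sg_mul_self]

theorem quadPlus_ghDual {p : ZMod 2} {K : Module.End ℂ Q.gPlus} (hK : IsParPlus Q p K)
    (ψ : Module.Dual ℂ Q.gPlus) : OPE R.Γ (R.quadPlus 𝔲 K) (R.ghDual ψ)
      (-(sg p • R.ghDual (ψ ∘ₗ Q.parPowPlus p ∘ₗ Q.parityPlus ∘ₗ K))) 0 0 := by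
  classical
  refine OPE_ext_basis_const 𝔲.bPlus.dualBasis R.ghDual
    (-(sg p • R.ghDual ∘ₗ (Q.parPowPlus p ∘ₗ Q.parityPlus ∘ₗ K).dualMap)) (fun i => ?_) ψ
  rw [Module.Basis.coe_dualBasis]
  obtain ⟨q, hq⟩ := exists_sg_eq_neg (𝔲.par i)
  refine (R.skew_quadPlus 𝔲 q hK (R.fieldPar_ghDual hq (coord_comp_parityPlus 𝔲 i))
    (R.ghDual_quadPlus 𝔲 i hq K)).of_eq ?_ rfl rfl
  have hP : 𝔲.bPlus.coord i ∘ₗ Q.parPowPlus p = sg (p * 𝔲.par i) • 𝔲.bPlus.coord i := by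
    induction p using zmod_two_cases with
    | h0 => simp [parPowPlus, sg_zero]
    | h1 => rw [one_mul, ← coord_comp_parityPlus]; simp [parPowPlus]
  simp only [LinearMap.neg_apply, LinearMap.smul_apply, LinearMap.comp_apply,
    LinearMap.dualMap_apply']
  rw [← LinearMap.comp_assoc (_ ∘ₗ K), hP, LinearMap.smul_comp, map_smul, smul_smul, neg_inj]
  congr 1
  rw [← sg_add]
  have h1 : 𝔲.par i = q + 1 := by
    induction q using zmod_two_cases with
    | h0 =>
      have h : sg (𝔲.par i) = -1 := by rw [sg_zero] at hq; linear_combination hq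
      generalize 𝔲.par i = r at h ⊢
      induction r using zmod_two_cases with
      | h0 => rw [sg_zero] at h; norm_num at h
      | h1 => rfl
    | h1 =>
      have h : sg (𝔲.par i) = 1 := by rw [sg_one] at hq; linear_combination hq
      generalize 𝔲.par i = r at h ⊢
      induction r using zmod_two_cases with
      | h0 => rfl
      | h1 => rw [sg_one] at h; norm_num at h
  rw [h1]
  congr 1
  have h2 : p + p = 0 := CharTwo.add_self_eq_zero p
  linear_combination -h2

/-- The ghost part of the field `J^{(v)}`. -/
def ch : g →ₗ[ℂ] VertexOperator ℂ V :=
  R.quadPlus 𝔲 ∘ₗ LinearMap.llcomp ℂ _ _ _ Q.parityPlus ∘ₗ 𝔲.adPlus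

/-- The neutral ghost part of the field `J^{{v}}`. -/
def ne : g →ₗ[ℂ] VertexOperator ℂ V :=
  (-(1 / 2) : ℂ) • R.quadHalf 𝔲 ∘ₗ LinearMap.llcomp ℂ _ _ _ Q.parityHalf ∘ₗ 𝔲.adHalf

theorem ch_apply (v : g) : R.ch 𝔲 v = R.quadPlus 𝔲 (Q.parityPlus ∘ₗ 𝔲.adPlus v) := rfl

theorem ne_apply (v : g) :
    R.ne 𝔲 v = (-(1 / 2) : ℂ) • R.quadHalf 𝔲 (Q.parityHalf ∘ₗ 𝔲.adHalf v) := rfl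

theorem isParPlus_adPlus {p : ZMod 2} {v : g} (hv : parity v = sg p • v) :
    IsParPlus Q p (𝔲.adPlus v) := 𝔲.parityPlus_adPlus hv

theorem isParHalf_adHalf {p : ZMod 2} {v : g} (hv : parity v = sg p • v) :
    IsParHalf Q p (𝔲.adHalf v) := 𝔲.parityHalf_adHalf hv

theorem parityPlus_comp_self_comp (K : Module.End ℂ Q.gPlus) :
    Q.parityPlus ∘ₗ Q.parityPlus ∘ₗ K = K := by
  ext1 a; simp

/-- The operator in the quadratic field is Γ ad v; the extra Γ cancels the one created by
contraction, up to the sign of moving v past the parity shift of g_+. -/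
theorem actsBy_ch {p : ZMod 2} {v : g} (hv : parity v = sg p • v) :
    R.ActsBy (R.ch 𝔲 v) p 0 (𝔲.adPlus v) 0 0 where
  par := R.fieldPar_quadPlus 𝔲 (isParPlus_adPlus 𝔲 hv).parity_comp
  cur a := by
    refine (OPE_ext_basis_const 𝔲.u R.cur 0 (fun i => ?_) a).of_eq (by simp) (by simp) rfl
    exact (R.skew_quadPlus 𝔲 (𝔲.par i) (isParPlus_adPlus 𝔲 hv).parity_comp
      (R.fieldPar_cur (𝔲.parity_u i)) (R.cur_quadPlus 𝔲 (𝔲.parity_u i) _)).of_eq (by simp) rfl rfl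
  gh a := (R.quadPlus_gh 𝔲 (isParPlus_adPlus 𝔲 hv).parity_comp a).of_eq (by
    rw [LinearMap.comp_apply, isParPlus_adPlus 𝔲 hv, map_smul, parityPlus_parityPlus]) rfl rfl
  ghDual ψ := (R.quadPlus_ghDual 𝔲 (isParPlus_adPlus 𝔲 hv).parity_comp ψ).of_eq
    (by rw [parityPlus_comp_self_comp]) rfl rfl
  ghNe a := by
    refine (OPE_ext_basis_const 𝔲.bHalf R.ghNe 0 (fun i => ?_) a).of_eq (by simp) rfl rfl
    exact (R.skew_quadPlus 𝔲 (𝔲.par i) (isParPlus_adPlus 𝔲 hv).parity_comp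
      (R.fieldPar_ghNe (𝔲.parityHalf_bHalf i))
      (R.ghNe_quadPlus 𝔲 (𝔲.parityHalf_bHalf i) _)).of_eq (by simp) rfl rfl

theorem quadHalf_zero {p q : ZMod 2} {K : Module.End ℂ Q.gHalf} (hK : IsParHalf Q p K)
    {r : VertexOperator ℂ V} (hr : FieldPar R.Γ q r) (h0 : ∀ a, OPE R.Γ r (R.ghNe a) 0 0 0) :
    OPE R.Γ (R.quadHalf 𝔲 K) r 0 0 0 :=
  (R.skew_quadHalf 𝔲 q hK hr (R.quadHalf_zero_of 𝔲 hr h0 K)).of_eq (by simp) rfl rfl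

/-- A neutral ghost contracts with both factors, in contrast to a charged one; the two summands are
the two contractions. -/
theorem ghNe_quadHalf (i : 𝔲.S') (K : Module.End ℂ Q.gHalf) :
    OPE R.Γ (R.ghNe (𝔲.bHalf i)) (R.quadHalf 𝔲 K)
      (R.ghNe (∑ j, Q.formHalf (𝔲.bHalf i) (K (𝔲.bHalf j)) • 𝔲.halfDual j) +
        R.ghNe (Q.parPowHalf (𝔲.par i) (K (𝔲.bHalf i)))) 0 0 := by
  rw [quadHalf_apply]
  have h : ∀ j ∈ Finset.univ, OPE R.Γ (R.ghNe (𝔲.bHalf i))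
      (nop R.Γ (R.ghNe (K (𝔲.bHalf j))) (R.ghNe (𝔲.halfDual j)))
      (Q.formHalf (𝔲.bHalf i) (K (𝔲.bHalf j)) • R.ghNe (𝔲.halfDual j) +
        Q.formHalf (𝔲.bHalf i) (𝔲.halfDual j) •
          R.ghNe (Q.parPowHalf (𝔲.par i) (K (𝔲.bHalf j)))) 0 0 :=
    fun j _ => OPE.nop_const R.Γ_Γ (R.fieldPar_ghNe (𝔲.parityHalf_bHalf i))
      (R.isConj_ghNe _ _) (R.ghNe_ghNe _ _) (R.ghNe_ghNe _ _)
  refine (OPE.sum_right _ h).of_eq ?_ Finset.sum_const_zero Finset.sum_const_zero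
  rw [Finset.sum_add_distrib, map_sum]
  simp only [map_smul]
  congr 1
  classical
  rw [Finset.sum_eq_single i (by
    intro j _ hj
    simp [𝔲.formHalf_halfDual, hj.symm]) (by simp)]
  simp [𝔲.formHalf_halfDual]

/-- An operator of parity `p` on `g_{1/2}` that is skew-adjoint for `⟨. , .⟩`. -/
def IsSkewHalf (Q : ReductionData g) (p : ZMod 2) (N : Module.End ℂ Q.gHalf) : Prop :=
  ∀ a b, Q.formHalf (N a) b = -Q.formHalf (Q.parPowHalf p a) (N b)

theorem formHalf_smul_left (c : ℂ) (a b : Q.gHalf) :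
    Q.formHalf (c • a) b = c * Q.formHalf a b := by simp [formHalf]

theorem formHalf_smul_right (c : ℂ) (a b : Q.gHalf) :
    Q.formHalf a (c • b) = c * Q.formHalf a b := by simp [formHalf]

theorem sg_self_mul (p : ZMod 2) : sg (p * p) = sg p := by
  induction p using zmod_two_cases <;> simp

/-- For a skew-adjoint operator the two contractions coincide, and the factor 1/2 in v^ne
compensates the doubling. -/
theorem quadHalf_ghNe {p : ZMod 2} {N : Module.End ℂ Q.gHalf} (hN : IsParHalf Q p N)
    (hs : IsSkewHalf Q p N) (a : Q.gHalf) :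
    OPE R.Γ ((-(1 / 2) : ℂ) • R.quadHalf 𝔲 (Q.parityHalf ∘ₗ N)) (R.ghNe a)
      (sg p • R.ghNe (N a)) 0 0 := by
  refine OPE_ext_basis_const 𝔲.bHalf R.ghNe (sg p • R.ghNe ∘ₗ N) (fun i => ?_) a
  have h := (R.skew_quadHalf 𝔲 (𝔲.par i) hN.parity_comp (R.fieldPar_ghNe (𝔲.parityHalf_bHalf i))
    (R.ghNe_quadHalf 𝔲 i _)).smul_left (-(1 / 2))
  refine h.of_eq ?_ (smul_zero _) (smul_zero _)
  -- The contraction with the first factor: skew-adjointness and the symmetry of ⟨·,·⟩ turn its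
  -- coefficients into the expansion of N u_i in the dual basis.
  have h1 : ∑ j, Q.formHalf (𝔲.bHalf i) ((Q.parityHalf ∘ₗ N) (𝔲.bHalf j)) • 𝔲.halfDual j =
      (sg (𝔲.par i * p) * sg p) • N (𝔲.bHalf i) := by
    rw [← 𝔲.sum_formHalf_bHalf (N (𝔲.bHalf i)), Finset.smul_sum]
    refine Finset.sum_congr rfl fun j _ => ?_
    rw [smul_smul]
    congr 1
    have e1 := hs (Q.parPowHalf p (𝔲.bHalf i)) (𝔲.bHalf j)
    rw [parPowHalf_parPowHalf, Q.parPowHalf_of_parity p (𝔲.parityHalf_bHalf i), map_smul,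
      formHalf_smul_left, 𝔲.formHalf_skew, hN, 𝔲.parityHalf_bHalf, map_smul, formHalf_smul_right,
      formHalf_smul_right] at e1
    have e2 := Q.formHalf_parityHalf (𝔲.bHalf i) (Q.parityHalf (N (𝔲.bHalf j)))
    rw [parityHalf_parityHalf, 𝔲.parityHalf_bHalf, formHalf_smul_left] at e2
    rw [LinearMap.comp_apply, ← e2, mul_comm (𝔲.par i) p]
    linear_combination sg (𝔲.par i) * e1 +
      sg (p * 𝔲.par i) * sg p * Q.formHalf (𝔲.bHalf j) (N (𝔲.bHalf i)) * sg_mul_self (𝔲.par i)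
  have h2 : Q.parPowHalf (𝔲.par i) ((Q.parityHalf ∘ₗ N) (𝔲.bHalf i)) =
      (sg (𝔲.par i * p) * sg p) • N (𝔲.bHalf i) := by
    have hb := 𝔲.parityHalf_bHalf i
    generalize 𝔲.par i = q at hb
    rw [LinearMap.comp_apply]
    induction q using zmod_two_cases with
    | h0 => rw [hN, hb]; simp [sg_zero]
    | h1 => simp [sg_mul_self]
  rw [h1, h2, ← two_smul ℂ]
  simp only [smul_smul, map_smul, smul_neg, LinearMap.smul_apply, LinearMap.comp_apply]
  rw [← neg_smul]
  congr 1
  linear_combination sg p * sg_mul_self (𝔲.par i * p)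


end FieldSystem
end ReductionData

/-! ### λ-brackets of the fields J with quadratic fields and with each other. -/

namespace ReductionData
namespace FieldSystem

variable {g : Type*} [AddCommGroup g] [Module ℂ g] [LieSuperalgebra g] {Q : ReductionData g}
  {V : Type*} [AddCommGroup V] [Module ℂ V] (R : Q.FieldSystem V) {ι : Type*} [Fintype ι]
  (𝔲 : Q.AdaptedBasis ι)

variable {R} {J : VertexOperator ℂ V} {p : ZMod 2} {A : Module.End ℂ g}
  {M : Module.End ℂ Q.gPlus} {N : Module.End ℂ Q.gHalf} {κ : Module.Dual ℂ g}

/-- Wick's formula differentiates the two factors in turn. In the second summand M acts on φ_j^*;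
moved across the canonical element it multiplies K on the right, so the two summands form a twisted
commutator. The double contraction is ∑_j of the diagonal coefficients of M K, a trace. -/
theorem ActsBy.quadPlus (h : R.ActsBy J p A M N κ) (K : Module.End ℂ Q.gPlus) :
    OPE R.Γ J (R.quadPlus 𝔲 K)
      (R.quadPlus 𝔲 (sg p • M ∘ₗ K - Q.parPowPlus p ∘ₗ K ∘ₗ Q.parPowPlus p ∘ₗ M))
      ((sg p * LinearMap.trace ℂ _ (M ∘ₗ K)) • oneField) 0 := by
  rw [quadPlus_apply]
  have hj : ∀ j ∈ Finset.univ, OPE R.Γ J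
      (nop R.Γ (R.gh (K (𝔲.bPlus j))) (R.ghDual (𝔲.bPlus.coord j)))
      (R.nopPlus (sg p • M (K (𝔲.bPlus j))) (𝔲.bPlus.coord j) -
        R.nopPlus (Q.parPowPlus p (K (𝔲.bPlus j)))
          (𝔲.bPlus.coord j ∘ₗ Q.parPowPlus p ∘ₗ M))
      ((sg p * 𝔲.bPlus.coord j (M (K (𝔲.bPlus j)))) • oneField) 0 := fun j _ => by
    refine (OPE.nop_linear (ε := sg p * 𝔲.bPlus.coord j (M (K (𝔲.bPlus j)))) R.Γ_Γ h.par
      (R.isConj_gh p _) (h.gh _) (h.ghDual _) ?_).of_eq ?_ rfl rfl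
    · exact ((R.gh_ghDual _ _).smul_left (sg p)).of_eq (smul_smul _ _ _) (smul_zero _)
        (smul_zero _)
    · simp only [nopPlus_apply, ← nopB_apply, map_smul, map_neg, LinearMap.smul_apply,
        smul_smul, sg_mul_self, one_smul, sub_eq_add_neg]
  refine (OPE.sum_right _ hj).of_eq ?_ ?_ Finset.sum_const_zero
  · have e := 𝔲.sum_bPlus_adjoint (R.nopPlus ∘ₗ Q.parPowPlus p ∘ₗ K) (Q.parPowPlus p ∘ₗ M)
    simp only [LinearMap.comp_apply] at e
    rw [Finset.sum_sub_distrib, ← e, map_sub, quadPlus_apply, quadPlus_apply]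
    rfl
  · rw [← Finset.sum_smul, ← Finset.mul_sum, trace_eq_sum_coord 𝔲.bPlus]
    rfl

theorem ActsBy.quadHalf (h : R.ActsBy J p A M N κ) (hN : IsParHalf Q p N)
    (hs : IsSkewHalf Q p N) (K : Module.End ℂ Q.gHalf) :
    OPE R.Γ J (R.quadHalf 𝔲 K)
      (R.quadHalf 𝔲 (sg p • N ∘ₗ K - Q.parPowHalf p ∘ₗ K ∘ₗ Q.parPowHalf p ∘ₗ N))
      ((sg p * LinearMap.trace ℂ _ (N ∘ₗ K)) • oneField) 0 := by
  rw [quadHalf_apply]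
  have hj : ∀ j ∈ Finset.univ, OPE R.Γ J
      (nop R.Γ (R.ghNe (K (𝔲.bHalf j))) (R.ghNe (𝔲.halfDual j)))
      (R.nopHalf (sg p • N (K (𝔲.bHalf j))) (𝔲.halfDual j) +
        R.nopHalf (Q.parPowHalf p (K (𝔲.bHalf j))) (sg p • N (𝔲.halfDual j)))
      ((sg p * 𝔲.bHalf.coord j (N (K (𝔲.bHalf j)))) • oneField) 0 := fun j _ => by
    refine (OPE.nop_linear (ε := sg p * 𝔲.bHalf.coord j (N (K (𝔲.bHalf j)))) R.Γ_Γ h.par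
      (R.isConj_ghNe p _) (h.ghNe _) (h.ghNe _) ?_).of_eq ?_ rfl rfl
    · refine ((R.ghNe_ghNe _ _).smul_left (sg p)).of_eq ?_ (smul_zero _)
        (smul_zero _)
      rw [smul_smul, 𝔲.formHalf_halfDual]
    · simp only [nopHalf_apply, ← nopB_apply, map_smul, LinearMap.smul_apply]
  -- Here duality is with respect to ⟨·,·⟩, so skew-adjointness of N provides the operator that can
  -- be moved across the canonical element.
  have hadj : ∀ a w, Q.formHalf ((-(Q.parPowHalf p ∘ₗ N)) a) w = Q.formHalf a ((sg p • N) w) := by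
    intro a w
    have e := hs (Q.parPowHalf p a) w
    rw [parPowHalf_parPowHalf] at e
    have e2 : Q.parPowHalf p (N a) = sg p • N (Q.parPowHalf p a) := by
      have := LinearMap.congr_fun (hN.conj p) (Q.parPowHalf p a)
      simpa [sg_self_mul] using this
    rw [LinearMap.neg_apply, LinearMap.comp_apply, e2, ← smul_neg, formHalf_smul_left,
      ← neg_one_smul ℂ, formHalf_smul_left, e, LinearMap.smul_apply, formHalf_smul_right]
    ring
  refine (OPE.sum_right _ hj).of_eq ?_ ?_ Finset.sum_const_zero
  · have e := 𝔲.sum_bHalf_adjoint (R.nopHalf ∘ₗ Q.parPowHalf p ∘ₗ K) _ _ hadj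
    simp only [LinearMap.comp_apply, LinearMap.smul_apply] at e
    rw [Finset.sum_add_distrib, ← e, sub_eq_add_neg, map_add, quadHalf_apply, quadHalf_apply]
    simp only [nopHalf_apply, ← nopB_apply, LinearMap.smul_apply, LinearMap.neg_apply,
      LinearMap.comp_apply, map_neg]
  · rw [← Finset.sum_smul, ← Finset.mul_sum, trace_eq_sum_coord 𝔲.bHalf]
    rfl

theorem parPowPlus_adPlus (q : ZMod 2) (v : g) :
    Q.parPowPlus q ∘ₗ 𝔲.adPlus v ∘ₗ Q.parPowPlus q = 𝔲.adPlus (parPow q v) := by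
  ext1 a
  induction q using zmod_two_cases with
  | h0 => simp
  | h1 =>
    simp only [LinearMap.comp_apply, parPowPlus_one, parPow_one, 𝔲.adPlus_apply]
    rw [← 𝔲.projPlus_parity, LieSuperalgebra.parity_br, coe_parityPlus,
      LieSuperalgebra.parity_parity]

theorem parPowHalf_adHalf (q : ZMod 2) (v : g) :
    Q.parPowHalf q ∘ₗ 𝔲.adHalf v ∘ₗ Q.parPowHalf q = 𝔲.adHalf (parPow q v) := by
  ext1 a
  induction q using zmod_two_cases with
  | h0 => simp
  | h1 =>
    simp only [LinearMap.comp_apply, parPowHalf_one, parPow_one, 𝔲.adHalf_apply]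
    rw [← 𝔲.projHalf_parity, LieSuperalgebra.parity_br, coe_parityHalf,
      LieSuperalgebra.parity_parity]

theorem parPowPlus_parityPlus (q : ZMod 2) (a : Q.gPlus) :
    Q.parPowPlus q (Q.parityPlus a) = Q.parityPlus (Q.parPowPlus q a) := by
  induction q using zmod_two_cases <;> simp

theorem parPowHalf_parityHalf (q : ZMod 2) (a : Q.gHalf) :
    Q.parPowHalf q (Q.parityHalf a) = Q.parityHalf (Q.parPowHalf q a) := by
  induction q using zmod_two_cases <;> simp

/-- For K = Γ ad v' the twisted commutator is Γ ad [v,v'] by `adPlus_br`, and moving Γ to the left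
turns the trace into a supertrace; the sign p cancels in both. -/
theorem ActsBy.ch {m n : ℤ} (hmn : 0 ≤ m * n) {v v' : g} (hp : parity v = sg p • v)
    (hv : v ∈ gr Q.x m) (hv' : v' ∈ gr Q.x n) (h : R.ActsBy J p A (𝔲.adPlus v) N κ) :
    OPE R.Γ J (R.ch 𝔲 v') (R.ch 𝔲 (br v v'))
      (LinearMap.trace ℂ _ (Q.parityPlus ∘ₗ 𝔲.adPlus v ∘ₗ 𝔲.adPlus v') • oneField) 0 := by
  have hM : 𝔲.adPlus v ∘ₗ Q.parityPlus = sg p • Q.parityPlus ∘ₗ 𝔲.adPlus v := by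
    ext1 a
    simp only [LinearMap.comp_apply, LinearMap.smul_apply]
    rw [𝔲.parityPlus_adPlus hp, smul_smul, sg_mul_self, one_smul]
  refine (h.quadPlus 𝔲 (Q.parityPlus ∘ₗ 𝔲.adPlus v')).of_eq ?_ ?_ rfl
  · rw [ch_apply]
    congr 1
    rw [← LinearMap.comp_assoc, hM, LinearMap.smul_comp, smul_smul, sg_mul_self, one_smul]
    ext1 a
    simp only [LinearMap.sub_apply, LinearMap.comp_apply]
    rw [𝔲.adPlus_br hmn hp hv hv', ← parPowPlus_adPlus, map_sub, parPowPlus_parityPlus]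
    rfl
  · rw [← LinearMap.comp_assoc, hM, LinearMap.smul_comp, map_smul, smul_eq_mul, ← mul_assoc,
      sg_mul_self, one_mul]
    rfl

theorem ActsBy.ne {v v' : g} (hp : parity v = sg p • v) (hv : v ∈ gr Q.x 0)
    (hv' : v' ∈ gr Q.x 0) (hs : IsSkewHalf Q p (𝔲.adHalf v))
    (h : R.ActsBy J p A M (𝔲.adHalf v) κ) :
    OPE R.Γ J (R.ne 𝔲 v') (R.ne 𝔲 (br v v'))
      (-((1 / 2) * LinearMap.trace ℂ _ (Q.parityHalf ∘ₗ 𝔲.adHalf v ∘ₗ 𝔲.adHalf v')) •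
        oneField) 0 := by
  have hM : 𝔲.adHalf v ∘ₗ Q.parityHalf = sg p • Q.parityHalf ∘ₗ 𝔲.adHalf v := by
    ext1 a
    simp only [LinearMap.comp_apply, LinearMap.smul_apply]
    rw [𝔲.parityHalf_adHalf hp, smul_smul, sg_mul_self, one_smul]
  rw [ne_apply]
  refine ((h.quadHalf 𝔲 (isParHalf_adHalf 𝔲 hp) hs _).smul_right _).of_eq ?_ ?_ (smul_zero _)
  · rw [ne_apply]
    congr 2
    rw [← LinearMap.comp_assoc, hM, LinearMap.smul_comp, smul_smul, sg_mul_self, one_smul]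
    ext1 a
    simp only [LinearMap.sub_apply, LinearMap.comp_apply]
    rw [𝔲.adHalf_br hp hv hv', ← parPowHalf_adHalf, map_sub, parPowHalf_parityHalf]
    rfl
  · rw [← LinearMap.comp_assoc, hM, LinearMap.smul_comp, map_smul, smul_eq_mul, ← mul_assoc,
      sg_mul_self, one_mul, smul_smul, neg_mul]
    rfl

theorem isSkewHalf_adHalf {v : g} (hp : parity v = sg p • v) (hv : v ∈ Q.centralizer₀) :
    IsSkewHalf Q p (𝔲.adHalf v) := fun a b =>
  𝔲.formHalf_adHalf hp hv a b _ (Q.coe_parPowHalf p a)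

theorem actsBy_ne {v : g} (hp : parity v = sg p • v) (hv : v ∈ Q.centralizer₀) :
    R.ActsBy (R.ne 𝔲 v) p 0 0 (𝔲.adHalf v) 0 where
  par := by
    refine fieldPar_iff.2 (((fieldPar_iff.1 (R.fieldPar_quadHalf 𝔲
      (isParHalf_adHalf 𝔲 hp).parity_comp)).smul (-(1 / 2))).congr (smul_comm _ _ _))
  cur a := by
    refine (OPE_ext_basis_const 𝔲.u R.cur 0 (fun i => ?_) a).of_eq (by simp) (by simp) rfl
    rw [ne_apply]
    exact ((R.quadHalf_zero 𝔲 (isParHalf_adHalf 𝔲 hp).parity_comp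
      (R.fieldPar_cur (𝔲.parity_u i)) (R.cur_ghNe _)).smul_left _).of_eq (smul_zero _)
        (smul_zero _) (smul_zero _)
  gh a := by
    refine (OPE_ext_basis_const 𝔲.bPlus R.gh 0 (fun i => ?_) a).of_eq (by simp) (by simp) rfl
    obtain ⟨q, hq⟩ := exists_sg_eq_neg (𝔲.par i)
    rw [ne_apply]
    exact ((R.quadHalf_zero 𝔲 (isParHalf_adHalf 𝔲 hp).parity_comp
      (R.fieldPar_gh hq (𝔲.parityPlus_bPlus i)) (R.gh_ghNe _)).smul_left _).of_eq (smul_zero _)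
        (smul_zero _) (smul_zero _)
  ghDual ψ := by
    classical
    refine (OPE_ext_basis_const 𝔲.bPlus.dualBasis R.ghDual 0 (fun i => ?_) ψ).of_eq (by simp)
      (by simp) rfl
    obtain ⟨q, hq⟩ := exists_sg_eq_neg (𝔲.par i)
    rw [ne_apply, Module.Basis.coe_dualBasis]
    exact ((R.quadHalf_zero 𝔲 (isParHalf_adHalf 𝔲 hp).parity_comp
      (R.fieldPar_ghDual hq (coord_comp_parityPlus 𝔲 i)) (R.ghDual_ghNe _)).smul_left _).of_eq
        (smul_zero _) (smul_zero _) (smul_zero _)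
  ghNe a := R.quadHalf_ghNe 𝔲 (isParHalf_adHalf 𝔲 hp) (isSkewHalf_adHalf 𝔲 hp hv) a

variable (R)

/-- The field `J^{(v)}`. -/
def Jround : g →ₗ[ℂ] VertexOperator ℂ V := R.cur + R.ch 𝔲

/-- The field `J^{{v}}`. -/
def Jcurly : g →ₗ[ℂ] VertexOperator ℂ V := R.cur + R.ch 𝔲 + R.ne 𝔲

theorem actsBy_Jround {v : g} (hp : parity v = sg p • v) :
    R.ActsBy (R.Jround 𝔲 v) p (br v) (𝔲.adPlus v) 0 (Q.k • Q.form v) := by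
  have h := (R.actsBy_cur hp).add (R.actsBy_ch 𝔲 hp)
  simp only [add_zero, zero_add] at h
  exact h

theorem actsBy_Jcurly {v : g} (hp : parity v = sg p • v) (hv : v ∈ Q.centralizer₀) :
    R.ActsBy (R.Jcurly 𝔲 v) p (br v) (𝔲.adPlus v) (𝔲.adHalf v) (Q.k • Q.form v) := by
  have h := (R.actsBy_Jround 𝔲 hp).add (actsBy_ne 𝔲 hp hv)
  simp only [add_zero, zero_add] at h
  exact h

theorem exists_parity_decomp (W : Submodule ℂ g) (hW : ∀ a ∈ W, parity a ∈ W) {v : g}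
    (hv : v ∈ W) : ∃ v₀ v₁ : g, v = v₀ + v₁ ∧ v₀ ∈ W ∧ v₁ ∈ W ∧
      parity v₀ = sg 0 • v₀ ∧ parity v₁ = sg 1 • v₁ := by
  refine ⟨(1 / 2 : ℂ) • (v + parity v), (1 / 2 : ℂ) • (v - parity v), ?_,
    W.smul_mem _ (W.add_mem hv (hW v hv)), W.smul_mem _ (W.sub_mem hv (hW v hv)), ?_, ?_⟩
  · module
  · rw [sg_zero, map_smul, map_add, LieSuperalgebra.parity_parity]
    module
  · rw [sg_one, map_smul, map_sub, LieSuperalgebra.parity_parity]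
    module

/-- Operator product expansions that are linear in `v ∈ W` may be checked for homogeneous `v`. -/
theorem OPE_of_homogeneous (W : Submodule ℂ g) (hW : ∀ a ∈ W, parity a ∈ W)
    (F C₀ C₁ C₂ : g →ₗ[ℂ] VertexOperator ℂ V) (b : VertexOperator ℂ V)
    (H : ∀ (p : ZMod 2), ∀ v ∈ W, parity v = sg p • v →
      OPE R.Γ (F v) b (C₀ v) (C₁ v) (C₂ v)) {v : g} (hv : v ∈ W) :
    OPE R.Γ (F v) b (C₀ v) (C₁ v) (C₂ v) := by
  obtain ⟨v₀, v₁, rfl, h0, h1, p0, p1⟩ := exists_parity_decomp W hW hv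
  simp only [map_add]
  exact (H 0 v₀ h0 p0).add_left (H 1 v₁ h1 p1)

theorem parity_mem_centralizer {v : g} (hv : v ∈ Q.centralizer₀) :
    parity v ∈ Q.centralizer₀ := by
  refine ⟨Q.parity_mem_gr 0 hv.1, ?_⟩
  have h : br Q.f v = 0 := hv.2
  have := LieSuperalgebra.parity_br Q.f v
  rw [h, map_zero, Q.f_even] at this
  exact this.symm

theorem Jround_Jround {m n : ℤ} (hmn : 0 ≤ m * n) {v v' : g} (hv : v ∈ gr Q.x m)
    (hv' : v' ∈ gr Q.x n) : OPE R.Γ (R.Jround 𝔲 v) (R.Jround 𝔲 v') (R.Jround 𝔲 (br v v'))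
      ((if m = 0 ∧ n = 0 then Q.k * Q.form v v' + strOn Q.gPlus (br v ∘ₗ br v') else 0) •
        oneField) 0 := by
  have key := R.OPE_of_homogeneous (gr Q.x m) (fun _ => Q.parity_mem_gr m) (R.Jround 𝔲)
    (R.Jround 𝔲 ∘ₗ br.flip v')
    ((Q.k • Q.form.flip v' + LinearMap.trace ℂ _ ∘ₗ LinearMap.llcomp ℂ _ _ _ Q.parityPlus ∘ₗ
      LinearMap.lcomp ℂ _ (𝔲.adPlus v') ∘ₗ 𝔲.adPlus).smulRight oneField) 0 (R.Jround 𝔲 v')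
    (fun p v hv hp => by
      have h := R.actsBy_Jround 𝔲 hp
      refine ((h.cur v').add_right (h.ch 𝔲 hmn hp hv hv')).of_eq rfl ?_ (add_zero 0)
      rw [← add_smul]
      rfl) hv
  refine key.of_eq rfl ?_ rfl
  rw [LinearMap.smulRight_apply]
  congr 1
  change Q.k * Q.form v v' +
    LinearMap.trace ℂ _ (Q.parityPlus ∘ₗ 𝔲.adPlus v ∘ₗ 𝔲.adPlus v') = _
  split_ifs with h
  · obtain ⟨rfl, rfl⟩ := h
    rw [𝔲.strOn_br_br hv hv']
  -- Degrees of equal sign with sum 0 are both 0. Outside that case both the form and the trace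
  -- vanish for degree reasons.
  · have h' : m + n ≠ 0 := fun h0 => h (by
      obtain rfl : n = -m := by omega
      have : m = 0 := by nlinarith
      exact ⟨this, by omega⟩)
    rw [Q.form_eq_zero hv hv' h', 𝔲.trace_adPlus_adPlus_eq_zero h' hv hv', mul_zero, add_zero]

/-- Only the acting element has to centralize f, to make its operator on g_{1/2} skew; `v'` enters
through its quadratic fields, for which degree 0 suffices. The factor -1/2 of v^ne becomes the
coefficient of the supertrace over g_{1/2}. -/
theorem Jcurly_Jcurly {v v' : g} (hv : v ∈ Q.centralizer₀) (hv' : v' ∈ gr Q.x 0) :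
    OPE R.Γ (R.Jcurly 𝔲 v) (R.Jcurly 𝔲 v') (R.Jcurly 𝔲 (br v v'))
      ((Q.k * Q.form v v' + strOn Q.gPlus (br v ∘ₗ br v') -
        1 / 2 * strOn Q.gHalf (br v ∘ₗ br v')) • oneField) 0 := by
  have key := R.OPE_of_homogeneous Q.centralizer₀ (fun _ => parity_mem_centralizer)
    (R.Jcurly 𝔲) (R.Jcurly 𝔲 ∘ₗ br.flip v')
    ((Q.k • Q.form.flip v' + LinearMap.trace ℂ _ ∘ₗ LinearMap.llcomp ℂ _ _ _ Q.parityPlus ∘ₗ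
      LinearMap.lcomp ℂ _ (𝔲.adPlus v') ∘ₗ 𝔲.adPlus +
      (-(1 / 2 : ℂ)) • LinearMap.trace ℂ _ ∘ₗ LinearMap.llcomp ℂ _ _ _ Q.parityHalf ∘ₗ
      LinearMap.lcomp ℂ _ (𝔲.adHalf v') ∘ₗ 𝔲.adHalf).smulRight oneField) 0 (R.Jcurly 𝔲 v')
    (fun p v hv hp => by
      have h := R.actsBy_Jcurly 𝔲 hp hv
      refine (((h.cur v').add_right (h.ch 𝔲 (by simp) hp hv.1 hv')).add_right
        (h.ne 𝔲 hp hv.1 hv' (isSkewHalf_adHalf 𝔲 hp hv))).of_eq rfl ?_ (by simp)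
      rw [← add_smul, ← add_smul, LinearMap.smulRight_apply]
      congr 1
      rw [← neg_mul]
      rfl) hv
  refine key.of_eq rfl ?_ rfl
  rw [LinearMap.smulRight_apply]
  congr 1
  rw [𝔲.strOn_br_br hv.1 hv', 𝔲.strOn_gHalf_br_br hv.1 hv', sub_eq_add_neg, ← neg_mul]
  rfl

end FieldSystem
end ReductionData

/-! ### The differential and its invariance under g_0^f. -/

section Generic

variable {V : Type*} [AddCommGroup V] [Module ℂ V] {Γ : Module.End ℂ V}

theorem OPE.sum_left {ι : Type*} (s : Finset ι) {b : VertexOperator ℂ V}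
    {a c₀ c₁ c₂ : ι → VertexOperator ℂ V} (h : ∀ i ∈ s, OPE Γ (a i) b (c₀ i) (c₁ i) (c₂ i)) :
    OPE Γ (∑ i ∈ s, a i) b (∑ i ∈ s, c₀ i) (∑ i ∈ s, c₁ i) (∑ i ∈ s, c₂ i) := by
  classical
  induction s using Finset.induction_on with
  | empty => simpa using OPE.zero_left b
  | insert i s hi ih =>
    simp only [Finset.sum_insert hi]
    exact (h i (Finset.mem_insert_self i s)).add_left
      (ih fun j hj => h j (Finset.mem_insert_of_mem hj))

/-- The Wick formula in the absence of poles beyond the first order. -/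
theorem OPE.nop_deriv (hΓ : Γ * Γ = 1) {p : ZMod 2} {a b b' c b₀ c₀ : VertexOperator ℂ V}
    (ha : FieldPar Γ p a) (hb : IsConj Γ p b b') (hab : OPE Γ a b b₀ 0 0)
    (hac : OPE Γ a c c₀ 0 0) (h0 : OPE Γ b₀ c 0 0 0) :
    OPE Γ a (QRed.nop Γ b c) (QRed.nop Γ b₀ c + QRed.nop Γ b' c₀) 0 0 :=
  (OPE.nop_linear (ε := 0) hΓ ha hb hab hac (h0.of_eq (zero_smul _ _).symm rfl rfl)).of_eq rfl
    (zero_smul _ _) rfl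

end Generic

namespace ReductionData

variable {g : Type*} [AddCommGroup g] [Module ℂ g] [LieSuperalgebra g] {Q : ReductionData g}

theorem br_mem_gPlus_of_mem {a b : g} (ha : a ∈ Q.gPlus) (hb : b ∈ Q.gPlus) :
    br a b ∈ Q.gPlus := by
  have : Q.gPlus ≤ Q.gPlus.comap (br.flip b) :=
    iSup_le fun n v hv => Q.br_mem_gPlus n.2.le hv hb
  exact this ha

namespace FieldSystem

variable {V : Type*} [AddCommGroup V] [Module ℂ V] (R : Q.FieldSystem V) {ι : Type*} [Fintype ι]
  (𝔲 : Q.AdaptedBasis ι)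

/-- The pairing `(a, ψ) ↦ :a φ^*_ψ:`. -/
def nopCur : Q.gPlus →ₗ[ℂ] Module.Dual ℂ Q.gPlus →ₗ[ℂ] VertexOperator ℂ V :=
  (nopB R.Γ).compl₁₂ (R.cur ∘ₗ Q.gPlus.subtype) R.ghDual

@[simp] theorem nopCur_apply (a : Q.gPlus) (ψ : Module.Dual ℂ Q.gPlus) :
    R.nopCur a ψ = nop R.Γ (R.cur a) (R.ghDual ψ) := rfl

/-- The pairing `(a, ψ) ↦ :φ^*_ψ Φ_a:`. -/
def nopNe : Q.gHalf →ₗ[ℂ] Module.Dual ℂ Q.gPlus →ₗ[ℂ] VertexOperator ℂ V :=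
  ((nopB R.Γ).compl₁₂ R.ghDual R.ghNe).flip

@[simp] theorem nopNe_apply (a : Q.gHalf) (ψ : Module.Dual ℂ Q.gPlus) :
    R.nopNe a ψ = nop R.Γ (R.ghDual ψ) (R.ghNe a) := rfl

/-- The cubic field `∑_{ij} :φ_{T(u_i, u_j)} φ_i^* φ_j^*:` of a bilinear operation `T` on `g_+`. -/
def cubic : (Q.gPlus →ₗ[ℂ] Q.gPlus →ₗ[ℂ] Q.gPlus) →ₗ[ℂ] VertexOperator ℂ V where
  toFun T := ∑ j, ∑ i, nopB R.Γ (R.gh (T (𝔲.bPlus i) (𝔲.bPlus j)))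
    (nopB R.Γ (R.ghDual (𝔲.bPlus.coord i)) (R.ghDual (𝔲.bPlus.coord j)))
  map_add' T T' := by
    simp only [LinearMap.add_apply, map_add, Finset.sum_add_distrib]
  map_smul' c T := by
    simp only [LinearMap.smul_apply, map_smul, Finset.smul_sum, RingHom.id_apply]

theorem cubic_apply (T : Q.gPlus →ₗ[ℂ] Q.gPlus →ₗ[ℂ] Q.gPlus) : R.cubic 𝔲 T =
    ∑ j, ∑ i, nopB R.Γ (R.gh (T (𝔲.bPlus i) (𝔲.bPlus j)))
      (nopB R.Γ (R.ghDual (𝔲.bPlus.coord i)) (R.ghDual (𝔲.bPlus.coord j))) := rfl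

theorem cubic_sub (T T' : Q.gPlus →ₗ[ℂ] Q.gPlus →ₗ[ℂ] Q.gPlus) :
    R.cubic 𝔲 (T - T') = R.cubic 𝔲 T - R.cubic 𝔲 T' := map_sub (R.cubic 𝔲) T T'

/-- `sum_bPlus_adjoint` in each of the two indices separately. -/
theorem cubic_compl (T : Q.gPlus →ₗ[ℂ] Q.gPlus →ₗ[ℂ] Q.gPlus) (A B : Module.End ℂ Q.gPlus) :
    R.cubic 𝔲 (T.compl₁₂ A B) = ∑ j, ∑ i, nopB R.Γ (R.gh (T (𝔲.bPlus i) (𝔲.bPlus j)))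
      (nopB R.Γ (R.ghDual (𝔲.bPlus.coord i ∘ₗ A)) (R.ghDual (𝔲.bPlus.coord j ∘ₗ B))) := by
  have h1 : ∀ j, ∑ i, nopB R.Γ (R.gh (T (𝔲.bPlus i) (𝔲.bPlus j)))
      (nopB R.Γ (R.ghDual (𝔲.bPlus.coord i ∘ₗ A)) (R.ghDual (𝔲.bPlus.coord j ∘ₗ B))) =
      ∑ i, nopB R.Γ (R.gh (T (A (𝔲.bPlus i)) (𝔲.bPlus j)))
      (nopB R.Γ (R.ghDual (𝔲.bPlus.coord i)) (R.ghDual (𝔲.bPlus.coord j ∘ₗ B))) := fun j =>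
    (𝔲.sum_bPlus_adjoint ((nopB R.Γ).compl₁₂ (R.gh ∘ₗ T.flip (𝔲.bPlus j))
      ((nopB R.Γ).flip (R.ghDual (𝔲.bPlus.coord j ∘ₗ B)) ∘ₗ R.ghDual)) A).symm
  have h2 : ∀ i, ∑ j, nopB R.Γ (R.gh (T (A (𝔲.bPlus i)) (𝔲.bPlus j)))
      (nopB R.Γ (R.ghDual (𝔲.bPlus.coord i)) (R.ghDual (𝔲.bPlus.coord j ∘ₗ B))) =
      ∑ j, nopB R.Γ (R.gh (T (A (𝔲.bPlus i)) (B (𝔲.bPlus j))))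
      (nopB R.Γ (R.ghDual (𝔲.bPlus.coord i)) (R.ghDual (𝔲.bPlus.coord j))) := fun i =>
    (𝔲.sum_bPlus_adjoint ((nopB R.Γ).compl₁₂ (R.gh ∘ₗ T (A (𝔲.bPlus i)))
      (nopB R.Γ (R.ghDual (𝔲.bPlus.coord i)) ∘ₗ R.ghDual)) B).symm
  rw [Finset.sum_congr rfl fun j _ => h1 j, Finset.sum_comm, Finset.sum_congr rfl fun i _ => h2 i,
    Finset.sum_comm]
  rfl

/-- The operation `(a, b) ↦ [b, Γ a]` on `g_+`. -/
def brPlus : Q.gPlus →ₗ[ℂ] Q.gPlus →ₗ[ℂ] Q.gPlus :=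
  (𝔲.adPlus ∘ₗ Q.gPlus.subtype).flip ∘ₗ Q.parityPlus

theorem coe_brPlus (a b : Q.gPlus) : (brPlus 𝔲 a b : g) = br (b : g) (parity (a : g)) :=
  𝔲.coe_projPlus (br_mem_gPlus_of_mem b.2 (Q.parityPlus a).2)

/-- The projection of `g_+` onto `g_{1/2}`. -/
def plusToHalf : Q.gPlus →ₗ[ℂ] Q.gHalf := 𝔲.projHalf ∘ₗ Q.gPlus.subtype

/-- The part `∑ (-1)^{p(u_i)} :u_i φ_i^*:` of the differential. -/
def dCur : VertexOperator ℂ V := ∑ i, R.nopCur (Q.parityPlus (𝔲.bPlus i)) (𝔲.bPlus.coord i)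

/-- The part `∑ :φ_i^* Φ_i:` of the differential. -/
def dNe : VertexOperator ℂ V := ∑ i, R.nopNe (plusToHalf 𝔲 (𝔲.bPlus i)) (𝔲.bPlus.coord i)

/-- The restriction of `(f | .)` to `g_+`. -/
def formF (Q : ReductionData g) : Module.Dual ℂ Q.gPlus := Q.form Q.f ∘ₗ Q.gPlus.subtype

/-- The field `d`. -/
def d : VertexOperator ℂ V :=
  R.dCur 𝔲 + (1 / 2 : ℂ) • R.cubic 𝔲 (brPlus 𝔲) + R.ghDual (formF Q) + R.dNe 𝔲

variable {R} {p : ZMod 2} {J : VertexOperator ℂ V} {A : Module.End ℂ g}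
  {M : Module.End ℂ Q.gPlus} {N : Module.End ℂ Q.gHalf} {κ : Module.Dual ℂ g}

theorem IsParPlus.parPowPlus_apply {K : Module.End ℂ Q.gPlus} (hK : IsParPlus Q p K)
    (q : ZMod 2) (a : Q.gPlus) :
    Q.parPowPlus q (K a) = sg (q * p) • K (Q.parPowPlus q a) := by
  have := LinearMap.congr_fun (hK.conj q) (Q.parPowPlus q a)
  simpa using this

/-- This part of d is the canonical element of g_+ with one slot realized by currents, and J acts on
both slots by dual operators, so the contributions cancel. The level term must vanish on g_+, which
degrees guarantee in the application. -/
theorem ActsBy.dCur (h : R.ActsBy J p A M N κ) (hM : IsParPlus Q p M)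
    (hA : ∀ a : Q.gPlus, A a = M a) (hκ : ∀ a : Q.gPlus, κ a = 0) :
    OPE R.Γ J (R.dCur 𝔲) 0 0 0 := by
  have hj : ∀ j ∈ Finset.univ, OPE R.Γ J
      (R.nopCur (Q.parityPlus (𝔲.bPlus j)) (𝔲.bPlus.coord j))
      (R.nopCur (M (Q.parityPlus (𝔲.bPlus j))) (𝔲.bPlus.coord j) -
        sg p • R.nopCur (Q.parPowPlus p (Q.parityPlus (𝔲.bPlus j)))
          (𝔲.bPlus.coord j ∘ₗ Q.parPowPlus p ∘ₗ M)) 0 0 := fun j _ => by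
    refine (OPE.nop_deriv R.Γ_Γ h.par (R.isConj_cur p _)
      ((h.cur _).of_eq rfl (by rw [Submodule.subtype_apply, hκ, zero_smul]) rfl) (h.ghDual _) (R.cur_ghDual _ _)).of_eq
      ?_ rfl rfl
    simp only [nopCur_apply, ← nopB_apply, map_neg, map_smul, sub_eq_add_neg, hA,
      coe_parPowPlus, Submodule.subtype_apply]
  refine (OPE.sum_right _ hj).of_eq ?_ Finset.sum_const_zero Finset.sum_const_zero
  have e := 𝔲.sum_bPlus_adjoint (R.nopCur ∘ₗ Q.parPowPlus p ∘ₗ Q.parityPlus)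
    (Q.parPowPlus p ∘ₗ M)
  simp only [LinearMap.comp_apply] at e
  rw [Finset.sum_sub_distrib, ← Finset.smul_sum, ← e, Finset.smul_sum, sub_eq_zero]
  refine Finset.sum_congr rfl fun j _ => ?_
  rw [← parPowPlus_parityPlus, parPowPlus_parPowPlus, hM, map_smul, LinearMap.smul_apply,
    smul_smul, sg_mul_self, one_smul]

/-- Rules out double contractions in the cubic term, so that no λ term arises there. -/
theorem gh_nop_ghDual_ghDual {a : Q.gPlus} {i j : 𝔲.S} (hi : 𝔲.bPlus.coord i a = 0)
    (hj : 𝔲.bPlus.coord j a = 0) : OPE R.Γ (R.gh a)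
      (nop R.Γ (R.ghDual (𝔲.bPlus.coord i)) (R.ghDual (𝔲.bPlus.coord j))) 0 0 0 := by
  classical
  rw [← 𝔲.bPlus.sum_repr a, map_sum]
  refine (OPE.sum_left (c₀ := fun _ => 0) (c₁ := fun _ => 0) (c₂ := fun _ => 0) _
    fun l _ => ?_).of_eq Finset.sum_const_zero Finset.sum_const_zero Finset.sum_const_zero
  rw [map_smul]
  by_cases hl : 𝔲.bPlus.repr a l = 0
  · rw [hl, zero_smul]
    exact OPE.zero_left _
  have hil : 𝔲.bPlus.coord i (𝔲.bPlus l) = 0 := by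
    have : l ≠ i := fun h => hl (h ▸ hi)
    simp [this]
  have hjl : 𝔲.bPlus.coord j (𝔲.bPlus l) = 0 := by
    have : l ≠ j := fun h => hl (h ▸ hj)
    simp [this]
  obtain ⟨q, hq⟩ := exists_sg_eq_neg (𝔲.par l)
  have h := OPE.nop_const R.Γ_Γ (R.fieldPar_gh hq (𝔲.parityPlus_bPlus l)) (R.isConj_ghDual q _)
    (R.gh_ghDual (𝔲.bPlus l) (𝔲.bPlus.coord i)) (R.gh_ghDual (𝔲.bPlus l) (𝔲.bPlus.coord j))
  rw [hil, hjl] at h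
  exact (h.smul_left _).of_eq (by simp) (smul_zero _) (smul_zero _)

theorem ActsBy.nop_ghDual_ghDual (h : R.ActsBy J p A M N κ) (ψ ψ' : Module.Dual ℂ Q.gPlus) :
    OPE R.Γ J (nop R.Γ (R.ghDual ψ) (R.ghDual ψ'))
      (-(sg p • nop R.Γ (R.ghDual (ψ ∘ₗ Q.parPowPlus p ∘ₗ M)) (R.ghDual ψ')) -
        nop R.Γ (R.ghDual (ψ ∘ₗ Q.parPowPlus p)) (R.ghDual (ψ' ∘ₗ Q.parPowPlus p ∘ₗ M))) 0 0 := by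
  refine (OPE.nop_deriv R.Γ_Γ h.par (R.isConj_ghDual p _) (h.ghDual _) (h.ghDual _) ?_).of_eq
    ?_ rfl rfl
  · rw [← map_smul, ← map_neg]
    exact R.ghDual_ghDual _ _
  · simp only [← nopB_apply, map_neg, map_smul, LinearMap.neg_apply, LinearMap.smul_apply,
      smul_smul, sg_mul_self, one_smul, sub_eq_add_neg]

theorem ActsBy.cubic (h : R.ActsBy J p A M N κ) (T : Q.gPlus →ₗ[ℂ] Q.gPlus →ₗ[ℂ] Q.gPlus)
    (h0 : ∀ i j, 𝔲.bPlus.coord i (M (T (𝔲.bPlus i) (𝔲.bPlus j))) = 0)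
    (h0' : ∀ i j, 𝔲.bPlus.coord j (M (T (𝔲.bPlus i) (𝔲.bPlus j))) = 0) :
    OPE R.Γ J (R.cubic 𝔲 T) (R.cubic 𝔲 (sg p • T.compr₂ M -
      (T.compr₂ (Q.parPowPlus p)).compl₁₂ (Q.parPowPlus p ∘ₗ M) LinearMap.id -
      sg p • (T.compr₂ (Q.parPowPlus p)).compl₁₂ (Q.parPowPlus p) (Q.parPowPlus p ∘ₗ M)))
      0 0 := by
  have hij : ∀ j ∈ Finset.univ, ∀ i ∈ Finset.univ, OPE R.Γ J
      (nopB R.Γ (R.gh (T (𝔲.bPlus i) (𝔲.bPlus j)))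
        (nopB R.Γ (R.ghDual (𝔲.bPlus.coord i)) (R.ghDual (𝔲.bPlus.coord j))))
      (sg p • nopB R.Γ (R.gh (T.compr₂ M (𝔲.bPlus i) (𝔲.bPlus j)))
          (nopB R.Γ (R.ghDual (𝔲.bPlus.coord i)) (R.ghDual (𝔲.bPlus.coord j))) -
        nopB R.Γ (R.gh (T.compr₂ (Q.parPowPlus p) (𝔲.bPlus i) (𝔲.bPlus j)))
          (nopB R.Γ (R.ghDual (𝔲.bPlus.coord i ∘ₗ Q.parPowPlus p ∘ₗ M))
            (R.ghDual (𝔲.bPlus.coord j ∘ₗ LinearMap.id))) -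
        sg p • nopB R.Γ (R.gh (T.compr₂ (Q.parPowPlus p) (𝔲.bPlus i) (𝔲.bPlus j)))
          (nopB R.Γ (R.ghDual (𝔲.bPlus.coord i ∘ₗ Q.parPowPlus p))
            (R.ghDual (𝔲.bPlus.coord j ∘ₗ Q.parPowPlus p ∘ₗ M)))) 0 0 := fun j _ i _ => by
    refine (OPE.nop_deriv R.Γ_Γ h.par (R.isConj_gh p _) (h.gh _) (h.nop_ghDual_ghDual _ _)
      ?_).of_eq ?_ rfl rfl
    · exact ((gh_nop_ghDual_ghDual 𝔲 (h0 i j) (h0' i j)).smul_left _).of_eq (smul_zero _)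
        (smul_zero _) (smul_zero _)
    · simp only [← nopB_apply, map_neg, map_smul, map_sub, LinearMap.smul_apply, smul_smul,
        sg_mul_self, one_smul, LinearMap.compr₂_apply, LinearMap.comp_id]
      abel
  refine (OPE.sum_right _ fun j hj => OPE.sum_right _ (hij j hj)).of_eq ?_ (by simp) (by simp)
  rw [cubic_sub, cubic_sub, map_smul, map_smul, cubic_compl, cubic_compl]
  simp only [Finset.sum_sub_distrib, ← Finset.smul_sum]
  rfl

/-- The Jacobi identity: ad v is a derivation of the bracket of g_+. This makes the three
contributions to the cubic term cancel. -/
theorem adPlus_brPlus {v : g} (hp : parity v = sg p • v) (hv : v ∈ gr Q.x 0) (a b : Q.gPlus) :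
    𝔲.adPlus v (brPlus 𝔲 a b) = brPlus 𝔲 a (𝔲.adPlus v b) +
      sg p • brPlus 𝔲 (𝔲.adPlus v a) (Q.parPowPlus p b) := by
  apply Subtype.ext
  have h0 : (0 : ℤ) ≤ 0 := le_rfl
  simp only [Submodule.coe_add, Submodule.coe_smul, coe_brPlus, 𝔲.coe_adPlus h0 hv,
    coe_parPowPlus]
  rw [br_br_of_parity hp, parity_br_of_parity hp, map_smul, smul_smul, sg_mul_self, one_smul]

theorem ActsBy.cubic_brPlus {v : g} (hp : parity v = sg p • v) (hv : v ∈ gr Q.x 0)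
    (h : R.ActsBy J p A (𝔲.adPlus v) N κ) : OPE R.Γ J (R.cubic 𝔲 (brPlus 𝔲)) 0 0 0 := by
  -- The degree of [v,[u_j,u_i]] is the sum of two positive degrees and exceeds both, so its
  -- coordinates at i and at j vanish. This supplies the condition excluding double contractions.
  have hT : ∀ i j : 𝔲.S, (𝔲.adPlus v (brPlus 𝔲 (𝔲.bPlus i) (𝔲.bPlus j)) : g) ∈
      gr Q.x (𝔲.deg i + 𝔲.deg j) := fun i j => by
    rw [𝔲.coe_adPlus le_rfl hv, coe_brPlus, show 𝔲.deg i + 𝔲.deg j = 0 + (𝔲.deg j + 𝔲.deg i) by ring]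
    refine Q.br_mem_gr hv (Q.br_mem_gr ?_ (Q.parity_mem_gr _ ?_))
    · rw [𝔲.bPlus_apply]; exact 𝔲.u_mem j
    · rw [𝔲.bPlus_apply]; exact 𝔲.u_mem i
  refine (h.cubic 𝔲 (brPlus 𝔲) (fun i j => ?_) fun i j => ?_).of_eq ?_ rfl rfl
  · rw [𝔲.bPlus_coord]
    exact 𝔲.coord_eq_zero (hT i j) (by have := j.2; omega)
  · rw [𝔲.bPlus_coord]
    exact 𝔲.coord_eq_zero (hT i j) (by have := i.2; omega)
  · rw [← map_zero (R.cubic 𝔲)]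
    congr 1
    refine LinearMap.ext fun a => LinearMap.ext fun b => ?_
    have hγ : ∀ a b, Q.parPowPlus p (brPlus 𝔲 a b) =
        brPlus 𝔲 (Q.parPowPlus p a) (Q.parPowPlus p b) := fun a b => by
      apply Subtype.ext
      simp only [coe_parPowPlus, coe_brPlus, parPow_br, parity_parPow]
    simp only [LinearMap.sub_apply, LinearMap.smul_apply, LinearMap.compr₂_apply,
      LinearMap.compl₁₂_apply, LinearMap.comp_apply, LinearMap.id_apply, hγ, parPowPlus_parPowPlus,
      adPlus_brPlus 𝔲 hp hv, LinearMap.zero_apply, smul_add, smul_smul, sg_mul_self, one_smul]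
    abel

/-- An operator of degree 0 maps each eigenspace of ad x to itself, so it commutes with the
projection. This is the invariance needed for the neutral part of d. -/
theorem projHalf_br {v : g} (hv : v ∈ gr Q.x 0) (a : g) :
    𝔲.projHalf (br v a) = 𝔲.projHalf (br v (𝔲.projHalf a : g)) := by
  have : 𝔲.projHalf ∘ₗ br v = 𝔲.projHalf ∘ₗ br v ∘ₗ Q.gHalf.subtype ∘ₗ 𝔲.projHalf := by
    refine 𝔲.u.ext fun i => ?_
    simp only [LinearMap.comp_apply, Submodule.subtype_apply]
    by_cases hi : 𝔲.deg i = 1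
    · rw [𝔲.coe_projHalf (Q.mem_gHalf hi (𝔲.u_mem i))]
    · have hz : ∀ a ∈ gr Q.x (𝔲.deg i), 𝔲.projHalf a = 0 := fun a ha => by
        rw [𝔲.projHalf_apply]
        refine Finset.sum_eq_zero fun j _ => ?_
        rw [𝔲.coord_eq_zero ha (by rw [j.2]; exact fun h => hi h.symm), zero_smul]
      have h1 := Q.br_mem_gr hv (𝔲.u_mem i)
      rw [zero_add] at h1
      rw [hz _ h1, hz _ (𝔲.u_mem i)]
      simp
  exact LinearMap.congr_fun this a

theorem plusToHalf_parPowPlus (q : ZMod 2) (a : Q.gPlus) :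
    plusToHalf 𝔲 (Q.parPowPlus q a) = Q.parPowHalf q (plusToHalf 𝔲 a) := by
  induction q using zmod_two_cases with
  | h0 => simp
  | h1 =>
    rw [parPowPlus_one, parPowHalf_one, plusToHalf, LinearMap.comp_apply, LinearMap.comp_apply,
      ← 𝔲.projHalf_parity]
    rfl

theorem ActsBy.dNe (h : R.ActsBy J p A M N κ) (hM : IsParPlus Q p M)
    (hN : ∀ a, plusToHalf 𝔲 (M a) = N (plusToHalf 𝔲 a)) : OPE R.Γ J (R.dNe 𝔲) 0 0 0 := by
  have hj : ∀ j ∈ Finset.univ, OPE R.Γ J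
      (R.nopNe (plusToHalf 𝔲 (𝔲.bPlus j)) (𝔲.bPlus.coord j))
      (R.nopNe (N (plusToHalf 𝔲 (𝔲.bPlus j))) (𝔲.bPlus.coord j ∘ₗ Q.parPowPlus p) -
        sg p • R.nopNe (plusToHalf 𝔲 (𝔲.bPlus j))
          (𝔲.bPlus.coord j ∘ₗ Q.parPowPlus p ∘ₗ M)) 0 0 := fun j _ => by
    refine (OPE.nop_deriv R.Γ_Γ h.par (R.isConj_ghDual p _) (h.ghDual _) (h.ghNe _) ?_).of_eq
      ?_ rfl rfl
    · rw [← map_smul, ← map_neg]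
      exact R.ghDual_ghNe _ _
    · simp only [nopNe_apply, ← nopB_apply, map_neg, map_smul, LinearMap.neg_apply,
        LinearMap.smul_apply, smul_smul, sg_mul_self, one_smul]
      abel
  refine (OPE.sum_right _ hj).of_eq ?_ Finset.sum_const_zero Finset.sum_const_zero
  have e1 := 𝔲.sum_bPlus_adjoint (R.nopNe ∘ₗ N ∘ₗ plusToHalf 𝔲) (Q.parPowPlus p)
  have e2 := 𝔲.sum_bPlus_adjoint (R.nopNe ∘ₗ plusToHalf 𝔲) (Q.parPowPlus p ∘ₗ M)
  simp only [LinearMap.comp_apply] at e1 e2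
  rw [Finset.sum_sub_distrib, ← Finset.smul_sum, ← e1, ← e2, Finset.smul_sum, sub_eq_zero]
  refine Finset.sum_congr rfl fun j _ => ?_
  rw [hM.parPowPlus_apply, ← hN, map_smul, map_smul, LinearMap.smul_apply, smul_smul, sg_self_mul,
    sg_mul_self, one_smul]

theorem ActsBy.ghDual_formF {v : g} (hp : parity v = sg p • v) (hv : v ∈ Q.centralizer₀)
    (h : R.ActsBy J p A (𝔲.adPlus v) N κ) : OPE R.Γ J (R.ghDual (formF Q)) 0 0 0 := by
  refine (h.ghDual _).of_eq ?_ rfl rfl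
  have : formF Q ∘ₗ Q.parPowPlus p ∘ₗ 𝔲.adPlus v = 0 := by
    ext1 a
    change Q.form Q.f (Q.parPowPlus p (𝔲.adPlus v a) : Q.gPlus) = 0
    rw [coe_parPowPlus, 𝔲.coe_adPlus le_rfl hv.1, parPow_br, parPow_of_parity p hp, map_smul,
      LinearMap.smul_apply, map_smul, Q.form_f_br_eq_zero hp hv, smul_zero]
  rw [this, map_zero, smul_zero, neg_zero]

/-- The bracket is taken in this order because J has a known action on every generator, while d does
not act linearly on them. -/
theorem Jcurly_d {v : g} (hp : parity v = sg p • v) (hv : v ∈ Q.centralizer₀) :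
    OPE R.Γ (R.Jcurly 𝔲 v) (R.d 𝔲) 0 0 0 := by
  have h := R.actsBy_Jcurly 𝔲 hp hv
  have h1 := h.dCur 𝔲 (isParPlus_adPlus 𝔲 hp) (fun a => (𝔲.coe_adPlus le_rfl hv.1 a).symm)
    (fun a => by
      have : Q.gPlus ≤ LinearMap.ker (Q.form v) := iSup_le fun n a ha =>
        Q.form_eq_zero hv.1 ha (by have := n.2; omega)
      rw [LinearMap.smul_apply, show Q.form v a = 0 from this a.2, smul_zero])
  have h2 := (h.cubic_brPlus 𝔲 hp hv.1).smul_right (1 / 2)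
  have h3 := h.ghDual_formF 𝔲 hp hv
  have h4 := h.dNe 𝔲 (isParPlus_adPlus 𝔲 hp) fun a => by
    change 𝔲.projHalf (𝔲.adPlus v a : g) = _
    rw [𝔲.coe_adPlus le_rfl hv.1, projHalf_br 𝔲 hv.1]
    rfl
  exact (((h1.add_right h2).add_right h3).add_right h4).of_eq (by simp) (by simp) (by simp)

/-- Each of the four tensors defining d is even and each summand has an odd number of
parity-reversed factors, so d is odd. Needed to exchange d and J, and to treat d_0 as an odd
operator. -/
theorem isConj_d (p : ZMod 2) : IsConj R.Γ p (R.d 𝔲) (sg p • R.d 𝔲) := by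
  have h1 : IsConj R.Γ p (R.dCur 𝔲) (sg p • R.dCur 𝔲) := by
    refine (IsConj.sum _ fun j _ => (R.isConj_cur p _).nop R.Γ_Γ (R.isConj_ghDual p _)).congr ?_
    have e := 𝔲.sum_bPlus_adjoint (R.nopCur ∘ₗ Q.parPowPlus p ∘ₗ Q.parityPlus) (Q.parPowPlus p)
    simp only [LinearMap.comp_apply, nopCur_apply, ← parPowPlus_parityPlus,
      parPowPlus_parPowPlus] at e
    simp only [dCur, nopCur_apply]
    rw [e, Finset.smul_sum]
    refine Finset.sum_congr rfl fun j _ => ?_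
    rw [← nopB_apply, map_smul, nopB_apply, coe_parPowPlus]
    rfl
  have h2 : IsConj R.Γ p (R.cubic 𝔲 (brPlus 𝔲)) (sg p • R.cubic 𝔲 (brPlus 𝔲)) := by
    refine (IsConj.sum _ fun j _ => IsConj.sum _ fun i _ => (R.isConj_gh p _).nop R.Γ_Γ
      ((R.isConj_ghDual p _).nop R.Γ_Γ (R.isConj_ghDual p _))).congr ?_
    have hT : brPlus 𝔲 = ((brPlus 𝔲).compr₂ (Q.parPowPlus p)).compl₁₂ (Q.parPowPlus p)
        (Q.parPowPlus p) := by
      refine LinearMap.ext fun a => LinearMap.ext fun b => Subtype.ext ?_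
      simp only [LinearMap.compr₂_apply, LinearMap.compl₁₂_apply, coe_parPowPlus, coe_brPlus,
        parPow_br, parPow_parPow, parity_parPow]
    conv_rhs => rw [hT]
    rw [cubic_compl, Finset.smul_sum]
    refine Finset.sum_congr rfl fun j _ => ?_
    rw [Finset.smul_sum]
    refine Finset.sum_congr rfl fun i _ => ?_
    simp only [← nopB_apply, map_smul, LinearMap.smul_apply, LinearMap.compr₂_apply, smul_smul,
      sg_mul_self, one_mul]
  have h3 : IsConj R.Γ p (R.ghDual (formF Q)) (sg p • R.ghDual (formF Q)) := by
    refine (R.isConj_ghDual p _).congr ?_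
    congr 2
    ext1 a
    change Q.form Q.f (Q.parPowPlus p a : Q.gPlus) = Q.form Q.f a
    rw [coe_parPowPlus, ← Q.form_parPow p, parPow_parPow, parPow_of_parity p Q.f_parity, mul_zero,
      sg_zero, one_smul]
  have h4 : IsConj R.Γ p (R.dNe 𝔲) (sg p • R.dNe 𝔲) := by
    refine (IsConj.sum _ fun j _ => (R.isConj_ghDual p _).nop R.Γ_Γ (R.isConj_ghNe p _)).congr ?_
    have e := 𝔲.sum_bPlus_adjoint (R.nopNe ∘ₗ Q.parPowHalf p ∘ₗ plusToHalf 𝔲) (Q.parPowPlus p)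
    simp only [LinearMap.comp_apply, nopNe_apply, plusToHalf_parPowPlus,
      parPowHalf_parPowHalf] at e
    simp only [dNe, nopNe_apply]
    rw [e, Finset.smul_sum]
    refine Finset.sum_congr rfl fun j _ => ?_
    rw [← nopB_apply, map_smul, LinearMap.smul_apply, nopB_apply]
  refine (((h1.add (h2.smul (1 / 2))).add h3).add h4).congr ?_
  rw [d]
  module

theorem d_Jcurly {v : g} (hv : v ∈ Q.centralizer₀) :
    OPE R.Γ (R.d 𝔲) (R.Jcurly 𝔲 v) 0 0 0 := by
  have key : ∀ (p : ZMod 2), ∀ v ∈ Q.centralizer₀, parity v = sg p • v →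
      OPE R.Γ (R.d 𝔲) (R.Jcurly 𝔲 v) 0 0 0 := fun p v hv hp => by
    have h := ((Jcurly_d (R := R) 𝔲 hp hv).skew R.Γ_Γ (R.actsBy_Jcurly 𝔲 hp hv).par
      (isConj_d 𝔲 p)).smul_left (sg p)
    rw [smul_smul, sg_mul_self, one_smul] at h
    exact h.of_eq (by simp [← derivL_apply]) (by simp [← derivL_apply]) (by simp)
  obtain ⟨v₀, v₁, rfl, h0, h1, p0, p1⟩ :=
    exists_parity_decomp Q.centralizer₀ (fun _ => parity_mem_centralizer) hv
  rw [map_add]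
  exact ((key 0 v₀ h0 p0).add_right (key 1 v₁ h1 p1)).of_eq (add_zero 0) (add_zero 0) (add_zero 0)

end FieldSystem
end ReductionData

/-! ### Wick rules adapted to energy-momentum fields. -/

section Generic

variable {V : Type*} [AddCommGroup V] [Module ℂ V] {Γ : Module.End ℂ V}

/-- The Leibniz rule for normally ordered products. -/
theorem deriv_nop (a b : VertexOperator ℂ V) :
    deriv (nop Γ a b) = nop Γ (deriv a) b + nop Γ a (deriv b) := field_ext fun m => by
  ext v
  simp only [ncoeff_deriv, ncoeff_nop, map_add, Pi.add_apply, LinearMap.add_apply,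
    LinearMap.smul_apply]
  obtain ⟨M, g1, g2, g3, g4, g5⟩ := ((nopMode_apply_eventually Γ a b (m - 1) v).and
    ((nopMode_apply_eventually Γ (deriv a) b m v).and
      ((nopMode_apply_eventually Γ a (deriv b) m v).and
        ((ncoeff_eventually b (m - 1) v).and (swapMul_eventually Γ a (-1) v))))).exists
  rw [g1, g2, g3, ← Finset.sum_add_distrib, Finset.smul_sum]
  -- Termwise the two sides of the Leibniz rule differ by (j+1)X_{j+1} - jX_j, for the creation and
  -- the annihilation part alike. The sums telescope, with no boundary term at 0 because of the
  -- factor j, and none at `M` by truncation.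
  have hA := Finset.sum_range_sub
    (fun j : ℕ => (j : ℂ) • (a[[-(j : ℤ) - 1]]) ((b[[m - 1 + j]]) v)) M
  have hB := Finset.sum_range_sub
    (fun j : ℕ => (j : ℂ) • swapMul Γ (a[[-1 + (j : ℤ)]]) (b[[m - j - 1]]) v) M
  simp only [g4, g5, map_zero, smul_zero, Nat.cast_zero, zero_smul, sub_zero] at hA hB
  rw [← sub_eq_zero, ← Finset.sum_sub_distrib, ← neg_eq_zero, ← Finset.sum_neg_distrib]
  refine Eq.trans ?_ ((congrArg₂ (· + ·) hA hB).trans (add_zero 0))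
  rw [← Finset.sum_add_distrib]
  refine Finset.sum_congr rfl fun j _ => ?_
  simp only [nopTerm, ncoeff_deriv, LinearMap.add_apply, Module.End.mul_apply, swapMul_smul_left,
    swapMul_smul_right, LinearMap.smul_apply, map_smul]
  rw [show -((j + 1 : ℕ) : ℤ) - 1 = -(j : ℤ) - 1 - 1 by push_cast; ring,
    show m - 1 + ((j + 1 : ℕ) : ℤ) = m + j by push_cast; ring,
    show -1 + ((j + 1 : ℕ) : ℤ) = j by push_cast; ring,
    show m - ((j + 1 : ℕ) : ℤ) - 1 = m - 1 - j - 1 by push_cast; ring,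
    show -1 + (j : ℤ) = j - 1 by ring, show m + (j : ℤ) - 1 = m - 1 + j by ring,
    show m - (j : ℤ) - 1 - 1 = m - 1 - j - 1 by ring]
  push_cast
  module

/-- Skew-symmetry for an even second factor. -/
theorem OPE.skew_even (hΓ : Γ * Γ = 1) {p : ZMod 2} {r L c₀ c₁ : VertexOperator ℂ V}
    (hr : FieldPar Γ p r) (hL : ∀ p, IsConj Γ p L L) (h : OPE Γ r L c₀ c₁ 0) :
    OPE Γ L r (-c₀ + deriv c₁) c₁ 0 := by
  refine (h.skew hΓ hr (hL p)).of_eq ?_ ?_ neg_zero <;> simp [← derivL_apply]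

theorem OPE.deriv_right_const {a b : VertexOperator ℂ V} {β : ℂ}
    (h : OPE Γ a b (β • oneField) 0 0) : OPE Γ a (deriv b) 0 (β • oneField) 0 := by
  refine h.deriv_right.of_eq ?_ ?_ rfl
  · rw [← derivL_apply, map_smul, derivL_apply, deriv_oneField, smul_zero]
  · rw [← derivL_apply, map_zero, add_zero]

/-- The Wick formula when the first factor has a constant double pole and the second one a constant
simple pole. -/
theorem OPE.nop_const_left (hΓ : Γ * Γ = 1) {p : ZMod 2} {a b b' c : VertexOperator ℂ V} {β γ : ℂ}
    (ha : FieldPar Γ p a) (hb : IsConj Γ p b b') (hab : OPE Γ a b 0 (β • oneField) 0)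
    (hac : OPE Γ a c (γ • oneField) 0 0) : OPE Γ a (QRed.nop Γ b c) (γ • b') (β • c) 0 := by
  have h1 : OPE Γ (β • oneField) c 0 0 0 :=
    ((OPE.one_left c hΓ).smul_left β).of_eq (smul_zero β) (smul_zero β) (smul_zero β)
  refine (OPE.nop hΓ ha hb hab hac (OPE.zero_left c) h1).of_eq ?_ ?_ ?_
  · simp only [← nopB_apply, map_smul, map_zero, LinearMap.zero_apply, zero_add]
    rw [nopB_apply, nop_oneField_right hΓ]
  · simp only [← nopB_apply, map_smul, map_zero, LinearMap.smul_apply, add_zero]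
    rw [nopB_apply, nop_oneField_left]
  · simp

/-- The Wick formula when the first factor has no pole and the second one a constant double
pole. -/
theorem OPE.nop_const_right (hΓ : Γ * Γ = 1) {p : ZMod 2} {a b b' c : VertexOperator ℂ V} {γ : ℂ}
    (ha : FieldPar Γ p a) (hb : IsConj Γ p b b') (hab : OPE Γ a b 0 0 0)
    (hac : OPE Γ a c 0 (γ • oneField) 0) : OPE Γ a (QRed.nop Γ b c) 0 (γ • b') 0 := by
  refine (OPE.nop hΓ ha hb hab hac (OPE.zero_left c) (OPE.zero_left c)).of_eq ?_ ?_ ?_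
  · simp only [← nopB_apply, map_zero, LinearMap.zero_apply, zero_add]
  · simp only [← nopB_apply, map_smul, map_zero, LinearMap.zero_apply, add_zero, zero_add]
    rw [nopB_apply, nop_oneField_right hΓ]
  · simp

/-- The action of an energy-momentum field on the normally ordered product of two free fields. -/
theorem OPE.nop_free (hΓ : Γ * Γ = 1) {L a b a₁ b₁ : VertexOperator ℂ V} {α β : ℂ}
    (hL : FieldPar Γ 0 L) (ha : OPE Γ L a (deriv a) a₁ 0) (hb : OPE Γ L b (deriv b) b₁ 0)
    (hab : OPE Γ a b (α • oneField) 0 0) (hab₁ : OPE Γ a₁ b (β • oneField) 0 0) :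
    OPE Γ L (QRed.nop Γ a b) (deriv (QRed.nop Γ a b)) (QRed.nop Γ a₁ b + QRed.nop Γ a b₁)
      ((β - 1 / 2 * α) • oneField) := by
  have ha0 : IsConj Γ 0 a a := fun n => (conj_zero_left _ _).symm
  refine (OPE.nop hΓ hL ha0 ha hb (hab.deriv_left.of_eq rfl rfl neg_zero) hab₁).of_eq ?_ ?_ ?_
  · rw [deriv_nop]
  · rw [add_zero]
  · module

end Generic

/-! ### The Sugawara field and the weights of the currents. -/

namespace ReductionData
namespace FieldSystem

variable {g : Type*} [AddCommGroup g] [Module ℂ g] [LieSuperalgebra g] {Q : ReductionData g}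
  {V : Type*} [AddCommGroup V] [Module ℂ V] (R : Q.FieldSystem V) {ι : Type*} [Fintype ι]
  (𝔲 : Q.AdaptedBasis ι)

/-- The Sugawara field without its normalization. -/
def sugawara : VertexOperator ℂ V :=
  ∑ i, sg (𝔲.par i) • nop R.Γ (R.cur (𝔲.u i)) (R.cur (𝔲.uDual i))

/-- The energy-momentum field of the charged ghosts. -/
def Lch : VertexOperator ℂ V :=
  ∑ i : 𝔲.S, (-𝔲.m i) • nop R.Γ (R.ghDual (𝔲.bPlus.coord i)) (deriv (R.gh (𝔲.bPlus i)))
  + ∑ i : 𝔲.S, (1 - 𝔲.m i) • nop R.Γ (deriv (R.ghDual (𝔲.bPlus.coord i))) (R.gh (𝔲.bPlus i))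

/-- The energy-momentum field of the neutral ghosts. -/
def Lne : VertexOperator ℂ V :=
  (1 / 2 : ℂ) • ∑ i, nop R.Γ (deriv (R.ghNe (𝔲.halfDual i))) (R.ghNe (𝔲.bHalf i))

/-- The energy-momentum field. -/
def L : VertexOperator ℂ V :=
  (2 * (Q.k + 𝔲.hDual))⁻¹ • R.sugawara 𝔲 + deriv (R.cur Q.x) + R.Lch 𝔲 + R.Lne 𝔲

theorem isConj_sugawara (p : ZMod 2) : IsConj R.Γ p (R.sugawara 𝔲) (R.sugawara 𝔲) := by
  refine (IsConj.sum _ fun j _ => ((R.isConj_cur p _).nop R.Γ_Γ (R.isConj_cur p _)).smul _).congr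
    (Finset.sum_congr rfl fun j _ => ?_)
  rw [parPow_of_parity p (𝔲.parity_u j), parPow_of_parity p (𝔲.parity_uDual j)]
  simp only [← nopB_apply, map_smul, LinearMap.smul_apply]
  rw [smul_smul (sg (p * 𝔲.par j)), sg_mul_self, one_smul]

theorem coord_comp_parPowPlus (p : ZMod 2) (i : 𝔲.S) :
    𝔲.bPlus.coord i ∘ₗ Q.parPowPlus p = sg (p * 𝔲.par i) • 𝔲.bPlus.coord i := by
  induction p using zmod_two_cases with
  | h0 => simp [parPowPlus, sg_zero]
  | h1 => rw [one_mul, ← coord_comp_parityPlus]; simp [parPowPlus]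

theorem isConj_gh_bPlus (p : ZMod 2) (i : 𝔲.S) :
    IsConj R.Γ p (R.gh (𝔲.bPlus i)) ((sg p * sg (p * 𝔲.par i)) • R.gh (𝔲.bPlus i)) :=
  (R.isConj_gh p _).congr (by
    rw [Q.parPowPlus_of_parity p (𝔲.parityPlus_bPlus i), map_smul, smul_smul])

theorem isConj_ghDual_coord (p : ZMod 2) (i : 𝔲.S) :
    IsConj R.Γ p (R.ghDual (𝔲.bPlus.coord i))
      ((sg p * sg (p * 𝔲.par i)) • R.ghDual (𝔲.bPlus.coord i)) :=
  (R.isConj_ghDual p _).congr (by rw [coord_comp_parPowPlus, map_smul, smul_smul])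

/-- φ_j and φ_j^* pick up the same sign under conjugation, so their products are invariant. -/
theorem isConj_Lch (p : ZMod 2) : IsConj R.Γ p (R.Lch 𝔲) (R.Lch 𝔲) := by
  have hs : ∀ j : 𝔲.S, sg p * sg (p * 𝔲.par j) * (sg p * sg (p * 𝔲.par j)) = 1 := fun j => by
    linear_combination sg (p * 𝔲.par j) * sg (p * 𝔲.par j) * sg_mul_self p +
      sg_mul_self (p * 𝔲.par j)
  have hn : ∀ (j : 𝔲.S) (a b : VertexOperator ℂ V),
      nop R.Γ ((sg p * sg (p * 𝔲.par j)) • a) ((sg p * sg (p * 𝔲.par j)) • b) = nop R.Γ a b :=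
    fun j a b => by
      rw [← nopB_apply, map_smul, map_smul, LinearMap.smul_apply, smul_smul, hs, one_smul,
        nopB_apply]
  have h1 : ∀ j ∈ (Finset.univ : Finset 𝔲.S), IsConj R.Γ p
      ((-𝔲.m j) • nop R.Γ (R.ghDual (𝔲.bPlus.coord j)) (deriv (R.gh (𝔲.bPlus j))))
      ((-𝔲.m j) • nop R.Γ (R.ghDual (𝔲.bPlus.coord j)) (deriv (R.gh (𝔲.bPlus j)))) := fun j _ => by
    refine (((R.isConj_ghDual_coord 𝔲 p j).nop R.Γ_Γ
      (R.isConj_gh_bPlus 𝔲 p j).deriv).smul _).congr ?_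
    rw [← derivL_apply, map_smul, hn, derivL_apply]
  have h2 : ∀ j ∈ (Finset.univ : Finset 𝔲.S), IsConj R.Γ p
      ((1 - 𝔲.m j) • nop R.Γ (deriv (R.ghDual (𝔲.bPlus.coord j))) (R.gh (𝔲.bPlus j)))
      ((1 - 𝔲.m j) • nop R.Γ (deriv (R.ghDual (𝔲.bPlus.coord j))) (R.gh (𝔲.bPlus j))) :=
    fun j _ => by
    refine (((R.isConj_ghDual_coord 𝔲 p j).deriv.nop R.Γ_Γ
      (R.isConj_gh_bPlus 𝔲 p j)).smul _).congr ?_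
    rw [← derivL_apply, map_smul, hn, derivL_apply]
  exact (IsConj.sum _ h1).add (IsConj.sum _ h2)

theorem isConj_Lne (p : ZMod 2) : IsConj R.Γ p (R.Lne 𝔲) (R.Lne 𝔲) := by
  refine ((IsConj.sum _ fun j _ => (R.isConj_ghNe p _).deriv.nop R.Γ_Γ
    (R.isConj_ghNe p _)).smul _).congr ?_
  have e := 𝔲.sum_bHalf_adjoint (((nopB R.Γ).compl₁₂ (derivL ∘ₗ R.ghNe) R.ghNe).flip ∘ₗ
    Q.parPowHalf p) (Q.parPowHalf p) (Q.parPowHalf p) (Q.formHalf_parPowHalf p)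
  simp only [LinearMap.comp_apply, LinearMap.flip_apply, LinearMap.compl₁₂_apply, nopB_apply,
    derivL_apply, parPowHalf_parPowHalf] at e
  rw [Lne, e]

theorem isConj_L (p : ZMod 2) : IsConj R.Γ p (R.L 𝔲) (R.L 𝔲) := by
  refine ((((R.isConj_sugawara 𝔲 p).smul _).add ((R.isConj_cur p Q.x).congr ?_).deriv).add
    (R.isConj_Lch 𝔲 p)).add (R.isConj_Lne 𝔲 p)
  rw [parPow_of_parity p Q.x_parity, mul_zero, sg_zero, one_smul]

theorem sum_form_cur {p : ZMod 2} {v : g} (hv : parity v = sg p • v) :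
    ∑ i, (sg (𝔲.par i) * Q.form v (𝔲.u i)) • 𝔲.uDual i = v := by
  conv_rhs => rw [← 𝔲.sum_form_u v]
  refine Finset.sum_congr rfl fun i _ => ?_
  rw [Q.form_symm_of_parity hv, parPow_of_parity p (𝔲.parity_u i), map_smul,
    LinearMap.smul_apply, smul_eq_mul]
  congr 1
  have h1 := Q.form_even (𝔲.u i) v
  rw [𝔲.parity_u, hv] at h1
  simp only [map_smul, LinearMap.smul_apply, smul_eq_mul] at h1
  generalize Q.form (𝔲.u i) v = z at h1 ⊢
  generalize 𝔲.par i = q at h1 ⊢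
  induction p using zmod_two_cases <;> induction q using zmod_two_cases <;>
    simp only [mul_zero, mul_one, sg_zero, sg_one, neg_mul, one_mul, neg_neg] at h1 ⊢ <;>
    linear_combination h1

theorem sum_form_cur' {p : ZMod 2} {v : g} (hv : parity v = sg p • v) :
    ∑ i, (sg (𝔲.par i) * Q.form v (𝔲.uDual i)) • parPow p (𝔲.u i) = v := by
  conv_rhs => rw [← 𝔲.sum_form_uDual v]
  refine Finset.sum_congr rfl fun i _ => ?_
  rw [parPow_of_parity p (𝔲.parity_u i), smul_smul]
  congr 1
  have h1 := Q.form_even v (𝔲.uDual i)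
  rw [𝔲.parity_uDual, hv] at h1
  simp only [map_smul, LinearMap.smul_apply, smul_eq_mul] at h1
  generalize Q.form v (𝔲.uDual i) = z at h1 ⊢
  generalize 𝔲.par i = q at h1 ⊢
  induction p using zmod_two_cases <;> induction q using zmod_two_cases <;>
    simp only [mul_zero, mul_one, sg_zero, sg_one, neg_mul, one_mul, neg_neg, mul_neg] at h1 ⊢ <;>
    linear_combination h1

/-- At λ⁰ the sum is zero by invariance of the Casimir element. At λ¹ the two single contractions
each give k v, and the double contraction gives the Casimir operator on v, that is 2h^∨ v. At λ²
stands `sum_form_br`, which is zero. -/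
theorem cur_sugawara [FiniteDimensional ℂ g] (hg : IsSimple g) {p : ZMod 2} {v : g}
    (hv : parity v = sg p • v) :
    OPE R.Γ (R.cur v) (R.sugawara 𝔲) 0 ((2 * (Q.k + 𝔲.hDual)) • R.cur v) 0 := by
  have hi : ∀ i ∈ Finset.univ, OPE R.Γ (R.cur v)
      (sg (𝔲.par i) • nop R.Γ (R.cur (𝔲.u i)) (R.cur (𝔲.uDual i)))
      (sg (𝔲.par i) • nop R.Γ (R.cur (br v (𝔲.u i))) (R.cur (𝔲.uDual i)) +
        sg (𝔲.par i) • nop R.Γ (R.cur (parPow p (𝔲.u i))) (R.cur (br v (𝔲.uDual i))))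
      (R.cur (Q.k • ((sg (𝔲.par i) * Q.form v (𝔲.u i)) • 𝔲.uDual i) +
        Q.k • ((sg (𝔲.par i) * Q.form v (𝔲.uDual i)) • parPow p (𝔲.u i)) +
        sg (𝔲.par i) • br (br v (𝔲.u i)) (𝔲.uDual i)))
      (((1 / 2 * Q.k) * (sg (𝔲.par i) * Q.form (br v (𝔲.u i)) (𝔲.uDual i))) • oneField) :=
    fun i _ => by
    have h1 : OPE R.Γ ((Q.k * Q.form v (𝔲.u i)) • oneField) (R.cur (𝔲.uDual i)) 0 0 0 :=
      ((OPE.one_left _ R.Γ_Γ).smul_left _).of_eq (smul_zero _) (smul_zero _) (smul_zero _)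
    refine ((OPE.nop R.Γ_Γ (R.fieldPar_cur hv) (R.isConj_cur p (𝔲.u i)) (R.cur_cur v (𝔲.u i))
      (R.cur_cur v (𝔲.uDual i)) (R.cur_cur _ _) h1).smul_right (sg (𝔲.par i))).of_eq ?_ ?_ ?_
    · rw [smul_add]
    · simp only [← nopB_apply, map_smul, LinearMap.smul_apply, map_add]
      rw [nopB_apply, nopB_apply, nop_oneField_left, nop_oneField_right R.Γ_Γ]
      module
    · rw [add_zero, smul_smul, smul_smul]
      congr 1
      ring
  refine (OPE.sum_right _ hi).of_eq ?_ ?_ ?_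
  · rw [Finset.sum_add_distrib]
    exact 𝔲.sum_casimir_invariant ((nopB R.Γ).compl₁₂ R.cur R.cur) hv
  · rw [← map_sum, ← map_smul]
    congr 1
    rw [Finset.sum_add_distrib, Finset.sum_add_distrib, ← Finset.smul_sum, ← Finset.smul_sum,
      sum_form_cur 𝔲 hv, sum_form_cur' 𝔲 hv, 𝔲.sum_br_br hv, 𝔲.casimir_eq hg]
    module
  · rw [← Finset.sum_smul, ← Finset.mul_sum, 𝔲.sum_form_br, mul_zero, zero_smul]

theorem sugawara_zero {p : ZMod 2} {r : VertexOperator ℂ V} (hr : FieldPar R.Γ p r)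
    (h0 : ∀ a, OPE R.Γ r (R.cur a) 0 0 0) : OPE R.Γ (R.sugawara 𝔲) r 0 0 0 := by
  have hi : ∀ i ∈ Finset.univ, OPE R.Γ r
      (sg (𝔲.par i) • nop R.Γ (R.cur (𝔲.u i)) (R.cur (𝔲.uDual i))) 0 0 0 := fun i _ =>
    ((OPE.nop_const (β := 0) (γ := 0) R.Γ_Γ hr (R.isConj_cur p _)
      ((h0 _).of_eq (zero_smul _ _).symm rfl rfl)
      ((h0 _).of_eq (zero_smul _ _).symm rfl rfl)).smul_right _).of_eq
      (by rw [zero_smul, zero_smul, zero_add, smul_zero]) (smul_zero _) (smul_zero _)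
  have h : OPE R.Γ r (R.sugawara 𝔲) 0 0 0 :=
    (OPE.sum_right _ hi).of_eq Finset.sum_const_zero Finset.sum_const_zero Finset.sum_const_zero
  exact (h.skew_even R.Γ_Γ hr (R.isConj_sugawara 𝔲)).of_eq (by simp [← derivL_apply]) rfl rfl

theorem Lch_zero {p : ZMod 2} {r : VertexOperator ℂ V} (hr : FieldPar R.Γ p r)
    (h0 : ∀ a, OPE R.Γ r (R.gh a) 0 0 0) (h1 : ∀ ψ, OPE R.Γ r (R.ghDual ψ) 0 0 0) :
    OPE R.Γ (R.Lch 𝔲) r 0 0 0 := by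
  have d0 : ∀ a, OPE R.Γ r (deriv (R.gh a)) ((0 : ℂ) • oneField) 0 0 := fun a =>
    ((h0 a).deriv_right).of_eq (by simp [← derivL_apply]) (by simp [← derivL_apply]) rfl
  have d1 : ∀ a, OPE R.Γ r (deriv (R.ghDual a)) ((0 : ℂ) • oneField) 0 0 := fun a =>
    ((h1 a).deriv_right).of_eq (by simp [← derivL_apply]) (by simp [← derivL_apply]) rfl
  have hi : ∀ i ∈ (Finset.univ : Finset 𝔲.S), OPE R.Γ r
      ((-𝔲.m i) • nop R.Γ (R.ghDual (𝔲.bPlus.coord i)) (deriv (R.gh (𝔲.bPlus i)))) 0 0 0 :=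
    fun i _ => ((OPE.nop_const (β := 0) R.Γ_Γ hr (R.isConj_ghDual p _)
      ((h1 _).of_eq (zero_smul _ _).symm rfl rfl) (d0 _)).smul_right _).of_eq
      (by rw [zero_smul, zero_smul, zero_add, smul_zero]) (smul_zero _) (smul_zero _)
  have hi' : ∀ i ∈ (Finset.univ : Finset 𝔲.S), OPE R.Γ r
      ((1 - 𝔲.m i) • nop R.Γ (deriv (R.ghDual (𝔲.bPlus.coord i))) (R.gh (𝔲.bPlus i))) 0 0 0 :=
    fun i _ => ((OPE.nop_const (γ := 0) R.Γ_Γ hr (R.isConj_ghDual p _).deriv (d1 _)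
      ((h0 _).of_eq (zero_smul _ _).symm rfl rfl)).smul_right _).of_eq
      (by rw [zero_smul, zero_smul, zero_add, smul_zero]) (smul_zero _) (smul_zero _)
  have h : OPE R.Γ r (R.Lch 𝔲) 0 0 0 :=
    ((OPE.sum_right _ hi).add_right (OPE.sum_right _ hi')).of_eq (by simp) (by simp) (by simp)
  exact (h.skew_even R.Γ_Γ hr (R.isConj_Lch 𝔲)).of_eq (by simp [← derivL_apply]) rfl rfl

theorem Lne_zero {p : ZMod 2} {r : VertexOperator ℂ V} (hr : FieldPar R.Γ p r)
    (h0 : ∀ a, OPE R.Γ r (R.ghNe a) 0 0 0) : OPE R.Γ (R.Lne 𝔲) r 0 0 0 := by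
  have d0 : ∀ a, OPE R.Γ r (deriv (R.ghNe a)) ((0 : ℂ) • oneField) 0 0 := fun a =>
    ((h0 a).deriv_right).of_eq (by simp [← derivL_apply]) (by simp [← derivL_apply]) rfl
  have hi : ∀ i ∈ Finset.univ, OPE R.Γ r
      (nop R.Γ (deriv (R.ghNe (𝔲.halfDual i))) (R.ghNe (𝔲.bHalf i))) 0 0 0 :=
    fun i _ => (OPE.nop_const (γ := 0) R.Γ_Γ hr (R.isConj_ghNe p _).deriv (d0 _)
      ((h0 _).of_eq (zero_smul _ _).symm rfl rfl)).of_eq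
      (by rw [zero_smul, zero_smul, zero_add]) rfl rfl
  have h : OPE R.Γ r (R.Lne 𝔲) 0 0 0 :=
    ((OPE.sum_right _ hi).smul_right _).of_eq (by simp) (by simp) (by simp)
  exact (h.skew_even R.Γ_Γ hr (R.isConj_Lne 𝔲)).of_eq (by simp [← derivL_apply]) rfl rfl

/-- After division by 2(k+h^∨), skew-symmetry gives every current weight 1 for the Sugawara field;
the remaining terms come from ∂x alone, since the ghost parts of L commute with currents. -/
theorem L_cur [FiniteDimensional ℂ g] (hg : IsSimple g) (hk : Q.k + 𝔲.hDual ≠ 0) (a : g) :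
    OPE R.Γ (R.L 𝔲) (R.cur a) (deriv (R.cur a)) (R.cur (a - br Q.x a))
      (-(Q.k * Q.form Q.x a) • oneField) := by
  refine (OPE.ext_basis 𝔲.u R.cur (derivL ∘ₗ R.cur) (R.cur ∘ₗ (LinearMap.id - br Q.x))
    ((-(Q.k • Q.form Q.x)).smulRight oneField) (fun i => ?_) a).of_eq rfl rfl rfl
  have hp := R.fieldPar_cur (𝔲.parity_u i)
  have h1 := (((R.cur_sugawara 𝔲 hg (𝔲.parity_u i)).skew_even R.Γ_Γ hp
    (R.isConj_sugawara 𝔲)).smul_left (2 * (Q.k + 𝔲.hDual))⁻¹)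
  -- [∂x_λ a] = -λ([x,a] + kλ(x|a)): the first term lowers the weight by the degree of a, the second
  -- is the anomaly.
  have h2 := (R.cur_cur Q.x (𝔲.u i)).deriv_left
  have h3 := R.Lch_zero 𝔲 hp (R.cur_gh _) (R.cur_ghDual _)
  have h4 := R.Lne_zero 𝔲 hp (R.cur_ghNe _)
  have hk2 : 2 * (Q.k + 𝔲.hDual) ≠ 0 := mul_ne_zero two_ne_zero hk
  have h := ((h1.add_left h2).add_left h3).add_left h4
  refine OPE.of_eq (a := R.L 𝔲) (b := R.cur (𝔲.u i)) h ?_ ?_ ?_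
  · simp only [← derivL_apply, map_smul, neg_zero, zero_add, add_zero, smul_smul,
      inv_mul_cancel₀ hk2, one_smul]
    rfl
  · simp only [add_zero, smul_smul, inv_mul_cancel₀ hk2, one_smul, ← sub_eq_add_neg]
    rw [← map_sub]
    rfl
  · simp only [smul_zero, zero_add, add_zero]
    exact (neg_smul (Q.k * Q.form Q.x (𝔲.u i)) oneField).symm

end FieldSystem
end ReductionData

/-! ### Weights of the ghosts, and the bracket of L with the fields J. -/

namespace ReductionData
namespace FieldSystem

variable {g : Type*} [AddCommGroup g] [Module ℂ g] [LieSuperalgebra g] {Q : ReductionData g}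
  {V : Type*} [AddCommGroup V] [Module ℂ V] (R : Q.FieldSystem V) {ι : Type*} [Fintype ι]
  (𝔲 : Q.AdaptedBasis ι)

/-- The first sum of L^ch contributes a derivative of φ, the second a λ term since the derivative
sits on the contracted factor. After skew-symmetry they combine to ∂φ with weight 1 - m. -/
theorem gh_Lch (l : 𝔲.S) {q : ZMod 2} (hq : sg q = -sg (𝔲.par l)) :
    OPE R.Γ (R.gh (𝔲.bPlus l)) (R.Lch 𝔲) (-𝔲.m l • deriv (R.gh (𝔲.bPlus l)))
      ((1 - 𝔲.m l) • R.gh (𝔲.bPlus l)) 0 := by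
  classical
  have hp := R.fieldPar_gh hq (𝔲.parityPlus_bPlus l)
  have d0 : ∀ a, OPE R.Γ (R.gh (𝔲.bPlus l)) (deriv (R.gh a)) ((0 : ℂ) • oneField) 0 0 := fun a =>
    ((R.gh_gh _ a).deriv_right).of_eq (by simp [← derivL_apply]) (by simp [← derivL_apply]) rfl
  have hi : ∀ i ∈ (Finset.univ : Finset 𝔲.S), OPE R.Γ (R.gh (𝔲.bPlus l))
      ((-𝔲.m i) • nop R.Γ (R.ghDual (𝔲.bPlus.coord i)) (deriv (R.gh (𝔲.bPlus i))))
      (𝔲.bPlus.coord i (𝔲.bPlus l) • (-𝔲.m i) • deriv (R.gh (𝔲.bPlus i))) 0 0 :=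
    fun i _ => ((OPE.nop_const R.Γ_Γ hp (R.isConj_ghDual q _)
      (R.gh_ghDual _ _) (d0 _)).smul_right _).of_eq
      (by rw [zero_smul, add_zero, smul_comm]) (smul_zero _) (smul_zero _)
  have hi' : ∀ i ∈ (Finset.univ : Finset 𝔲.S), OPE R.Γ (R.gh (𝔲.bPlus l))
      ((1 - 𝔲.m i) • nop R.Γ (deriv (R.ghDual (𝔲.bPlus.coord i))) (R.gh (𝔲.bPlus i))) 0
      (𝔲.bPlus.coord i (𝔲.bPlus l) • (1 - 𝔲.m i) • R.gh (𝔲.bPlus i)) 0 :=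
    fun i _ => ((OPE.nop_const_left (γ := 0) R.Γ_Γ hp (R.isConj_ghDual q _).deriv
      (R.gh_ghDual _ _).deriv_right_const
      ((R.gh_gh _ _).of_eq (zero_smul _ _).symm rfl rfl)).smul_right _).of_eq
      (by rw [zero_smul, smul_zero]) (smul_comm _ _ _) (smul_zero _)
  have hδ : ∀ F : 𝔲.S → VertexOperator ℂ V, ∑ i, 𝔲.bPlus.coord i (𝔲.bPlus l) • F i = F l :=
    fun F => by
    rw [Finset.sum_eq_single l (by
      intro j _ hj
      simp [hj.symm]) (by simp)]
    simp
  have h := (OPE.sum_right _ hi).add_right (OPE.sum_right _ hi')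
  rw [hδ, hδ] at h
  exact OPE.of_eq (b := R.Lch 𝔲) h (by simp) (by simp) (by simp)

/-- The roles of the two sums are exchanged as compared with φ, and the weight becomes m, so that
φ_i and φ_i^* have total weight 1. -/
theorem ghDual_Lch (l : 𝔲.S) {q : ZMod 2} (hq : sg q = -sg (𝔲.par l)) :
    OPE R.Γ (R.ghDual (𝔲.bPlus.coord l)) (R.Lch 𝔲)
      (-(1 - 𝔲.m l) • deriv (R.ghDual (𝔲.bPlus.coord l)))
      (𝔲.m l • R.ghDual (𝔲.bPlus.coord l)) 0 := by
  classical
  have hp := R.fieldPar_ghDual hq (coord_comp_parityPlus 𝔲 l)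
  have d1 : ∀ a, OPE R.Γ (R.ghDual (𝔲.bPlus.coord l)) (deriv (R.ghDual a))
      ((0 : ℂ) • oneField) 0 0 := fun a =>
    ((R.ghDual_ghDual _ a).deriv_right).of_eq (by simp [← derivL_apply])
      (by simp [← derivL_apply]) rfl
  have hi : ∀ i ∈ (Finset.univ : Finset 𝔲.S), OPE R.Γ (R.ghDual (𝔲.bPlus.coord l))
      ((-𝔲.m i) • nop R.Γ (R.ghDual (𝔲.bPlus.coord i)) (deriv (R.gh (𝔲.bPlus i)))) 0
      (𝔲.bPlus.coord l (Q.parityPlus (𝔲.bPlus i)) • (-𝔲.m i) •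
        (sg q * sg (q * 𝔲.par i)) • R.ghDual (𝔲.bPlus.coord i)) 0 :=
    fun i _ => ((OPE.nop_const_right R.Γ_Γ hp (R.isConj_ghDual_coord 𝔲 q i)
      (R.ghDual_ghDual _ _) (R.ghDual_gh _ _).deriv_right_const).smul_right _).of_eq
      (smul_zero _) (smul_comm _ _ _) (smul_zero _)
  have hi' : ∀ i ∈ (Finset.univ : Finset 𝔲.S), OPE R.Γ (R.ghDual (𝔲.bPlus.coord l))
      ((1 - 𝔲.m i) • nop R.Γ (deriv (R.ghDual (𝔲.bPlus.coord i))) (R.gh (𝔲.bPlus i)))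
      (𝔲.bPlus.coord l (Q.parityPlus (𝔲.bPlus i)) • (1 - 𝔲.m i) •
        deriv ((sg q * sg (q * 𝔲.par i)) • R.ghDual (𝔲.bPlus.coord i))) 0 0 :=
    fun i _ => ((OPE.nop_const R.Γ_Γ hp (R.isConj_ghDual_coord 𝔲 q i).deriv (d1 _)
      (R.ghDual_gh _ _)).smul_right _).of_eq
      (by rw [zero_smul, zero_add, smul_comm]) (smul_zero _) (smul_zero _)
  have hδ : ∀ F : 𝔲.S → VertexOperator ℂ V,
      ∑ i, 𝔲.bPlus.coord l (Q.parityPlus (𝔲.bPlus i)) • F i = sg (𝔲.par l) • F l :=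
    fun F => by
    rw [Finset.sum_eq_single l (by
      intro j _ hj
      simp [𝔲.parityPlus_bPlus, hj]) (by simp)]
    simp [𝔲.parityPlus_bPlus]
  have hs : sg (𝔲.par l) * (sg q * sg (q * 𝔲.par l)) = -1 := by
    generalize 𝔲.par l = r at hq ⊢
    induction q using zmod_two_cases <;> induction r using zmod_two_cases <;>
      simp only [mul_zero, mul_one, sg_zero, sg_one] at hq ⊢ <;>
      first | (exfalso; norm_num at hq; done) | norm_num
  have h := (OPE.sum_right _ hi).add_right (OPE.sum_right _ hi')
  rw [hδ, hδ] at h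
  refine OPE.of_eq (b := R.Lch 𝔲) h ?_ ?_ (by simp)
  · rw [← derivL_apply, map_smul, Finset.sum_const_zero, zero_add, derivL_apply, smul_smul,
      smul_smul]
    congr 1
    linear_combination (1 - 𝔲.m l) * hs
  · rw [Finset.sum_const_zero, add_zero, smul_smul, smul_smul]
    congr 1
    linear_combination (-𝔲.m l) * hs

/-- The two contractions yield a derivative term and a λ term, each with coefficient of modulus 1/2;
skew-symmetry adds the derivatives up to ∂Φ and leaves weight 1/2. -/
theorem ghNe_Lne (l : 𝔲.S') :
    OPE R.Γ (R.ghNe (𝔲.bHalf l)) (R.Lne 𝔲) ((-(1 / 2) : ℂ) • deriv (R.ghNe (𝔲.bHalf l)))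
      ((1 / 2 : ℂ) • R.ghNe (𝔲.bHalf l)) 0 := by
  classical
  have hp := R.fieldPar_ghNe (𝔲.parityHalf_bHalf l)
  have hi : ∀ i ∈ Finset.univ, OPE R.Γ (R.ghNe (𝔲.bHalf l))
      (nop R.Γ (deriv (R.ghNe (𝔲.halfDual i))) (R.ghNe (𝔲.bHalf i)))
      (Q.formHalf (𝔲.bHalf l) (𝔲.bHalf i) •
        deriv (R.ghNe (Q.parPowHalf (𝔲.par l) (𝔲.halfDual i))))
      (Q.formHalf (𝔲.bHalf l) (𝔲.halfDual i) • R.ghNe (𝔲.bHalf i)) 0 :=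
    fun i _ => OPE.nop_const_left R.Γ_Γ hp (R.isConj_ghNe _ _).deriv
      (R.ghNe_ghNe _ _).deriv_right_const (R.ghNe_ghNe _ _)
  refine OPE.of_eq (b := R.Lne 𝔲) ((OPE.sum_right _ hi).smul_right (1 / 2)) ?_ ?_ (by simp)
  · simp only [← derivL_apply, ← map_smul, ← map_sum]
    congr 2
    have e : ∀ i, Q.formHalf (𝔲.bHalf l) (𝔲.bHalf i) =
        -sg (𝔲.par l) * Q.formHalf (𝔲.bHalf i) (𝔲.bHalf l) := fun i => by
      rw [𝔲.formHalf_skew, 𝔲.parityHalf_bHalf, formHalf_smul_right, neg_mul]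
    simp only [e, ← smul_smul (-sg (𝔲.par l))]
    rw [← Finset.smul_sum, 𝔲.sum_formHalf_bHalf, map_smul, map_smul,
      Q.parPowHalf_of_parity _ (𝔲.parityHalf_bHalf l), sg_self_mul, smul_smul, smul_smul]
    congr 1
    linear_combination (-(1 / 2) : ℂ) * sg_mul_self (𝔲.par l)
  · congr 1
    rw [Finset.sum_eq_single l (by
      intro j _ hj
      simp [𝔲.formHalf_halfDual, hj.symm]) (by simp)]
    simp [𝔲.formHalf_halfDual]

theorem fieldPar_L : FieldPar R.Γ 0 (R.L 𝔲) :=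
  fieldPar_iff.2 ((R.isConj_L 𝔲 1).congr (by rw [sg_zero, one_smul]))

/-- The zero `λ`-brackets of the Sugawara field and of `∂x` with ghosts. -/
theorem sugawara_add_zero {p : ZMod 2} {r : VertexOperator ℂ V} (hr : FieldPar R.Γ p r)
    (h0 : ∀ a, OPE R.Γ r (R.cur a) 0 0 0) (h1 : OPE R.Γ (R.cur Q.x) r 0 0 0) :
    OPE R.Γ ((2 * (Q.k + 𝔲.hDual))⁻¹ • R.sugawara 𝔲 + deriv (R.cur Q.x)) r 0 0 0 :=
  (((R.sugawara_zero 𝔲 hr h0).smul_left _).add_left h1.deriv_left).of_eq (by simp) (by simp)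
    (by simp)

theorem L_gh (a : Q.gPlus) : OPE R.Γ (R.L 𝔲) (R.gh a) (deriv (R.gh a))
    (R.gh (a - 𝔲.adPlus Q.x a)) 0 := by
  refine (OPE.ext_basis 𝔲.bPlus R.gh (derivL ∘ₗ R.gh) (R.gh ∘ₗ (LinearMap.id - 𝔲.adPlus Q.x)) 0
    (fun i => ?_) a).of_eq rfl rfl rfl
  obtain ⟨q, hq⟩ := exists_sg_eq_neg (𝔲.par i)
  have hp := R.fieldPar_gh hq (𝔲.parityPlus_bPlus i)
  have h := ((R.sugawara_add_zero 𝔲 hp (R.gh_cur _) (R.cur_gh _ _)).add_left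
    ((R.gh_Lch 𝔲 i hq).skew_even R.Γ_Γ hp (R.isConj_Lch 𝔲))).add_left
    (R.Lne_zero 𝔲 hp (R.gh_ghNe _))
  refine OPE.of_eq (a := R.L 𝔲) (b := R.gh (𝔲.bPlus i)) h ?_ ?_ ?_
  · rw [← derivL_apply, ← derivL_apply, map_smul, LinearMap.comp_apply]
    module
  · rw [LinearMap.comp_apply, LinearMap.sub_apply, 𝔲.adPlus_x_bPlus, LinearMap.id_apply, map_sub,
      map_smul]
    module
  · simp

theorem L_ghDual (ψ : Module.Dual ℂ Q.gPlus) : OPE R.Γ (R.L 𝔲) (R.ghDual ψ)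
    (deriv (R.ghDual ψ)) (R.ghDual (ψ ∘ₗ 𝔲.adPlus Q.x)) 0 := by
  classical
  refine (OPE.ext_basis 𝔲.bPlus.dualBasis R.ghDual (derivL ∘ₗ R.ghDual)
    (R.ghDual ∘ₗ (𝔲.adPlus Q.x).dualMap) 0 (fun i => ?_) ψ).of_eq rfl rfl rfl
  obtain ⟨q, hq⟩ := exists_sg_eq_neg (𝔲.par i)
  have hp := R.fieldPar_ghDual hq (coord_comp_parityPlus 𝔲 i)
  have h := ((R.sugawara_add_zero 𝔲 hp (R.ghDual_cur _) (R.cur_ghDual _ _)).add_left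
    ((R.ghDual_Lch 𝔲 i hq).skew_even R.Γ_Γ hp (R.isConj_Lch 𝔲))).add_left
    (R.Lne_zero 𝔲 hp (R.ghDual_ghNe _))
  rw [Module.Basis.coe_dualBasis]
  refine OPE.of_eq (a := R.L 𝔲) (b := R.ghDual (𝔲.bPlus.coord i)) h ?_ ?_ ?_
  · rw [← derivL_apply, ← derivL_apply, map_smul, LinearMap.comp_apply]
    module
  · rw [LinearMap.comp_apply, LinearMap.dualMap_apply', 𝔲.bPlus_coord_adPlus_x, map_smul]
    module
  · simp

theorem L_ghNe (a : Q.gHalf) : OPE R.Γ (R.L 𝔲) (R.ghNe a) (deriv (R.ghNe a))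
    ((1 / 2 : ℂ) • R.ghNe a) 0 := by
  refine (OPE.ext_basis 𝔲.bHalf R.ghNe (derivL ∘ₗ R.ghNe) ((1 / 2 : ℂ) • R.ghNe) 0
    (fun i => ?_) a).of_eq rfl rfl rfl
  have hp := R.fieldPar_ghNe (𝔲.parityHalf_bHalf i)
  have h := ((R.sugawara_add_zero 𝔲 hp (R.ghNe_cur _) (R.cur_ghNe _ _)).add_left
    (R.Lch_zero 𝔲 hp (R.ghNe_gh _) (R.ghNe_ghDual _))).add_left
    ((R.ghNe_Lne 𝔲 i).skew_even R.Γ_Γ hp (R.isConj_Lne 𝔲))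
  refine OPE.of_eq (a := R.L 𝔲) (b := R.ghNe (𝔲.bHalf i)) h ?_ ?_ ?_
  · rw [← derivL_apply, ← derivL_apply, map_smul, LinearMap.comp_apply]
    module
  · rw [LinearMap.smul_apply]
    module
  · simp

/-- The ad x in the weight of φ and the one in the weight of φ^* combine into [ad x, ad v] = j ad v.
In the λ² term the weight contributes tr K - tr(ad x K) and the derivative on the first factor -½ tr
K, with K = Γ ad v. -/
theorem L_ch {n : ℤ} {v : g} (hv : v ∈ gr Q.x n) : OPE R.Γ (R.L 𝔲) (R.ch 𝔲 v)
    (deriv (R.ch 𝔲 v)) ((1 - (n : ℂ) / 2) • R.ch 𝔲 v)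
    ((1 / 2 * LinearMap.trace ℂ _ (Q.parityPlus ∘ₗ 𝔲.adPlus v) -
      LinearMap.trace ℂ _ (Q.parityPlus ∘ₗ 𝔲.adPlus Q.x ∘ₗ 𝔲.adPlus v)) • oneField) := by
  rw [ch_apply, quadPlus_apply]
  set K := Q.parityPlus ∘ₗ 𝔲.adPlus v with hK
  have hj : ∀ j ∈ Finset.univ, OPE R.Γ (R.L 𝔲)
      (nop R.Γ (R.gh (K (𝔲.bPlus j))) (R.ghDual (𝔲.bPlus.coord j)))
      (deriv (nop R.Γ (R.gh (K (𝔲.bPlus j))) (R.ghDual (𝔲.bPlus.coord j))))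
      (R.nopPlus (K (𝔲.bPlus j) - 𝔲.adPlus Q.x (K (𝔲.bPlus j))) (𝔲.bPlus.coord j) +
        R.nopPlus (K (𝔲.bPlus j)) (𝔲.bPlus.coord j ∘ₗ 𝔲.adPlus Q.x))
      ((𝔲.bPlus.coord j (K (𝔲.bPlus j) - 𝔲.adPlus Q.x (K (𝔲.bPlus j))) -
        1 / 2 * 𝔲.bPlus.coord j (K (𝔲.bPlus j))) • oneField) := fun j _ =>
    OPE.nop_free R.Γ_Γ (R.fieldPar_L 𝔲) (R.L_gh 𝔲 _) (R.L_ghDual 𝔲 _) (R.gh_ghDual _ _)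
      (R.gh_ghDual _ _)
  -- x is even, so Γ commutes with ad x and only the degree of v remains.
  have hX : ∀ a, K a - 𝔲.adPlus Q.x (K a) + K (𝔲.adPlus Q.x a) = (1 - (n : ℂ) / 2) • K a := by
    intro a
    have h1 := 𝔲.parityPlus_adPlus Q.x_parity (𝔲.adPlus v a)
    rw [sg_zero, one_smul, 𝔲.adPlus_x_adPlus hv, map_add, map_smul] at h1
    simp only [hK, LinearMap.comp_apply]
    rw [← h1]
    module
  refine (OPE.sum_right _ hj).of_eq ?_ ?_ ?_
  · simp only [← derivL_apply, map_sum]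
  · have e := 𝔲.sum_bPlus_adjoint (R.nopPlus ∘ₗ K) (𝔲.adPlus Q.x)
    simp only [LinearMap.comp_apply] at e
    rw [Finset.sum_add_distrib, ← e, ← Finset.sum_add_distrib, Finset.smul_sum]
    refine Finset.sum_congr rfl fun j _ => ?_
    rw [← LinearMap.add_apply, ← map_add, hX, map_smul, LinearMap.smul_apply, nopPlus_apply]
  · rw [← Finset.sum_smul, trace_eq_sum_coord 𝔲.bPlus, trace_eq_sum_coord 𝔲.bPlus,
      Finset.mul_sum, ← Finset.sum_sub_distrib]
    congr 1
    refine Finset.sum_congr rfl fun j _ => ?_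
    have h1 := 𝔲.parityPlus_adPlus Q.x_parity (𝔲.adPlus v (𝔲.bPlus j))
    rw [sg_zero, one_smul] at h1
    simp only [hK, LinearMap.comp_apply]
    rw [h1, map_sub]
    ring

/-- Both factors have weight 1/2, so the product has weight 1. The contributions of the weight and
of the derivative to λ² are ½ and -½ of the same contraction and cancel. -/
theorem L_ne (v : g) : OPE R.Γ (R.L 𝔲) (R.ne 𝔲 v) (deriv (R.ne 𝔲 v)) (R.ne 𝔲 v) 0 := by
  rw [ne_apply, quadHalf_apply]
  set K := Q.parityHalf ∘ₗ 𝔲.adHalf v with hK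
  have hj : ∀ j ∈ Finset.univ, OPE R.Γ (R.L 𝔲)
      (nop R.Γ (R.ghNe (K (𝔲.bHalf j))) (R.ghNe (𝔲.halfDual j)))
      (deriv (nop R.Γ (R.ghNe (K (𝔲.bHalf j))) (R.ghNe (𝔲.halfDual j))))
      (nop R.Γ (R.ghNe (K (𝔲.bHalf j))) (R.ghNe (𝔲.halfDual j))) 0 := fun j _ => by
    refine (OPE.nop_free (α := Q.formHalf (K (𝔲.bHalf j)) (𝔲.halfDual j))
      (β := 1 / 2 * Q.formHalf (K (𝔲.bHalf j)) (𝔲.halfDual j)) R.Γ_Γ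
      (R.fieldPar_L 𝔲) (R.L_ghNe 𝔲 _) (R.L_ghNe 𝔲 _)
      (R.ghNe_ghNe _ _) (((R.ghNe_ghNe _ _).smul_left (1 / 2)).of_eq (smul_smul _ _ _)
        (smul_zero _) (smul_zero _))).of_eq rfl ?_ ?_
    · simp only [← nopB_apply, map_smul, LinearMap.smul_apply]
      module
    · rw [sub_self, zero_smul]
  refine ((OPE.sum_right _ hj).smul_right _).of_eq ?_ rfl ?_
  · simp only [← derivL_apply, map_sum, map_smul]
  · simp

theorem L_Jround [FiniteDimensional ℂ g] (hg : IsSimple g) (hk : Q.k + 𝔲.hDual ≠ 0) {n : ℤ}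
    {v : g} (hv : v ∈ gr Q.x n) : OPE R.Γ (R.L 𝔲) (R.Jround 𝔲 v) (deriv (R.Jround 𝔲 v))
      ((1 - (n : ℂ) / 2) • R.Jround 𝔲 v)
      ((if n = 0 then 1 / 2 * strOn Q.gPlus (br v) - (Q.k + 𝔲.hDual) * Q.form v Q.x else 0) •
        oneField) := by
  refine OPE.of_eq (b := R.Jround 𝔲 v) ((R.L_cur 𝔲 hg hk v).add_right (R.L_ch 𝔲 hv)) ?_ ?_ ?_
  · rw [← derivL_apply, ← derivL_apply, ← map_add, derivL_apply]
    rfl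
  · rw [mem_gr_iff.1 hv, map_sub, map_smul, Jround, LinearMap.add_apply]
    module
  · rw [𝔲.trace_x_adPlus hg, ← add_smul]
    congr 1
    have hx : Q.form Q.x v = Q.form v Q.x := by
      rw [Q.form_symm_of_parity Q.x_parity, parPow_zero]
    rw [hx]
    split_ifs with h
    · subst h
      rw [𝔲.strOn_br hv]
      ring
    · rw [𝔲.trace_adPlus_eq_zero h hv, Q.form_eq_zero hv Q.x_mem (by rwa [add_zero])]
      ring

theorem L_Jcurly [FiniteDimensional ℂ g] (hg : IsSimple g) (hk : Q.k + 𝔲.hDual ≠ 0)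
    {v : g} (hv : v ∈ gr Q.x 0) : OPE R.Γ (R.L 𝔲) (R.Jcurly 𝔲 v) (deriv (R.Jcurly 𝔲 v))
      (R.Jcurly 𝔲 v)
      ((1 / 2 * strOn Q.gPlus (br v) - (Q.k + 𝔲.hDual) * Q.form v Q.x) • oneField) := by
  refine OPE.of_eq (b := R.Jcurly 𝔲 v) ((R.L_Jround 𝔲 hg hk hv).add_right (R.L_ne 𝔲 v)) ?_ ?_ ?_
  · rw [← derivL_apply, ← derivL_apply, ← map_add, derivL_apply]
    rfl
  · rw [Int.cast_zero, zero_div, sub_zero, one_smul]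
    rfl
  · rw [if_pos rfl, add_zero]

end FieldSystem
end ReductionData

/-! ### Comparison with the coordinate formulas for v^ch, v^ne and d. -/

namespace ReductionData
namespace FieldSystem

variable {g : Type*} [AddCommGroup g] [Module ℂ g] [LieSuperalgebra g] {Q : ReductionData g}
  {V : Type*} [AddCommGroup V] [Module ℂ V] (R : Q.FieldSystem V) {ι : Type*} [Fintype ι]
  (𝔲 : Q.AdaptedBasis ι)

/-- The overall minus sign and the reversed parity of φ_i combine to (-1)^{p(u_i)}, the eigenvalue
of Γ on u_i. -/
theorem ch_eq_sum (v : g) : R.ch 𝔲 v = -∑ i : 𝔲.S, ∑ j : 𝔲.S, (sg (𝔲.par i + 1) * 𝔲.c v i j) •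
    nop R.Γ (R.gh (𝔲.bPlus i)) (R.ghDual (𝔲.bPlus.coord j)) := by
  rw [ch_apply, quadPlus_apply, Finset.sum_comm, ← Finset.sum_neg_distrib]
  refine Finset.sum_congr rfl fun j _ => ?_
  rw [LinearMap.comp_apply, 𝔲.adPlus_bPlus]
  simp only [map_sum, map_smul, 𝔲.parityPlus_bPlus, ← nopB_apply, LinearMap.sum_apply,
    LinearMap.smul_apply, ← Finset.sum_neg_distrib, smul_smul]
  refine Finset.sum_congr rfl fun i _ => ?_
  rw [← neg_one_smul ℂ, smul_smul, sg_add, sg_one]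
  congr 1
  ring

theorem ne_eq_sum (v : g) : R.ne 𝔲 v = -((1 / 2 : ℂ) • ∑ i : 𝔲.S', ∑ j : 𝔲.S',
    (sg (𝔲.par i) * 𝔲.c v i j) •
      nop R.Γ (R.ghNe (𝔲.bHalf i)) (R.ghNe (𝔲.halfDual j))) := by
  have h : ∀ X : VertexOperator ℂ V, (-(1 / 2) : ℂ) • X = -((1 / 2 : ℂ) • X) :=
    fun X => neg_smul _ X
  rw [ne_apply, quadHalf_apply, Finset.sum_comm, h]
  congr 2
  refine Finset.sum_congr rfl fun j _ => ?_
  rw [LinearMap.comp_apply, 𝔲.adHalf_bHalf]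
  simp only [map_sum, map_smul, 𝔲.parityHalf_bHalf, ← nopB_apply, LinearMap.sum_apply,
    LinearMap.smul_apply, smul_smul]
  exact Finset.sum_congr rfl fun i _ => by rw [mul_comm]

theorem dCur_eq_sum : R.dCur 𝔲 = ∑ i : 𝔲.S, sg (𝔲.par i) •
    nop R.Γ (R.cur (𝔲.u i)) (R.ghDual (𝔲.bPlus.coord i)) := by
  refine Finset.sum_congr rfl fun i _ => ?_
  rw [𝔲.parityPlus_bPlus, map_smul, LinearMap.smul_apply, nopCur_apply, 𝔲.bPlus_apply]

/-- A structure constant is nonzero only if p(u_l) = p(u_i) + p(u_j). Then p(u_i)p(u_l) = p(u_i) +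
p(u_i)p(u_j), which is the sign from Γ together with that of skew-symmetry. -/
theorem brPlus_bPlus (i j : 𝔲.S) : brPlus 𝔲 (𝔲.bPlus i) (𝔲.bPlus j) =
    -∑ l : 𝔲.S, (sg (𝔲.par i * 𝔲.par l) * 𝔲.c (𝔲.u i) l j) • 𝔲.bPlus l := by
  refine 𝔲.bPlus.ext_elem fun l => ?_
  have h1 : 𝔲.bPlus.repr (brPlus 𝔲 (𝔲.bPlus i) (𝔲.bPlus j)) l =
      𝔲.u.coord l (br (𝔲.u j) (parity (𝔲.u i))) := by
    change 𝔲.bPlus.coord l _ = _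
    rw [𝔲.bPlus_coord, LinearMap.comp_apply, Submodule.subtype_apply, coe_brPlus, 𝔲.bPlus_apply,
      𝔲.bPlus_apply]
  classical
  have h2 : 𝔲.bPlus.repr (-∑ l : 𝔲.S, (sg (𝔲.par i * 𝔲.par l) * 𝔲.c (𝔲.u i) l j) • 𝔲.bPlus l) l =
      -(sg (𝔲.par i * 𝔲.par l) * 𝔲.c (𝔲.u i) l j) := by
    rw [map_neg, Finsupp.neg_apply, 𝔲.bPlus.repr_sum_self]
  rw [h1, h2, 𝔲.parity_u, map_smul, map_smul,
    LieSuperalgebra.skew _ _ _ _ (𝔲.parity_u j) (𝔲.parity_u i), map_neg, map_smul]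
  have h3 := 𝔲.coord_parity l (br (𝔲.u i) (𝔲.u j))
  rw [LieSuperalgebra.parity_br, 𝔲.parity_u, 𝔲.parity_u] at h3
  simp only [map_smul, LinearMap.smul_apply, smul_eq_mul] at h3 ⊢
  change _ = -(_ * 𝔲.u.coord l (br (𝔲.u i) (𝔲.u j)))
  generalize 𝔲.u.coord l (br (𝔲.u i) (𝔲.u j)) = z at h3 ⊢
  generalize 𝔲.par i = a at h3 ⊢
  generalize 𝔲.par j = b at h3 ⊢
  generalize 𝔲.par l = c at h3 ⊢
  induction a using zmod_two_cases <;> induction b using zmod_two_cases <;>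
    induction c using zmod_two_cases <;>
    simp only [mul_zero, mul_one, sg_zero, sg_one, one_mul] at h3 ⊢ <;>
    first | ring1 | linear_combination h3 | linear_combination -h3

theorem cubic_brPlus_eq_sum : R.cubic 𝔲 (brPlus 𝔲) = -∑ i : 𝔲.S, ∑ j : 𝔲.S, ∑ l : 𝔲.S,
    (sg (𝔲.par i * 𝔲.par l) * 𝔲.c (𝔲.u i) l j) • nop R.Γ (R.gh (𝔲.bPlus l))
      (nop R.Γ (R.ghDual (𝔲.bPlus.coord i)) (R.ghDual (𝔲.bPlus.coord j))) := by
  rw [cubic_apply, Finset.sum_comm, ← Finset.sum_neg_distrib]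
  refine Finset.sum_congr rfl fun i _ => ?_
  rw [← Finset.sum_neg_distrib]
  refine Finset.sum_congr rfl fun j _ => ?_
  rw [brPlus_bPlus]
  simp only [map_neg, map_sum, map_smul, LinearMap.neg_apply, LinearMap.sum_apply,
    LinearMap.smul_apply, nopB_apply]

theorem ghDual_formF_eq_sum :
    R.ghDual (formF Q) = ∑ i : 𝔲.S, Q.form Q.f (𝔲.u i) • R.ghDual (𝔲.bPlus.coord i) := by
  simp only [← map_smul, ← map_sum]
  congr 1
  refine 𝔲.bPlus.ext fun k => ?_
  classical
  rw [LinearMap.sum_apply, Finset.sum_eq_single k (by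
    intro j _ hj
    simp [hj.symm]) (by simp)]
  simp [formF, 𝔲.bPlus_apply]

theorem plusToHalf_bPlus (i : 𝔲.S) (hi : 𝔲.deg i = 1) :
    plusToHalf 𝔲 (𝔲.bPlus i) = 𝔲.bHalf ⟨i, hi⟩ := by
  apply Subtype.ext
  change (𝔲.projHalf (𝔲.bPlus i : g) : g) = _
  rw [𝔲.bPlus_apply, 𝔲.coe_projHalf (Q.mem_gHalf hi (𝔲.u_mem i)), 𝔲.bHalf_apply]

theorem plusToHalf_bPlus_of_ne (i : 𝔲.S) (hi : 𝔲.deg i ≠ 1) :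
    plusToHalf 𝔲 (𝔲.bPlus i) = 0 := by
  change 𝔲.projHalf (𝔲.bPlus i : g) = _
  rw [𝔲.bPlus_apply, 𝔲.projHalf_apply]
  refine Finset.sum_eq_zero fun j _ => ?_
  rw [𝔲.coord_eq_zero (𝔲.u_mem i) (by rw [j.2]; exact hi.symm), zero_smul]

/-- The projection onto g_{1/2} kills the basis vectors of other positive degrees, so the sum over
g_+ collapses. -/
theorem dNe_eq_sum : R.dNe 𝔲 = ∑ i : 𝔲.S',
    nop R.Γ (R.ghDual (𝔲.u.coord i ∘ₗ Q.gPlus.subtype)) (R.ghNe (𝔲.bHalf i)) := by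
  classical
  symm
  refine Finset.sum_of_injOn (fun i : 𝔲.S' => (⟨i.1, by rw [i.2]; exact one_pos⟩ : 𝔲.S))
    (fun i _ j _ h => Subtype.ext (congrArg (fun z : 𝔲.S => z.1) h)) (by simp) ?_ ?_
  · intro i _ hi
    rw [plusToHalf_bPlus_of_ne 𝔲 i (fun h => hi ⟨⟨i.1, h⟩, by simp, rfl⟩), map_zero,
      LinearMap.zero_apply]
  · intro i _
    rw [plusToHalf_bPlus 𝔲 _ i.2, 𝔲.bPlus_coord, nopNe_apply]

end FieldSystem
end ReductionData

/-! ### The complex as a system of currents and ghosts. -/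

namespace ReductionData

variable {g : Type*} [AddCommGroup g] [Module ℂ g] [LieSuperalgebra g] (Q : ReductionData g)

/-- The parity operator of the state space. -/
abbrev ΓC : Module.End ℂ Q.C := Q.currents.ΓV

theorem ΓC_mul_ΓC : Q.ΓC * Q.ΓC = 1 := Q.currents.ΓV_mul_ΓV

theorem currents_br (s t : Q.P) : Q.currents.br s t = (br s.1 t.1, 0, 0, 0) := rfl

theorem currents_α (s t : Q.P) : Q.currents.α s t =
    t.2.2.1 s.2.1 + s.2.2.1 (Q.parityPlus t.2.1) + Q.formHalf s.2.2.2 t.2.2.2 := rfl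

theorem currents_β (s t : Q.P) : Q.currents.β s t = Q.k * Q.form s.1 t.1 := rfl

theorem currents_Γ (s : Q.P) : Q.currents.Γ s =
    (parity s.1, -Q.parityPlus s.2.1, -(s.2.2.1 ∘ₗ Q.parityPlus), Q.parityHalf s.2.2.2) := rfl

theorem formHalf_zero_left (a : Q.gHalf) : Q.formHalf 0 a = 0 := by simp [formHalf]

theorem formHalf_zero_right (a : Q.gHalf) : Q.formHalf a 0 = 0 := by simp [formHalf]

theorem field_currents_zero : Q.currents.field (0, 0, 0, 0) = 0 := map_zero Q.currents.fieldL

/-- The currents as a linear map. -/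
def curL : g →ₗ[ℂ] Q.Fld := Q.currents.fieldL ∘ₗ LinearMap.inl ℂ _ _

/-- The charged ghosts in `Πg_+` as a linear map. -/
def ghL : Q.gPlus →ₗ[ℂ] Q.Fld :=
  Q.currents.fieldL ∘ₗ LinearMap.inr ℂ _ _ ∘ₗ LinearMap.inl ℂ _ _

/-- The charged ghosts in `Πg_+^*` as a linear map. -/
def ghDualL : Module.Dual ℂ Q.gPlus →ₗ[ℂ] Q.Fld :=
  Q.currents.fieldL ∘ₗ LinearMap.inr ℂ _ _ ∘ₗ LinearMap.inr ℂ _ _ ∘ₗ LinearMap.inl ℂ _ _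

/-- The neutral ghosts as a linear map. -/
def ghNeL : Q.gHalf →ₗ[ℂ] Q.Fld :=
  Q.currents.fieldL ∘ₗ LinearMap.inr ℂ _ _ ∘ₗ LinearMap.inr ℂ _ _ ∘ₗ LinearMap.inr ℂ _ _

theorem gh_smul (c : ℂ) (a : Q.gPlus) : Q.gh (c • a) = c • Q.gh a := map_smul Q.ghL c a

theorem ghDual_smul (c : ℂ) (ψ : Module.Dual ℂ Q.gPlus) :
    Q.ghDual (c • ψ) = c • Q.ghDual ψ := map_smul Q.ghDualL c ψ

theorem OPE_cur_cur (a b : g) :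
    OPE Q.ΓC (Q.cur a) (Q.cur b) (Q.cur (br a b)) ((Q.k * Q.form a b) • oneField) 0 :=
  (Q.currents.OPE_field _ _).of_eq
    (by simp [currents_br, currents_α, formHalf_zero_left, cur]) (by rw [currents_β]) rfl

theorem OPE_gh_ghDual (a : Q.gPlus) (ψ : Module.Dual ℂ Q.gPlus) :
    OPE Q.ΓC (Q.gh a) (Q.ghDual ψ) (ψ a • oneField) 0 0 :=
  (Q.currents.OPE_field _ _).of_eq
    (by simp [currents_br, currents_α, formHalf_zero_right,
      field_currents_zero]) (by simp [currents_β]) rfl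

theorem OPE_ghDual_gh (a : Q.gPlus) (ψ : Module.Dual ℂ Q.gPlus) :
    OPE Q.ΓC (Q.ghDual ψ) (Q.gh a) (ψ (Q.parityPlus a) • oneField) 0 0 :=
  (Q.currents.OPE_field _ _).of_eq
    (by simp [currents_br, currents_α, formHalf_zero_right,
      field_currents_zero]) (by simp [currents_β]) rfl

theorem OPE_ghNe_ghNe (a b : Q.gHalf) :
    OPE Q.ΓC (Q.ghNe a) (Q.ghNe b) (Q.formHalf a b • oneField) 0 0 :=
  (Q.currents.OPE_field _ _).of_eq
    (by simp [currents_br, currents_α, field_currents_zero]) (by simp [currents_β]) rfl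

section Orthogonal

variable (a : g) (b b' : Q.gPlus) (ψ ψ' : Module.Dual ℂ Q.gPlus) (c : Q.gHalf)

theorem OPE_cur_gh : OPE Q.ΓC (Q.cur a) (Q.gh b) 0 0 0 :=
  (Q.currents.OPE_field _ _).of_eq
    (by simp [currents_br, currents_α, formHalf_zero_right,
      field_currents_zero]) (by simp [currents_β]) rfl

theorem OPE_cur_ghDual : OPE Q.ΓC (Q.cur a) (Q.ghDual ψ) 0 0 0 :=
  (Q.currents.OPE_field _ _).of_eq
    (by simp [currents_br, currents_α, formHalf_zero_right,
      field_currents_zero]) (by simp [currents_β]) rfl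

theorem OPE_cur_ghNe : OPE Q.ΓC (Q.cur a) (Q.ghNe c) 0 0 0 :=
  (Q.currents.OPE_field _ _).of_eq
    (by simp [currents_br, currents_α, formHalf_zero_left,
      field_currents_zero]) (by simp [currents_β]) rfl

theorem OPE_gh_cur : OPE Q.ΓC (Q.gh b) (Q.cur a) 0 0 0 :=
  (Q.currents.OPE_field _ _).of_eq
    (by simp [currents_br, currents_α, formHalf_zero_right,
      field_currents_zero]) (by simp [currents_β]) rfl

theorem OPE_gh_gh : OPE Q.ΓC (Q.gh b) (Q.gh b') 0 0 0 :=
  (Q.currents.OPE_field _ _).of_eq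
    (by simp [currents_br, currents_α, formHalf_zero_right,
      field_currents_zero]) (by simp [currents_β]) rfl

theorem OPE_gh_ghNe : OPE Q.ΓC (Q.gh b) (Q.ghNe c) 0 0 0 :=
  (Q.currents.OPE_field _ _).of_eq
    (by simp [currents_br, currents_α, formHalf_zero_left,
      field_currents_zero]) (by simp [currents_β]) rfl

theorem OPE_ghDual_cur : OPE Q.ΓC (Q.ghDual ψ) (Q.cur a) 0 0 0 :=
  (Q.currents.OPE_field _ _).of_eq
    (by simp [currents_br, currents_α, formHalf_zero_right,
      field_currents_zero]) (by simp [currents_β]) rfl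

theorem OPE_ghDual_ghDual : OPE Q.ΓC (Q.ghDual ψ) (Q.ghDual ψ') 0 0 0 :=
  (Q.currents.OPE_field _ _).of_eq
    (by simp [currents_br, currents_α, formHalf_zero_right,
      field_currents_zero]) (by simp [currents_β]) rfl

theorem OPE_ghDual_ghNe : OPE Q.ΓC (Q.ghDual ψ) (Q.ghNe c) 0 0 0 :=
  (Q.currents.OPE_field _ _).of_eq
    (by simp [currents_br, currents_α, formHalf_zero_left,
      field_currents_zero]) (by simp [currents_β]) rfl

theorem OPE_ghNe_cur : OPE Q.ΓC (Q.ghNe c) (Q.cur a) 0 0 0 :=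
  (Q.currents.OPE_field _ _).of_eq
    (by simp [currents_br, currents_α, formHalf_zero_right,
      field_currents_zero]) (by simp [currents_β]) rfl

theorem OPE_ghNe_gh : OPE Q.ΓC (Q.ghNe c) (Q.gh b) 0 0 0 :=
  (Q.currents.OPE_field _ _).of_eq
    (by simp [currents_br, currents_α, formHalf_zero_right,
      field_currents_zero]) (by simp [currents_β]) rfl

theorem OPE_ghNe_ghDual : OPE Q.ΓC (Q.ghNe c) (Q.ghDual ψ) 0 0 0 :=
  (Q.currents.OPE_field _ _).of_eq
    (by simp [currents_br, currents_α, formHalf_zero_right,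
      field_currents_zero]) (by simp [currents_β]) rfl

end Orthogonal

theorem isConj_cur (p : ZMod 2) (a : g) : IsConj Q.ΓC p (Q.cur a) (Q.cur (parPow p a)) :=
  (Q.currents.isConj_field p _).congr (by
    induction p using zmod_two_cases <;> simp [CurrentData.ΓPow, cur, currents_Γ])

theorem isConj_gh (p : ZMod 2) (a : Q.gPlus) :
    IsConj Q.ΓC p (Q.gh a) (sg p • Q.gh (Q.parPowPlus p a)) :=
  (Q.currents.isConj_field p _).congr (by
    rw [← gh_smul]
    induction p using zmod_two_cases <;> simp [CurrentData.ΓPow, gh, currents_Γ, sg])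

theorem isConj_ghDual (p : ZMod 2) (ψ : Module.Dual ℂ Q.gPlus) :
    IsConj Q.ΓC p (Q.ghDual ψ) (sg p • Q.ghDual (ψ ∘ₗ Q.parPowPlus p)) :=
  (Q.currents.isConj_field p _).congr (by
    rw [← ghDual_smul]
    induction p using zmod_two_cases with
    | h0 => simp [CurrentData.ΓPow, ghDual, parPowPlus, sg]
    | h1 => simp [CurrentData.ΓPow, ghDual, currents_Γ, parPowPlus, sg])

theorem isConj_ghNe (p : ZMod 2) (a : Q.gHalf) :
    IsConj Q.ΓC p (Q.ghNe a) (Q.ghNe (Q.parPowHalf p a)) :=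
  (Q.currents.isConj_field p _).congr (by
    induction p using zmod_two_cases <;> simp [CurrentData.ΓPow, ghNe, currents_Γ])

/-- The generating fields of `C(g, x, f, k)`. -/
def system : Q.FieldSystem Q.C where
  Γ := Q.ΓC
  Γ_Γ := Q.ΓC_mul_ΓC
  cur := Q.curL
  gh := Q.ghL
  ghDual := Q.ghDualL
  ghNe := Q.ghNeL
  isConj_cur := Q.isConj_cur
  isConj_gh := Q.isConj_gh
  isConj_ghDual := Q.isConj_ghDual
  isConj_ghNe := Q.isConj_ghNe
  cur_cur := Q.OPE_cur_cur
  gh_ghDual := Q.OPE_gh_ghDual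
  ghDual_gh ψ a := Q.OPE_ghDual_gh a ψ
  ghNe_ghNe := Q.OPE_ghNe_ghNe
  cur_gh := Q.OPE_cur_gh
  cur_ghDual := Q.OPE_cur_ghDual
  cur_ghNe := Q.OPE_cur_ghNe
  gh_cur b a := Q.OPE_gh_cur a b
  gh_gh := Q.OPE_gh_gh
  gh_ghNe := Q.OPE_gh_ghNe
  ghDual_cur ψ a := Q.OPE_ghDual_cur a ψ
  ghDual_ghDual := Q.OPE_ghDual_ghDual
  ghDual_ghNe := Q.OPE_ghDual_ghNe
  ghNe_cur c a := Q.OPE_ghNe_cur a c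
  ghNe_gh c b := Q.OPE_ghNe_gh b c
  ghNe_ghDual c ψ := Q.OPE_ghNe_ghDual ψ c

/-- The index sets of the sums may be enumerated in different ways; the sums agree regardless. -/
theorem univ_eq_univ {α : Type*} (i₁ i₂ : Fintype α) :
    @Finset.univ α i₁ = @Finset.univ α i₂ := by rw [Subsingleton.elim i₁ i₂]

namespace AdaptedBasis

variable {Q} {ι : Type*} [Fintype ι] (𝔲 : Q.AdaptedBasis ι)

theorem φ_eq (i : 𝔲.S) : 𝔲.φ i = Q.system.gh (𝔲.bPlus i) :=
  congrArg Q.gh (Subtype.ext (𝔲.bPlus_apply i).symm)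

theorem φDual_eq (i : 𝔲.S) : 𝔲.φDual i = Q.system.ghDual (𝔲.bPlus.coord i) :=
  congrArg Q.ghDual (𝔲.bPlus_coord i).symm

theorem Φ_eq (i : 𝔲.S') : 𝔲.Φ i = Q.system.ghNe (𝔲.bHalf i) :=
  congrArg Q.ghNe (Subtype.ext (𝔲.bHalf_apply i).symm)

theorem no_congr {a b a' b' : Q.Fld} (ha : a = a') (hb : b = b') : Q.no a b = nop Q.ΓC a' b' :=
  congrArg₂ (nop Q.ΓC) ha hb

theorem vch_eq (v : g) : 𝔲.vch v = Q.system.ch 𝔲 v :=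
  Eq.trans (congrArg Neg.neg (Finset.sum_congr (univ_eq_univ _ _) fun i _ =>
    Finset.sum_congr (univ_eq_univ _ _) fun j _ =>
      congrArg ((sg (𝔲.par i + 1) * 𝔲.c v i j) • ·) (no_congr (𝔲.φ_eq i) (𝔲.φDual_eq j))))
    (Q.system.ch_eq_sum 𝔲 v).symm

theorem vne_eq (v : g) : 𝔲.vne v = Q.system.ne 𝔲 v :=
  Eq.trans (congrArg (fun X => -((1 / 2 : ℂ) • X)) (Finset.sum_congr (univ_eq_univ _ _) fun i _ =>
    Finset.sum_congr (univ_eq_univ _ _) fun j _ =>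
      congrArg ((sg (𝔲.par i) * 𝔲.c v i j) • ·) (no_congr (𝔲.Φ_eq i) rfl)))
    (Q.system.ne_eq_sum 𝔲 v).symm

theorem Jround_eq (v : g) : 𝔲.Jround v = Q.system.Jround 𝔲 v :=
  congrArg (Q.cur v + ·) (𝔲.vch_eq v)

theorem Jcurly_eq (v : g) : 𝔲.Jcurly v = Q.system.Jcurly 𝔲 v :=
  congrArg₂ (· + ·) (𝔲.Jround_eq v) (𝔲.vne_eq v)

theorem sum_no_cur_φDual : ∑ i : 𝔲.S, sg (𝔲.par i) • Q.no (Q.cur (𝔲.u i)) (𝔲.φDual i) =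
    Q.system.dCur 𝔲 :=
  Eq.trans (Finset.sum_congr rfl fun i _ =>
    congrArg (sg (𝔲.par i) • ·) (no_congr rfl (𝔲.φDual_eq i))) (Q.system.dCur_eq_sum 𝔲).symm

theorem sum_no_φ_φDual_φDual : -∑ i : 𝔲.S, ∑ j : 𝔲.S, ∑ l : 𝔲.S,
      (sg (𝔲.par i * 𝔲.par l) * 𝔲.c (𝔲.u i) l j) •
        Q.no (𝔲.φ l) (Q.no (𝔲.φDual i) (𝔲.φDual j)) =
      Q.system.cubic 𝔲 (FieldSystem.brPlus 𝔲) :=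
  Eq.trans (congrArg Neg.neg (Finset.sum_congr rfl fun i _ =>
    Finset.sum_congr rfl fun j _ => Finset.sum_congr rfl fun l _ =>
      congrArg ((sg (𝔲.par i * 𝔲.par l) * 𝔲.c (𝔲.u i) l j) • ·)
        (no_congr (𝔲.φ_eq l) (no_congr (𝔲.φDual_eq i) (𝔲.φDual_eq j)))))
    (Q.system.cubic_brPlus_eq_sum 𝔲).symm

theorem sum_form_φDual : ∑ i : 𝔲.S, Q.form Q.f (𝔲.u i) • 𝔲.φDual i =
    Q.system.ghDual (FieldSystem.formF Q) :=
  Eq.trans (Finset.sum_congr rfl fun i _ =>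
    congrArg (Q.form Q.f (𝔲.u i) • ·) (𝔲.φDual_eq i)) (Q.system.ghDual_formF_eq_sum 𝔲).symm

theorem sum_no_φDual_Φ : ∑ i : 𝔲.S', Q.no (𝔲.φDual i) (𝔲.Φ i) = Q.system.dNe 𝔲 :=
  Eq.trans (Finset.sum_congr rfl fun i _ => no_congr rfl (𝔲.Φ_eq i))
    (Q.system.dNe_eq_sum 𝔲).symm

theorem sub_half_smul {V : Type*} [AddCommGroup V] [Module ℂ V] {A B A' B' : V} (hA : A = A')
    (hB : -B = B') : A - (1 / 2 : ℂ) • B = A' + (1 / 2 : ℂ) • B' := by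
  rw [hA, ← hB, smul_neg, sub_eq_add_neg]

theorem d_eq : 𝔲.d = Q.system.d 𝔲 := by
  have h1 := 𝔲.sum_no_cur_φDual
  have h2 := 𝔲.sum_no_φ_φDual_φDual
  have h3 := 𝔲.sum_form_φDual
  have h4 := 𝔲.sum_no_φDual_Φ
  rw [univ_eq_univ (α := 𝔲.S) _ (Subtype.fintype _)] at h1 h2 h3
  rw [univ_eq_univ (α := 𝔲.S') _ (Subtype.fintype _)] at h4
  exact congrArg₂ (· + ·) (congrArg₂ (· + ·) (sub_half_smul h1 h2) h3) h4

theorem L_eq : 𝔲.L = Q.system.L 𝔲 := by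
  have h1 : 𝔲.Lch = Q.system.Lch 𝔲 := by
    refine congrArg₂ (· + ·) ?_ (Finset.sum_congr (univ_eq_univ _ _) fun i _ =>
      congrArg ((1 - 𝔲.m i) • ·) (no_congr (congrArg QRed.deriv (𝔲.φDual_eq i)) (𝔲.φ_eq i)))
    refine (Finset.sum_neg_distrib _).symm.trans
      (Finset.sum_congr (univ_eq_univ _ _) fun i _ => ?_)
    exact (neg_smul (𝔲.m i) _).symm.trans (congrArg ((-𝔲.m i) • ·)
      (no_congr (𝔲.φDual_eq i) (congrArg QRed.deriv (𝔲.φ_eq i))))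
  have h2 : 𝔲.Lne = Q.system.Lne 𝔲 :=
    congrArg ((1 / 2 : ℂ) • ·) (Finset.sum_congr (univ_eq_univ _ _) fun i _ =>
      no_congr rfl (𝔲.Φ_eq i))
  exact congrArg₂ (fun A B => 𝔲.Lg + QRed.deriv (Q.cur Q.x) + A + B) h1 h2

end AdaptedBasis
end ReductionData

theorem OPE.lbr_eq_linear {V : Type*} [AddCommGroup V] [Module ℂ V] {Γ : Module.End ℂ V}
    {a b c₀ c₁ : VertexOperator ℂ V} (h : OPE Γ a b c₀ c₁ 0) :
    lbr Γ a b = lam 0 c₀ + lam 1 c₁ := by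
  rw [h.lbr_eq, show lam 2 (0 : VertexOperator ℂ V) = 0 from Pi.single_zero 2, add_zero]

/-! ### Charge, and passage to homology. -/

section Shifts

variable {V : Type*} [AddCommGroup V] [Module ℂ V] (C : ℤ → Submodule ℂ V)

/-- The operator `X` shifts the grading `C` by `m`. -/
def Shifts (m : ℤ) (X : Module.End ℂ V) : Prop := ∀ n, ∀ v ∈ C n, X v ∈ C (n + m)

variable {C}

theorem Shifts.mul {p q r : ℤ} {X Y : Module.End ℂ V} (hX : Shifts C p X) (hY : Shifts C q Y)
    (h : p + q = r) : Shifts C r (X * Y) := fun n v hv => by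
  have := hX _ _ (hY n v hv)
  rwa [show n + q + p = n + r by omega] at this

theorem Shifts.add {p : ℤ} {X Y : Module.End ℂ V} (hX : Shifts C p X) (hY : Shifts C p Y) :
    Shifts C p (X + Y) := fun n v hv => add_mem (hX n v hv) (hY n v hv)

theorem Shifts.sub {p : ℤ} {X Y : Module.End ℂ V} (hX : Shifts C p X) (hY : Shifts C p Y) :
    Shifts C p (X - Y) := fun n v hv => sub_mem (hX n v hv) (hY n v hv)

theorem Shifts.smul (c : ℂ) {p : ℤ} {X : Module.End ℂ V} (hX : Shifts C p X) :
    Shifts C p (c • X) := fun n v hv => (C _).smul_mem c (hX n v hv)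

theorem Shifts.zero (p : ℤ) : Shifts C p 0 := fun _ _ _ => zero_mem _

theorem Shifts.conj {Γ : Module.End ℂ V} (hΓ : Shifts C 0 Γ) {p : ℤ} {X : Module.End ℂ V}
    (hX : Shifts C p X) : Shifts C p (Γ * X * Γ) :=
  (hΓ.mul hX (zero_add p)).mul hΓ (add_zero p)

theorem Shifts.swapMul {Γ : Module.End ℂ V} (hΓ : Shifts C 0 Γ) {p q r : ℤ}
    {X Y : Module.End ℂ V} (hX : Shifts C p X) (hY : Shifts C q Y) (h : p + q = r) :
    Shifts C r (swapMul Γ X Y) := by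
  have h' : q + p = r := (add_comm q p).trans h
  exact ((((hY.mul hX h').add ((hΓ.conj hY).mul hX h')).add (hY.mul (hΓ.conj hX) h')).sub
    ((hΓ.conj hY).mul (hΓ.conj hX) h')).smul _

variable (C) in
/-- All modes of the field `a` shift the grading `C` by `m`. -/
def FieldShifts (m : ℤ) (a : VertexOperator ℂ V) : Prop := ∀ n, Shifts C m (a[[n]])

theorem FieldShifts.add {m : ℤ} {a b : VertexOperator ℂ V} (ha : FieldShifts C m a)
    (hb : FieldShifts C m b) : FieldShifts C m (a + b) := fun n => (ha n).add (hb n)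

theorem FieldShifts.smul (c : ℂ) {m : ℤ} {a : VertexOperator ℂ V} (ha : FieldShifts C m a) :
    FieldShifts C m (c • a) := fun n => (ha n).smul c

theorem FieldShifts.zero (m : ℤ) : FieldShifts C m (0 : VertexOperator ℂ V) :=
  fun _ => Shifts.zero m

theorem FieldShifts.nop {Γ : Module.End ℂ V} (hΓ : Shifts C 0 Γ) {p q r : ℤ}
    {a b : VertexOperator ℂ V} (ha : FieldShifts C p a) (hb : FieldShifts C q b)
    (h : p + q = r) : FieldShifts C r (nop Γ a b) := fun n k v hv => by
  rw [ncoeff_nop]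
  refine finsum_induction (· ∈ C (k + r)) (zero_mem _) (fun _ _ => add_mem) fun j => ?_
  exact (((ha _).mul (hb _) h).add (hΓ.swapMul (ha _) (hb _) h)) k v hv

theorem IsConj.apply {Γ : Module.End ℂ V} (hΓ : Γ * Γ = 1) {b b' : VertexOperator ℂ V}
    (h : IsConj Γ 1 b b') (n : ℤ) (v : V) : Γ ((b[[n]]) v) = (b'[[n]]) (Γ v) := by
  have h2 : Γ (Γ v) = v := congrArg (fun X : Module.End ℂ V => X v) hΓ
  rw [h n, conj_one_left, Module.End.mul_apply, Module.End.mul_apply, h2]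

theorem mul_eq_conj_mul_of_scomm_eq_zero {Γ D X : Module.End ℂ V} (hD : IsPar Γ 1 D)
    (h : scomm Γ D X = 0) : D * X = (Γ * X * Γ) * D := by
  rwa [scomm_of_isPar hD, conj_one_left, sub_eq_zero] at h

/-- Conjugate the relation D X = (ΓXΓ) D by Γ and use that D is odd. This form shows that X
preserves the image of D, as the other one shows that it preserves the kernel. -/
theorem mul_eq_mul_conj_of_scomm_eq_zero {Γ D X : Module.End ℂ V} (hΓ : Γ * Γ = 1)
    (hD : IsPar Γ 1 D) (h : scomm Γ D X = 0) : X * D = D * (Γ * X * Γ) := by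
  have h1 := congrArg (fun Y => Γ * Y * Γ) (mul_eq_conj_mul_of_scomm_eq_zero hD h)
  have hD' : Γ * D * Γ = -D := by
    rw [hD, sg_one, neg_smul, one_smul]
  have e : ∀ Y, Γ * (Γ * Y) = Y := fun Y => by rw [← mul_assoc, hΓ, one_mul]
  have e1 : Γ * (D * X) * Γ = (Γ * D * Γ) * (Γ * X * Γ) := by simp only [mul_assoc, e]
  have e2 : Γ * ((Γ * X * Γ) * D) * Γ = X * (Γ * D * Γ) := by simp only [mul_assoc, e]
  change Γ * (D * X) * Γ = Γ * ((Γ * X * Γ) * D) * Γ at h1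
  rw [e1, e2, hD', neg_mul, mul_neg, neg_inj] at h1
  exact h1.symm

/-- A field whose modes preserve subspaces `Z` and `B` induces a field on `Z / (B ∩ Z)`. -/
theorem exists_induced_field (a : VertexOperator ℂ V) {Z B : Submodule ℂ V}
    (hZ : ∀ n, ∀ z ∈ Z, (a[[n]]) z ∈ Z) (hB : ∀ n, ∀ z ∈ B, (a[[n]]) z ∈ B) :
    ∃ F : VertexOperator ℂ (Z ⧸ B.submoduleOf Z), ∀ (n : ℤ) (z : Z), ∃ h : (a[[n]]) (z : V) ∈ Z,
      (F[[n]]) ((B.submoduleOf Z).mkQ z) = (B.submoduleOf Z).mkQ ⟨(a[[n]]) (z : V), h⟩ := by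
  let A : ℤ → Module.End ℂ (Z ⧸ B.submoduleOf Z) := fun n =>
    (B.submoduleOf Z).mapQ (B.submoduleOf Z) ((a[[n]]).restrict (hZ n)) fun z hz => hB n z hz
  refine ⟨mkField A fun w => ?_, fun n z => ⟨hZ n z z.2, by rw [ncoeff_mkField]; rfl⟩⟩
  obtain ⟨z, rfl⟩ := (B.submoduleOf Z).mkQ_surjective w
  obtain ⟨N, hN⟩ := exists_trunc a (z : V)
  refine ⟨N, fun n hn => ?_⟩
  change (B.submoduleOf Z).mkQ ((a[[n]]).restrict (hZ n) z) = 0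
  rw [show (a[[n]]).restrict (hZ n) z = 0 from Subtype.ext (hN n hn), map_zero]

end Shifts

namespace ReductionData

variable {g : Type*} [AddCommGroup g] [Module ℂ g] [LieSuperalgebra g] (Q : ReductionData g)

theorem fieldShifts_cur (a : g) : FieldShifts Q.charge 0 (Q.cur a) := fun n k v hv => by
  rw [add_zero]
  exact HasCharge.cur a n hv

theorem fieldShifts_gh (a : Q.gPlus) : FieldShifts Q.charge 1 (Q.gh a) :=
  fun n _ _ hv => HasCharge.gh a n hv

theorem fieldShifts_ghDual (ψ : Module.Dual ℂ Q.gPlus) :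
    FieldShifts Q.charge (-1) (Q.ghDual ψ) :=
  fun n _ _ hv => HasCharge.ghDual ψ n hv

theorem fieldShifts_ghNe (a : Q.gHalf) : FieldShifts Q.charge 0 (Q.ghNe a) := fun n k v hv => by
  rw [add_zero]
  exact HasCharge.ghNe a n hv

/-- Vectors of given charge are built from the vacuum by modes of generators, and Γ sends each
generator to one of the same kind and charge. It is needed because normally ordered products involve
Γ. -/
theorem shifts_ΓC : Shifts Q.charge 0 Q.ΓC := fun m v hv => by
  rw [add_zero]
  induction (hv : Q.HasCharge m v) with
  | vac => exact (congrArg (Q.HasCharge 0) Q.currents.ΓV_vac).mpr HasCharge.vac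
  | zero m => rw [map_zero]; exact zero_mem _
  | add hv hw ihv ihw => rw [map_add]; exact add_mem ihv ihw
  | smul c hv ih => rw [map_smul]; exact Submodule.smul_mem _ c ih
  | cur a n hv ih =>
    rw [IsConj.apply Q.ΓC_mul_ΓC (Q.isConj_cur 1 a)]
    exact HasCharge.cur _ n ih
  | gh a n hv ih =>
    rw [IsConj.apply Q.ΓC_mul_ΓC (Q.isConj_gh 1 a)]
    exact ((Q.fieldShifts_gh _).smul _) n _ _ ih
  | ghDual ψ n hv ih =>
    rw [IsConj.apply Q.ΓC_mul_ΓC (Q.isConj_ghDual 1 ψ)]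
    exact ((Q.fieldShifts_ghDual _).smul _) n _ _ ih
  | ghNe a n hv ih =>
    rw [IsConj.apply Q.ΓC_mul_ΓC (Q.isConj_ghNe 1 a)]
    exact HasCharge.ghNe _ n ih

variable {Q}

theorem IsVField.no {m m' n : ℤ} {a b : Q.Fld} (ha : Q.IsVField m a) (hb : Q.IsVField m' b)
    (h : m + m' = n) : Q.IsVField n (Q.no a b) := by
  subst h
  have := IsVField.nProd (-1) ha hb
  have e : QRed.nProd Q.ΓC (-1) a b = Q.no a b := by
    change ((Nat.factorial 0 : ℂ)⁻¹) • nop Q.ΓC a b = _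
    rw [Nat.factorial_zero, Nat.cast_one, inv_one]
    exact one_smul ℂ _
  exact e ▸ this

theorem IsVField.sum {α : Type*} (s : Finset α) {m : ℤ} {a : α → Q.Fld}
    (h : ∀ i ∈ s, Q.IsVField m (a i)) : Q.IsVField m (∑ i ∈ s, a i) :=
  Finset.sum_induction a (Q.IsVField m) (fun _ _ => IsVField.add) (IsVField.zero m) h

theorem IsVField.neg {m : ℤ} {a : Q.Fld} (h : Q.IsVField m a) : Q.IsVField m (-a) := by
  have e : (-1 : ℂ) • a = -a := neg_one_smul ℂ a
  exact e ▸ h.smul (-1)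

theorem fieldShifts_sum {α : Type*} (s : Finset α) {m : ℤ} {a : α → Q.Fld}
    (h : ∀ i ∈ s, FieldShifts Q.charge m (a i)) : FieldShifts Q.charge m (∑ i ∈ s, a i) :=
  Finset.sum_induction a (FieldShifts Q.charge m) (fun _ _ => FieldShifts.add)
    (FieldShifts.zero m) h

theorem fieldShifts_neg {m : ℤ} {a : Q.Fld} (h : FieldShifts Q.charge m a) :
    FieldShifts Q.charge m (-a) := by
  have e : (-1 : ℂ) • a = -a := neg_one_smul ℂ a
  exact e ▸ h.smul (-1)

theorem fieldShifts_no {p q r : ℤ} {a b : Q.Fld} (ha : FieldShifts Q.charge p a)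
    (hb : FieldShifts Q.charge q b) (h : p + q = r) : FieldShifts Q.charge r (Q.no a b) :=
  FieldShifts.nop Q.shifts_ΓC ha hb h

namespace AdaptedBasis

variable {ι : Type*} [Fintype ι] (𝔲 : Q.AdaptedBasis ι)

/-- Membership in the vertex algebra of fields is one requirement for a field of W_k; that its modes
preserve the charge of states is proved separately next, for the action on homology. -/
theorem isVField_Jcurly (v : g) : Q.IsVField 0 (𝔲.Jcurly v) := by
  refine ((IsVField.cur v).add (IsVField.sum _ fun i _ => IsVField.sum _ fun j _ =>
    IsVField.smul _ ?_).neg).add ((IsVField.sum _ fun i _ => IsVField.sum _ fun j _ =>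
    IsVField.smul _ ?_).smul _).neg
  · exact (IsVField.gh _).no (IsVField.ghDual _) rfl
  · exact (IsVField.ghNe _).no (IsVField.ghNe _) rfl

theorem fieldShifts_Jcurly (v : g) : FieldShifts Q.charge 0 (𝔲.Jcurly v) := by
  refine ((Q.fieldShifts_cur v).add (fieldShifts_neg (fieldShifts_sum _ fun i _ =>
    fieldShifts_sum _ fun j _ => FieldShifts.smul _ ?_))).add (fieldShifts_neg
    ((fieldShifts_sum _ fun i _ => fieldShifts_sum _ fun j _ => FieldShifts.smul _ ?_).smul _))
  · exact fieldShifts_no (Q.fieldShifts_gh _) (Q.fieldShifts_ghDual _) rfl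
  · exact fieldShifts_no (Q.fieldShifts_ghNe _) (Q.fieldShifts_ghNe _) rfl

theorem isPar_d₀ : IsPar Q.ΓC 1 𝔲.d₀ := by
  have h := FieldSystem.isConj_d (R := Q.system) 𝔲 1 0
  rw [conj_one_left] at h
  have e : 𝔲.d₀ = (Q.system.d 𝔲)[[0]] := congrArg (fun a : Q.Fld => a[[0]]) 𝔲.d_eq
  rw [e]
  exact h.symm

/-- A field of charge `0` that supercommutes with `d₀` induces a field on the homology. -/
theorem exists_isImage {a : Q.Fld} (ha : FieldShifts Q.charge 0 a)
    (hd : ∀ n, scomm Q.ΓC 𝔲.d₀ (a[[n]]) = 0) :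
    ∃ F : VertexOperator ℂ 𝔲.W, 𝔲.IsImage a F := by
  have h1 := fun n => mul_eq_conj_mul_of_scomm_eq_zero 𝔲.isPar_d₀ (hd n)
  have h2 := fun n => mul_eq_mul_conj_of_scomm_eq_zero Q.ΓC_mul_ΓC 𝔲.isPar_d₀ (hd n)
  have hZ : ∀ n, ∀ z ∈ 𝔲.Z₀, (a[[n]]) z ∈ 𝔲.Z₀ := fun n z hz => by
    refine ⟨?_, by simpa using ha n 0 z hz.2⟩
    have := congrArg (fun X : Module.End ℂ Q.C => X z) (h1 n)
    change 𝔲.d₀ ((a[[n]]) z) = (Q.ΓC * a[[n]] * Q.ΓC) (𝔲.d₀ z) at this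
    rw [LinearMap.mem_ker.1 hz.1, map_zero] at this
    exact this
  have hB : ∀ n, ∀ z ∈ 𝔲.B₀, (a[[n]]) z ∈ 𝔲.B₀ := fun n z hz => by
    obtain ⟨w, hw, rfl⟩ := hz
    -- A boundary d_0 w goes to d_0 applied to the conjugated mode acting on w, and that vector
    -- again has charge 1.
    refine ⟨(Q.ΓC * a[[n]] * Q.ΓC) w, by simpa using Q.shifts_ΓC.conj (ha n) 1 w hw, ?_⟩
    exact (congrArg (fun X : Module.End ℂ Q.C => X w) (h2 n)).symm
  exact exists_induced_field a hZ hB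

theorem OPE_d_Jcurly {v : g} (hv : v ∈ Q.centralizer₀) :
    OPE Q.ΓC 𝔲.d (𝔲.Jcurly v) 0 0 0 := by
  have h := FieldSystem.d_Jcurly (R := Q.system) 𝔲 hv
  rwa [← 𝔲.d_eq, ← 𝔲.Jcurly_eq] at h

/-- The commutator formula with the first mode index equal to 0. -/
theorem scomm_d₀_Jcurly {v : g} (hv : v ∈ Q.centralizer₀) (n : ℤ) :
    scomm Q.ΓC 𝔲.d₀ ((𝔲.Jcurly v)[[n]]) = 0 :=
  ((𝔲.OPE_d_Jcurly hv) 0 n).trans (by simp)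

theorem bracket_d_Jcurly {v : g} (hv : v ∈ Q.centralizer₀) :
    Q.bracket 𝔲.d (𝔲.Jcurly v) = 0 := by
  refine (𝔲.OPE_d_Jcurly hv).lbr_eq.trans ?_
  simp only [lam, Pi.single_zero, add_zero]

theorem exists_isWField_Jcurly {v : g} (hv : v ∈ Q.centralizer₀) :
    ∃ F : VertexOperator ℂ 𝔲.W, 𝔲.IsWField F ∧ 𝔲.IsImage (𝔲.Jcurly v) F := by
  obtain ⟨F, hF⟩ := 𝔲.exists_isImage (𝔲.fieldShifts_Jcurly v) (𝔲.scomm_d₀_Jcurly hv)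
  exact ⟨F, ⟨𝔲.Jcurly v, 𝔲.isVField_Jcurly v, 𝔲.scomm_d₀_Jcurly hv, hF⟩, hF⟩

theorem bracket_L_Jround [FiniteDimensional ℂ g] (hg : IsSimple g) (hk : Q.k + 𝔲.hDual ≠ 0)
    {n : ℤ} {v : g} (hv : v ∈ gr Q.x n) :
    Q.bracket 𝔲.L (𝔲.Jround v) =
      lam 0 (QRed.deriv (𝔲.Jround v)) + lam 1 ((1 - (n : ℂ) / 2) • 𝔲.Jround v) +
      lam 2 ((if n = 0 then 1 / 2 * strOn Q.gPlus (br v)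
        - (Q.k + 𝔲.hDual) * Q.form v Q.x else 0) • oneField) := by
  rw [𝔲.L_eq, 𝔲.Jround_eq]
  exact (Q.system.L_Jround 𝔲 hg hk hv).lbr_eq

theorem bracket_L_Jcurly [FiniteDimensional ℂ g] (hg : IsSimple g) (hk : Q.k + 𝔲.hDual ≠ 0)
    {v : g} (hv : v ∈ gr Q.x 0) :
    Q.bracket 𝔲.L (𝔲.Jcurly v) =
      lam 0 (QRed.deriv (𝔲.Jcurly v)) + lam 1 (𝔲.Jcurly v) +
      lam 2 ((1 / 2 * strOn Q.gPlus (br v)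
        - (Q.k + 𝔲.hDual) * Q.form v Q.x) • oneField) := by
  rw [𝔲.L_eq, 𝔲.Jcurly_eq]
  exact (Q.system.L_Jcurly 𝔲 hg hk hv).lbr_eq

set_option maxHeartbeats 1000000 in
theorem bracket_Jcurly_Jcurly {v v' : g} (hv : v ∈ Q.centralizer₀) (hv' : v' ∈ Q.centralizer₀) :
    Q.bracket (𝔲.Jcurly v) (𝔲.Jcurly v') =
      lam 0 (𝔲.Jcurly (br v v')) +
      lam 1 ((Q.k * Q.form v v' + strOn Q.gPlus (br v ∘ₗ br v')
        - 1 / 2 * strOn Q.gHalf (br v ∘ₗ br v')) • oneField) := by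
  have h := Q.system.Jcurly_Jcurly 𝔲 hv hv'.1
  rw [← 𝔲.Jcurly_eq v, ← 𝔲.Jcurly_eq v', ← 𝔲.Jcurly_eq (br v v')] at h
  exact h.lbr_eq_linear

set_option maxHeartbeats 1000000 in
theorem bracket_Jround_Jround {m n : ℤ} (hmn : 0 ≤ m * n) {v v' : g} (hv : v ∈ gr Q.x m)
    (hv' : v' ∈ gr Q.x n) :
    Q.bracket (𝔲.Jround v) (𝔲.Jround v') =
      lam 0 (𝔲.Jround (br v v')) +
      lam 1 ((if m = 0 ∧ n = 0 then Q.k * Q.form v v'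
        + strOn Q.gPlus (br v ∘ₗ br v') else 0) • oneField) := by
  have h := Q.system.Jround_Jround 𝔲 hmn hv hv'
  rw [← 𝔲.Jround_eq v, ← 𝔲.Jround_eq v', ← 𝔲.Jround_eq (br v v')] at h
  exact h.lbr_eq_linear

end AdaptedBasis
end ReductionData

end QRed
end

open QRed in
/-- The fields `J^{{v}}` and `J^{(v)}` of the quantum reduction. -/
theorem theorem2p4 {g : Type*} [AddCommGroup g] [Module ℂ g] [FiniteDimensional ℂ g]
    [LieSuperalgebra g] (hg : IsSimple g) (Q : ReductionData g)
    {ι : Type*} [Fintype ι] (𝔲 : Q.AdaptedBasis ι) (hk : Q.k + 𝔲.hDual ≠ 0) :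
    -- (a)
    (∀ v ∈ Q.centralizer₀,
      Q.bracket 𝔲.d (𝔲.Jcurly v) = 0 ∧
      ∃ F : VertexOperator ℂ 𝔲.W, 𝔲.IsWField F ∧ 𝔲.IsImage (𝔲.Jcurly v) F) ∧
    -- (b)
    (∀ (n : ℤ), ∀ v ∈ gr Q.x n,
      Q.bracket 𝔲.L (𝔲.Jround v) =
        lam 0 (deriv (𝔲.Jround v)) + lam 1 ((1 - (n : ℂ) / 2) • 𝔲.Jround v) +
        lam 2 ((if n = 0 then 1 / 2 * strOn Q.gPlus (LieSuperalgebra.br v)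
          - (Q.k + 𝔲.hDual) * Q.form v Q.x else 0) • oneField)) ∧
    (∀ v ∈ gr Q.x 0,
      Q.bracket 𝔲.L (𝔲.Jcurly v) =
        lam 0 (deriv (𝔲.Jcurly v)) + lam 1 (𝔲.Jcurly v) +
        lam 2 ((1 / 2 * strOn Q.gPlus (LieSuperalgebra.br v)
          - (Q.k + 𝔲.hDual) * Q.form v Q.x) • oneField)) ∧
    -- (c)
    (∀ v ∈ Q.centralizer₀, ∀ v' ∈ Q.centralizer₀,
      Q.bracket (𝔲.Jcurly v) (𝔲.Jcurly v') =
        lam 0 (𝔲.Jcurly (LieSuperalgebra.br v v')) +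
        lam 1 ((Q.k * Q.form v v'
          + strOn Q.gPlus (LieSuperalgebra.br v ∘ₗ LieSuperalgebra.br v')
          - 1 / 2 * strOn Q.gHalf (LieSuperalgebra.br v ∘ₗ LieSuperalgebra.br v')) • oneField)) ∧
    (∀ (m n : ℤ), 0 ≤ m * n → ∀ v ∈ gr Q.x m, ∀ v' ∈ gr Q.x n,
      Q.bracket (𝔲.Jround v) (𝔲.Jround v') =
        lam 0 (𝔲.Jround (LieSuperalgebra.br v v')) +
        lam 1 ((if m = 0 ∧ n = 0 then Q.k * Q.form v v'
          + strOn Q.gPlus (LieSuperalgebra.br v ∘ₗ LieSuperalgebra.br v') else 0) •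
            oneField)) := by
  refine ⟨fun v hv => ⟨?_, ?_⟩, fun n v hv => ?_, fun v hv => ?_, fun v hv v' hv' => ?_,
    fun m n hmn v hv v' hv' => ?_⟩
  · exact 𝔲.bracket_d_Jcurly hv
  · exact 𝔲.exists_isWField_Jcurly hv
  · exact 𝔲.bracket_L_Jround hg hk hv
  · exact 𝔲.bracket_L_Jcurly hg hk hv
  · exact 𝔲.bracket_Jcurly_Jcurly hv hv'
  · exact 𝔲.bracket_Jround_Jround hmn hv hv'
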